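/- Let $K$ be a field, let $S=K[x_1,\ldots,x_n,y_1,\ldots,y_m]$ ($n,m\ge 0$) be the polynomial ring with the bigrading $\deg x_i=(1,0)$, $\deg y_j=(0,1)$, let $J\subset S$ be a bihomogeneous ideal, and let $R=S/J$ with its induced bigrading $R=\bigoplus_{i,j\ge 0}R_{(i,j)}$. A positively graded $K$-algebra $A=\bigoplus_{i\ge 0}A_i$ with $A_0=K$ is called Koszul if its residue class field $K=A/\bigoplus_{i>0}A_i$ has a linear free resolution over $A$, that is, if there is an exact sequence of graded $A$-modules with degree-preserving maps $$\cdots\to A(-2)^{r_2}\to A(-1)^{r_1}\to A^{r_0}\to K\to 0$$ with all $r_i$ finite. A bigraded algebra is regarded as a graded algebra through its total degree, i.e. its component of degree $k$ is the direct sum of its components of bidegree $(i,j)$ with $i+j=k$. Suppose that $R$ is Koszul, and let $a,b\ge 0$ be integers with $(a,b)\ne(0,0)$. Then: 1. the diagonal subalgebra $R_\Delta=\bigoplus_{i\ge 0}R_{(ia,ib)}$, graded by $(R_\Delta)_i=R_{(ia,ib)}$, is Koszul; 2. the generalized Veronese subring $R_{\tilde\Delta}=\bigoplus_{i,j\ge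 0}R_{(ia,jb)}\subset R$, bigraded by $(R_{\tilde\Delta})_{(i,j)}=R_{(ia,jb)}$, is Koszul. (If $a=0$ or $b=0$, each component of $R$ is counted only once: for $a=0$ only $i=0$ occurs, and for $b=0$ only $j=0$ occurs.) -/

import Mathlib

universe u v

namespace BigradedKoszul

section Koszul

variable {K : Type u} {A : Type v} [Field K] [CommRing A] [Algebra K A]

/-- `A = ⨁_{i ≥ 0} 𝒜 i` is a positively graded `K`-algebra with `𝒜 0 = K`. -/
structure IsPositivelyGraded (𝒜 : ℕ → Submodule K A) : Prop where
  nontrivial : Nontrivial A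
  gradedMonoid : SetLike.GradedMonoid 𝒜
  isInternal : DirectSum.IsInternal 𝒜
  /-- `1 : Submodule K A` is the image of `K` in `A`. -/
  degree_zero : 𝒜 0 = 1

/-- The ideal `A₊` generated by the homogeneous elements of positive degree. -/
def irrelevantIdeal (𝒜 : ℕ → Submodule K A) : Ideal A :=
  Ideal.span {x | ∃ i, 0 < i ∧ x ∈ 𝒜 i}

/-- The degree `n` component of the graded free module `A(-i)^r`, that is, `(A_{n-i})^r`, which
is zero for `n < i`. -/
def shiftedFreeComponent (𝒜 : ℕ → Submodule K A) (i r n : ℕ) : Submodule K (Fin r → A) :=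
  if i ≤ n then Submodule.pi Set.univ (fun _ => 𝒜 (n - i)) else ⊥

/-- A linear free resolution
`⋯ → A(-2)^{r₂} → A(-1)^{r₁} → A^{r₀} → A ⧸ A₊ → 0`
of the residue class field `K = A ⧸ A₊` (considered as a trivial `A`-module in degree `0`): an
exact sequence with degree preserving `A`-linear maps. (That `ε` preserves degrees is automatic,
because `A₊` annihilates its target.) -/
structure LinearFreeResolution (𝒜 : ℕ → Submodule K A) where
  rank : ℕ → ℕ
  d : ∀ i, (Fin (rank (i + 1)) → A) →ₗ[A] (Fin (rank i) → A)
  ε : (Fin (rank 0) → A) →ₗ[A] (A ⧸ irrelevantIdeal 𝒜)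
  d_degree : ∀ i n, ∀ v ∈ shiftedFreeComponent 𝒜 (i + 1) (rank (i + 1)) n,
    d i v ∈ shiftedFreeComponent 𝒜 i (rank i) n
  ε_surjective : Function.Surjective ε
  exact_zero : Function.Exact (d 0) ε
  exact_succ : ∀ i, Function.Exact (d (i + 1)) (d i)

/-- A positively graded `K`-algebra is Koszul if its residue class field has a linear free
resolution. -/
def IsKoszul (𝒜 : ℕ → Submodule K A) : Prop :=
  IsPositivelyGraded 𝒜 ∧ Nonempty (LinearFreeResolution 𝒜)

end Koszul

section Bigraded

variable {K : Type u} {R : Type v} [Field K] [CommRing R] [Algebra K R]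

/-- The `ℕ`-grading `R_k = ⨁_{i+j=k} R_{(i,j)}` underlying a bigrading. -/
def totalGrading (𝓡 : ℕ × ℕ → Submodule K R) (k : ℕ) : Submodule K R :=
  ⨆ p ∈ Finset.HasAntidiagonal.antidiagonal k, 𝓡 p

/-- The subalgebra `∑ᵢ R_{φ(i)}` of `R`, for an additive map `φ` of degrees. -/
def subalgebraAlong {ι : Type*} [AddMonoid ι] (𝓡 : ℕ × ℕ → Submodule K R)
    [SetLike.GradedMonoid 𝓡] (φ : ι →+ ℕ × ℕ) : Subalgebra K R :=
  (⨆ i, 𝓡 (φ i)).toSubalgebra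
    (Submodule.mem_iSup_of_mem 0 (by rw [map_zero]; exact SetLike.one_mem_graded 𝓡))
    (by
      intro x y hx hy
      have h : (⨆ i, 𝓡 (φ i)) * (⨆ i, 𝓡 (φ i)) ≤ ⨆ i, 𝓡 (φ i) := by
        rw [Submodule.iSup_mul]
        refine iSup_le fun i => ?_
        rw [Submodule.mul_iSup]
        refine iSup_le fun j => Submodule.mul_le.2 fun r hr s hs => ?_
        refine Submodule.mem_iSup_of_mem (i + j) ?_
        rw [map_add]
        exact SetLike.mul_mem_graded hr hs
      exact h (Submodule.mul_mem_mul hx hy))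

/-- `i ↦ (ia, ib)`. -/
def diagonalMap (a b : ℕ) : ℕ →+ ℕ × ℕ where
  toFun i := (i * a, i * b)
  map_zero' := by simp
  map_add' i j := by simp [add_mul]

/-- `(i, j) ↦ (ia, jb)`. -/
def veroneseMap (a b : ℕ) : ℕ × ℕ →+ ℕ × ℕ where
  toFun p := (p.1 * a, p.2 * b)
  map_zero' := by simp
  map_add' p q := by simp [add_mul]

/-- The diagonal subalgebra `R_Δ = ⨁_{i ≥ 0} R_{(ia,ib)}`. -/
abbrev diagonalSubalgebra (𝓡 : ℕ × ℕ → Submodule K R) [SetLike.GradedMonoid 𝓡] (a b : ℕ) :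
    Subalgebra K R :=
  subalgebraAlong 𝓡 (diagonalMap a b)

/-- The grading `(R_Δ)_i = R_{(ia,ib)}`. -/
def diagonalGrading (𝓡 : ℕ × ℕ → Submodule K R) [SetLike.GradedMonoid 𝓡] (a b i : ℕ) :
    Submodule K (diagonalSubalgebra 𝓡 a b) :=
  (𝓡 (i * a, i * b)).comap (diagonalSubalgebra 𝓡 a b).val.toLinearMap

/-- The generalized Veronese subring: the sum in `R` of the components `R_{(ia,jb)}`,
`i, j ≥ 0`. -/
abbrev veroneseSubalgebra (𝓡 : ℕ × ℕ → Submodule K R) [SetLike.GradedMonoid 𝓡] (a b : ℕ) :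
    Subalgebra K R :=
  subalgebraAlong 𝓡 (veroneseMap a b)

/-- The bigrading of the generalized Veronese subring: its component of degree `(i, j)` is
`R_{(ia,jb)}`. When `a = 0` (resp. `b = 0`) the components `R_{(ia,jb)}` do not depend on `i`
(resp. `j`), and each is counted once, namely for `i = 0` (resp. `j = 0`). -/
def veroneseBigrading (𝓡 : ℕ × ℕ → Submodule K R) [SetLike.GradedMonoid 𝓡] (a b : ℕ)
    (p : ℕ × ℕ) : Submodule K (veroneseSubalgebra 𝓡 a b) :=
  if (a = 0 ∧ p.1 ≠ 0) ∨ (b = 0 ∧ p.2 ≠ 0) then ⊥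
  else (𝓡 (p.1 * a, p.2 * b)).comap (veroneseSubalgebra 𝓡 a b).val.toLinearMap

end Bigraded

section Standard

/-- The polynomial ring `S = K[x₁, …, xₙ, y₁, …, yₘ]`. -/
abbrev PolyRing (K : Type u) [Field K] (n m : ℕ) : Type u := MvPolynomial (Fin n ⊕ Fin m) K

/-- `deg xᵢ = (1, 0)`, `deg yⱼ = (0, 1)`. -/
def bidegree (n m : ℕ) : Fin n ⊕ Fin m → ℕ × ℕ :=
  Sum.elim (fun _ => (1, 0)) (fun _ => (0, 1))

/-- The standard bigrading of `S`. -/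
abbrev polyBigrading (K : Type u) [Field K] (n m : ℕ) : ℕ × ℕ → Submodule K (PolyRing K n m) :=
  MvPolynomial.weightedHomogeneousSubmodule K (bidegree n m)

noncomputable instance polyBigrading.gradedAlgebra (K : Type u) [Field K] (n m : ℕ) :
    GradedAlgebra (polyBigrading K n m) :=
  MvPolynomial.weightedGradedAlgebra K (bidegree n m)

/-- The bigrading of `R = S / J`: `R_{(i,j)}` is the image of `S_{(i,j)}`. -/
noncomputable def quotientBigrading {K : Type u} [Field K] {n m : ℕ} (J : Ideal (PolyRing K n m))
    (p : ℕ × ℕ) : Submodule K (PolyRing K n m ⧸ J) :=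
  (polyBigrading K n m p).map (Ideal.Quotient.mkₐ K J).toLinearMap

instance quotientBigrading.gradedMonoid {K : Type u} [Field K] {n m : ℕ}
    (J : Ideal (PolyRing K n m)) : SetLike.GradedMonoid (quotientBigrading J) where
  one_mem := ⟨1, SetLike.one_mem_graded (polyBigrading K n m), map_one (Ideal.Quotient.mkₐ K J)⟩
  mul_mem := by
    rintro p q _ _ ⟨f, hf, rfl⟩ ⟨g, hg, rfl⟩
    exact ⟨f * g, SetLike.mul_mem_graded (A := polyBigrading K n m) hf hg,
      map_mul (Ideal.Quotient.mkₐ K J) f g⟩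

end Standard

end BigradedKoszul

/-! Regularity is measured by graded free resolutions that need not be minimal: `Reg` bounds the
weights of the generators of the `i`-th term by `t + i`. A Koszul algebra has a maximal ideal
satisfying `RegInf` with `t = 1`, and conversely this bound yields a linear resolution of the
residue field. Bounds of this kind pass along short exact sequences (`MapsOnto.reg_of_ker`,
`MapsOnto.reg_of_source`, `MapsOnto.reg_ker`), and relations may be computed from any generators of
suitable weight (`Reg.syzFamily`). All algebras stay inside one ring `R`: a subalgebra is a family
of subspaces indexed by a group of degrees, and kernels are taken degree by degree.

The first main input is that the ideals `(x) = ⨁_{i>0} R_{(i,j)}` and `(y) = ⨁_{j>0} R_{(i,j)}` have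
linear resolutions over `R` (`regInf_posFamily_of_regInf`). The quotient `A = R ⧸ (x)` is also the
subalgebra `⨁ R_{(0,j)}`, so it is an algebra retract. If `F` resolves `K` over `A` and `G` resolves
`A` over `R`, then the total complex of `F ⊗_A G` resolves `K` over `R`. Linearity for `K` bounds
the generators of its cycles, and through the summand `F_0 ⊗ G` also those of the syzygies of `A`.

The second input concerns the slices `V_γ = ⨁_{x ∈ C} R_{φ(x)+γ}` as modules over `V_0`; both `R_Δ`
and the Veronese ring are of the form `V_0`. Slicing an `R`-resolution of the maximal ideal gives an
exact complex of sums of slices, so it suffices to bound every `V_γ` (`reg_slice`). If `γ ≥ 0` and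
`γ.1 > 0`, then `V_γ` is a slice of `(x)`, which is generated in degree `(1,0)`; its linear
resolution reduces `V_γ` to `V_{γ-(1,0)}` and to statements about shorter resolutions. The second
coordinate is treated in the same way, and for other `γ` the slice is zero or a shift of a slice
with a smaller negative part.

Finally, choosing the fewest generators at each step turns upper bounds on weights into equalities
(`exists_linear_stages`), and the resulting matrices have entries in the subalgebra
(`isKoszul_of_regInf`). -/

set_option linter.unusedSectionVars false

namespace BigradedKoszul

/-! ### Regularity bounds and short exact sequences -/

section Regularity

variable {K : Type u} {R : Type v} {Γ : Type*} [Field K] [CommRing R] [Algebra K R]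
  [AddCommGroup Γ] {X Y : Type v} [AddCommGroup X] [Module K X] [Module R X] [IsScalarTower K R X]
  [AddCommGroup Y] [Module K Y] [Module R Y] [IsScalarTower K R Y] {ι κ : Type}

/-- The family `ℳ` of subspaces of `X` is stable under multiplication by the family `𝒜`. -/
def IsGradedFamily (𝒜 : Γ → Submodule K R) (ℳ : Γ → Submodule K X) : Prop :=
  ∀ ⦃γ δ : Γ⦄ ⦃a : R⦄ ⦃x : X⦄, a ∈ 𝒜 γ → x ∈ ℳ δ → a • x ∈ ℳ (γ + δ)

/-- The homogeneous components of the graded free module with basis in degrees `deg`. -/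
def freeFamily (𝒜 : Γ → Submodule K R) (deg : ι → Γ) (γ : Γ) : Submodule K (ι → R) :=
  Submodule.pi Set.univ fun i => 𝒜 (γ - deg i)

/-- The homogeneous components of the kernel of a map of graded modules. -/
def kerFamily (ℳ : Γ → Submodule K X) (g : X →ₗ[R] Y) (γ : Γ) : Submodule K X :=
  ℳ γ ⊓ (LinearMap.ker g).restrictScalars K

/-- The homogeneous relations between the elements `m i` of degrees `deg i`. -/
def syzFamily [Fintype ι] (𝒜 : Γ → Submodule K R) (deg : ι → Γ) (m : ι → X) :
    Γ → Submodule K (ι → R) :=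
  kerFamily (freeFamily 𝒜 deg) (Fintype.linearCombination R m)

/-- The homogeneous elements `m i` of degrees `deg i` generate the graded module `ℳ`. -/
structure Generates [Fintype ι] (𝒜 : Γ → Submodule K R) (ℳ : Γ → Submodule K X) (deg : ι → Γ)
    (m : ι → X) : Prop where
  mem : ∀ i, m i ∈ ℳ (deg i)
  exists_eq : ∀ ⦃γ x⦄, x ∈ ℳ γ → ∃ a ∈ freeFamily 𝒜 deg γ, Fintype.linearCombination R m a = x

/-- The linear map `g` maps the graded module `ℳ` onto the graded module `𝒩`. -/
structure MapsOnto (g : X →ₗ[R] Y) (ℳ : Γ → Submodule K X) (𝒩 : Γ → Submodule K Y) : Prop where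
  map_mem : ∀ ⦃γ x⦄, x ∈ ℳ γ → g x ∈ 𝒩 γ
  exists_eq : ∀ ⦃γ y⦄, y ∈ 𝒩 γ → ∃ x ∈ ℳ γ, g x = y

/-- `ℳ` has a graded free resolution whose `i`-th term has a finite basis of elements of weight at
most `t + i`, for `i < p`. -/
def Reg (𝒜 : Γ → Submodule K R) (w : Γ →+ ℤ) : ℕ → ℤ → ∀ {X : Type v} [AddCommGroup X]
    [Module K X] [Module R X] [IsScalarTower K R X], (Γ → Submodule K X) → Prop
  | 0, _, _, _, _, _, _, _ => True
  | p + 1, t, X, _, _, _, _, ℳ => ∃ (ι : Type) (_ : Fintype ι) (deg : ι → Γ) (m : ι → X),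
      (∀ i, w (deg i) ≤ t) ∧ Generates 𝒜 ℳ deg m ∧ Reg 𝒜 w p (t + 1) (syzFamily 𝒜 deg m)

/-- `Reg` for all lengths. -/
def RegInf (𝒜 : Γ → Submodule K R) (w : Γ →+ ℤ) (t : ℤ) (ℳ : Γ → Submodule K X) : Prop :=
  ∀ p, Reg 𝒜 w p t ℳ

variable {𝒜 : Γ → Submodule K R} {w : Γ →+ ℤ} {ℳ : Γ → Submodule K X} {𝒩 : Γ → Submodule K Y}

theorem mem_freeFamily {deg : ι → Γ} {γ : Γ} {a : ι → R} :
    a ∈ freeFamily 𝒜 deg γ ↔ ∀ i, a i ∈ 𝒜 (γ - deg i) := by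
  simp [freeFamily]

theorem mem_kerFamily {g : X →ₗ[R] Y} {γ : Γ} {x : X} :
    x ∈ kerFamily ℳ g γ ↔ x ∈ ℳ γ ∧ g x = 0 := by
  simp [kerFamily]

theorem mem_syzFamily [Fintype ι] {deg : ι → Γ} {m : ι → X} {γ : Γ} {a : ι → R} :
    a ∈ syzFamily 𝒜 deg m γ ↔
      (∀ i, a i ∈ 𝒜 (γ - deg i)) ∧ Fintype.linearCombination R m a = 0 := by
  rw [syzFamily, mem_kerFamily, mem_freeFamily]

theorem IsGradedFamily.linearCombination_mem [Fintype ι] (hℳ : IsGradedFamily 𝒜 ℳ)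
    {deg : ι → Γ} {m : ι → X} (hm : ∀ i, m i ∈ ℳ (deg i)) {γ : Γ} {a : ι → R}
    (ha : a ∈ freeFamily 𝒜 deg γ) : Fintype.linearCombination R m a ∈ ℳ γ := by
  rw [Fintype.linearCombination_apply]
  refine Submodule.sum_mem _ fun i _ => ?_
  have := hℳ (mem_freeFamily.1 ha i) (hm i)
  rwa [sub_add_cancel] at this

theorem isGradedFamily_self [SetLike.GradedMonoid 𝒜] : IsGradedFamily 𝒜 𝒜 :=
  fun _ _ _ _ ha hx => SetLike.mul_mem_graded ha hx

theorem isGradedFamily_freeFamily [SetLike.GradedMonoid 𝒜] (deg : ι → Γ) :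
    IsGradedFamily 𝒜 (freeFamily 𝒜 deg) := by
  intro γ δ a x ha hx
  rw [mem_freeFamily] at hx ⊢
  intro i
  rw [add_sub_assoc]
  exact SetLike.mul_mem_graded ha (hx i)

theorem IsGradedFamily.kerFamily (hℳ : IsGradedFamily 𝒜 ℳ) (g : X →ₗ[R] Y) :
    IsGradedFamily 𝒜 (kerFamily ℳ g) := by
  intro γ δ a x ha hx
  rw [mem_kerFamily] at hx ⊢
  exact ⟨hℳ ha hx.1, by rw [map_smul, hx.2, smul_zero]⟩

theorem isGradedFamily_syzFamily [SetLike.GradedMonoid 𝒜] [Fintype ι] (deg : ι → Γ) (m : ι → X) :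
    IsGradedFamily 𝒜 (syzFamily 𝒜 deg m) :=
  (isGradedFamily_freeFamily deg).kerFamily _

theorem Generates.mapsOnto [Fintype ι] {deg : ι → Γ} {m : ι → X} (hm : Generates 𝒜 ℳ deg m)
    (hℳ : IsGradedFamily 𝒜 ℳ) :
    MapsOnto (Fintype.linearCombination R m) (freeFamily 𝒜 deg) ℳ :=
  ⟨fun _ _ hx => hℳ.linearCombination_mem hm.mem hx, fun _ _ hx => hm.exists_eq hx⟩

theorem Reg.mono {p : ℕ} : ∀ {t t' : ℤ} {X : Type v} [AddCommGroup X] [Module K X] [Module R X]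
    [IsScalarTower K R X] {ℳ : Γ → Submodule K X}, Reg 𝒜 w p t ℳ → t ≤ t' → Reg 𝒜 w p t' ℳ := by
  induction p with
  | zero => intros; trivial
  | succ p ih =>
    rintro t t' X _ _ _ _ ℳ ⟨ι, _, deg, m, h1, h2, h3⟩ h
    exact ⟨ι, _, deg, m, fun i => (h1 i).trans h, h2, ih h3 (by lia)⟩

/-- `Reg` is invariant under isomorphisms. -/
theorem MapsOnto.reg_iff {g : X →ₗ[R] Y} (hg : MapsOnto g ℳ 𝒩) (hℳ : IsGradedFamily 𝒜 ℳ)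
    (hinj : ∀ ⦃γ x⦄, x ∈ ℳ γ → g x = 0 → x = 0) {p : ℕ} {t : ℤ} :
    Reg 𝒜 w p t ℳ ↔ Reg 𝒜 w p t 𝒩 := by
  cases p with
  | zero => exact Iff.rfl
  | succ p =>
    -- Injectivity on homogeneous elements suffices: generators and their images have the same
    -- homogeneous relations.
    have key : ∀ {ι : Type} [Fintype ι] (deg : ι → Γ) (m : ι → X), (∀ i, m i ∈ ℳ (deg i)) →
        syzFamily 𝒜 deg (fun i => g (m i)) = syzFamily 𝒜 deg m := by
      intro ι _ deg m hm
      funext γ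
      ext a
      have h1 : Fintype.linearCombination R (fun i => g (m i)) a =
          g (Fintype.linearCombination R m a) := by
        simp [Fintype.linearCombination_apply]
      simp only [mem_syzFamily, h1]
      refine and_congr_right fun ha => ⟨fun h => ?_, fun h => by rw [h, map_zero]⟩
      exact hinj (hℳ.linearCombination_mem hm (mem_freeFamily.2 ha)) h
    constructor
    · rintro ⟨ι, _, deg, m, h1, h2, h3⟩
      refine ⟨ι, _, deg, fun i => g (m i), h1, ⟨fun i => hg.map_mem (h2.mem i), ?_⟩, ?_⟩
      · intro γ y hy
        obtain ⟨x, hx, rfl⟩ := hg.exists_eq hy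
        obtain ⟨a, ha, rfl⟩ := h2.exists_eq hx
        exact ⟨a, ha, by simp [Fintype.linearCombination_apply]⟩
      · rwa [key deg m h2.mem]
    · rintro ⟨ι, _, deg, m, h1, h2, h3⟩
      choose n hn hn' using fun i => hg.exists_eq (h2.mem i)
      obtain rfl : (fun i => g (n i)) = m := funext hn'
      refine ⟨ι, _, deg, n, h1, ⟨hn, ?_⟩, ?_⟩
      · intro γ x hx
        obtain ⟨a, ha, hax⟩ := h2.exists_eq (hg.map_mem hx)
        refine ⟨a, ha, ?_⟩
        have h4 := hℳ.linearCombination_mem hn ha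
        rw [← sub_eq_zero]
        refine hinj (γ := γ) (Submodule.sub_mem _ h4 hx) ?_
        rw [map_sub, ← hax, sub_eq_zero]
        simp [Fintype.linearCombination_apply]
      · rwa [← key deg n hn]

/-- An extension of graded modules satisfying `Reg` satisfies `Reg`. -/
theorem MapsOnto.reg_of_ker [SetLike.GradedMonoid 𝒜] {p : ℕ} : ∀ {X Y : Type v} [AddCommGroup X]
    [Module K X] [Module R X] [IsScalarTower K R X] [AddCommGroup Y] [Module K Y] [Module R Y]
    [IsScalarTower K R Y] {ℳ : Γ → Submodule K X} {𝒩 : Γ → Submodule K Y} {g : X →ₗ[R] Y}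
    (_ : MapsOnto g ℳ 𝒩) (_ : IsGradedFamily 𝒜 ℳ) {t : ℤ},
    Reg 𝒜 w p t (kerFamily ℳ g) → Reg 𝒜 w p t 𝒩 → Reg 𝒜 w p t ℳ := by
  induction p with
  | zero => intros; trivial
  | succ p ih =>
    rintro X Y _ _ _ _ _ _ _ _ ℳ 𝒩 g hg hℳ t ⟨ι, _, deg, m, h1, h2, h3⟩
      ⟨κ, _, deg', m', h1', h2', h3'⟩
    choose n hn hn' using fun i => hg.exists_eq (h2'.mem i)
    obtain rfl : (fun i => g (n i)) = m' := funext hn'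
    have hlin : ∀ a : κ → R, Fintype.linearCombination R (fun i => g (n i)) a =
        g (Fintype.linearCombination R n a) := fun a => by simp [Fintype.linearCombination_apply]
    have hsum : ∀ a : ι ⊕ κ → R, Fintype.linearCombination R (Sum.elim m n) a =
        Fintype.linearCombination R m (a ∘ Sum.inl) +
          Fintype.linearCombination R n (a ∘ Sum.inr) := fun a => by
      simp [Fintype.linearCombination_apply]
    have hgm : ∀ a : ι → R, g (Fintype.linearCombination R m a) = 0 := fun a => by
      have : ∀ i, g (m i) = 0 := fun i => (mem_kerFamily.1 (h2.mem i)).2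
      simp [Fintype.linearCombination_apply, this]
    refine ⟨ι ⊕ κ, inferInstance, Sum.elim deg deg', Sum.elim m n, ?_, ⟨?_, ?_⟩, ?_⟩
    · rintro (i | i)
      exacts [h1 i, h1' i]
    · rintro (i | i)
      exacts [(mem_kerFamily.1 (h2.mem i)).1, hn i]
    · intro γ x hx
      obtain ⟨b, hb, hbx⟩ := h2'.exists_eq (hg.map_mem hx)
      have h4 : x - Fintype.linearCombination R n b ∈ kerFamily ℳ g γ :=
        mem_kerFamily.2 ⟨Submodule.sub_mem _ hx (hℳ.linearCombination_mem hn hb), by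
          rw [map_sub, ← hlin, hbx, sub_self]⟩
      obtain ⟨a, ha, hax⟩ := h2.exists_eq h4
      refine ⟨Sum.elim a b, mem_freeFamily.2 ?_, ?_⟩
      · rintro (i | i)
        exacts [mem_freeFamily.1 ha i, mem_freeFamily.1 hb i]
      · rw [hsum, Sum.elim_comp_inl, Sum.elim_comp_inr, hax, sub_add_cancel]
    -- The horseshoe lemma: the relations of the combined generators are an extension of the
    -- relations of the quotient by those of the kernel, so the induction hypothesis applies to
    -- them.
    · have hon : MapsOnto (LinearMap.funLeft R R (Sum.inr : κ → ι ⊕ κ))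
          (syzFamily 𝒜 (Sum.elim deg deg') (Sum.elim m n))
          (syzFamily 𝒜 deg' fun i => g (n i)) := by
        constructor
        · intro γ a ha
          rw [mem_syzFamily] at ha ⊢
          refine ⟨fun i => ha.1 (Sum.inr i), ?_⟩
          have := congrArg g ha.2
          rw [hsum, map_add, hgm, zero_add, map_zero] at this
          rw [hlin]
          exact this
        · intro γ b hb
          rw [mem_syzFamily] at hb
          have h4 : Fintype.linearCombination R n b ∈ kerFamily ℳ g γ :=
            mem_kerFamily.2 ⟨hℳ.linearCombination_mem hn (mem_freeFamily.2 hb.1), by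
              rw [← hlin, hb.2]⟩
          obtain ⟨a, ha, hab⟩ := h2.exists_eq h4
          refine ⟨Sum.elim (-a) b, mem_syzFamily.2 ⟨?_, ?_⟩, rfl⟩
          · rintro (i | i)
            · exact Submodule.neg_mem _ (mem_freeFamily.1 ha i)
            · exact hb.1 i
          · rw [hsum, Sum.elim_comp_inl, Sum.elim_comp_inr, map_neg, hab, neg_add_cancel]
      refine ih hon (isGradedFamily_syzFamily _ _) ?_ h3'
      have hon' : MapsOnto (LinearMap.funLeft R R (Sum.inl : ι → ι ⊕ κ))
          (kerFamily (syzFamily 𝒜 (Sum.elim deg deg') (Sum.elim m n))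
            (LinearMap.funLeft R R (Sum.inr : κ → ι ⊕ κ))) (syzFamily 𝒜 deg m) := by
        constructor
        · intro γ a ha
          rw [mem_kerFamily, mem_syzFamily, hsum] at ha
          obtain ⟨⟨ha1, ha2⟩, ha3⟩ := ha
          refine mem_syzFamily.2 ⟨fun i => ha1 (Sum.inl i), ?_⟩
          have h5 : a ∘ Sum.inr = 0 := ha3
          rw [h5, map_zero, add_zero] at ha2
          exact ha2
        · intro γ a ha
          rw [mem_syzFamily] at ha
          refine ⟨Sum.elim a 0, mem_kerFamily.2 ⟨mem_syzFamily.2 ⟨?_, ?_⟩, rfl⟩, rfl⟩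
          · rintro (i | i)
            · exact ha.1 i
            · exact Submodule.zero_mem _
          · rw [hsum, Sum.elim_comp_inl, Sum.elim_comp_inr, map_zero, add_zero, ha.2]
      refine (hon'.reg_iff ((isGradedFamily_syzFamily _ _).kerFamily _) ?_).2 h3
      intro γ a ha ha'
      rw [mem_kerFamily] at ha
      funext i
      rcases i with i | i
      · exact congrFun ha' i
      · exact congrFun ha.2 i

/-- A quotient of a graded module satisfying `Reg` by a graded submodule satisfying `Reg`. -/
theorem MapsOnto.reg_of_source [SetLike.GradedMonoid 𝒜] {g : X →ₗ[R] Y} (hg : MapsOnto g ℳ 𝒩)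
    (hℳ : IsGradedFamily 𝒜 ℳ) {p : ℕ} {t : ℤ} (hker : Reg 𝒜 w p (t + 1) (kerFamily ℳ g))
    (h : Reg 𝒜 w (p + 1) t ℳ) : Reg 𝒜 w (p + 1) t 𝒩 := by
  obtain ⟨ι, _, deg, m, h1, h2, h3⟩ := h
  have hlin : ∀ a : ι → R, Fintype.linearCombination R (fun i => g (m i)) a =
      g (Fintype.linearCombination R m a) := fun a => by simp [Fintype.linearCombination_apply]
  refine ⟨ι, _, deg, fun i => g (m i), h1, ⟨fun i => hg.map_mem (h2.mem i), ?_⟩, ?_⟩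
  · intro γ y hy
    obtain ⟨x, hx, rfl⟩ := hg.exists_eq hy
    obtain ⟨a, ha, rfl⟩ := h2.exists_eq hx
    exact ⟨a, ha, hlin a⟩
  -- A relation between the images `g (m i)` evaluates on the `m i` to an element of `ker g`, and it
  -- evaluates to zero exactly when it is a relation in `ℳ`. So the new relations are an extension
  -- of `ker g` by the old ones.
  · have hon : MapsOnto (Fintype.linearCombination R m) (syzFamily 𝒜 deg fun i => g (m i))
        (BigradedKoszul.kerFamily ℳ g) := by
      constructor
      · intro γ a ha
        rw [mem_syzFamily, hlin] at ha
        exact mem_kerFamily.2 ⟨hℳ.linearCombination_mem h2.mem (mem_freeFamily.2 ha.1), ha.2⟩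
      · intro γ x hx
        rw [mem_kerFamily] at hx
        obtain ⟨a, ha, rfl⟩ := h2.exists_eq hx.1
        exact ⟨a, mem_syzFamily.2 ⟨mem_freeFamily.1 ha, by rw [hlin, hx.2]⟩, rfl⟩
    refine hon.reg_of_ker (isGradedFamily_syzFamily _ _) ?_ hker
    convert h3 using 1
    funext γ
    ext a
    simp only [mem_kerFamily, mem_syzFamily, hlin]
    exact ⟨fun h => ⟨h.1.1, h.2⟩, fun h => ⟨⟨h.1, by rw [h.2, map_zero]⟩, h.2⟩⟩

theorem reg_of_forall_eq_zero (hℳ : ∀ ⦃γ x⦄, x ∈ ℳ γ → x = 0) (p : ℕ) (t : ℤ) :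
    Reg 𝒜 w p t ℳ := by
  induction p generalizing t X ℳ with
  | zero => trivial
  | succ p ih =>
    refine ⟨Empty, inferInstance, Empty.elim, Empty.elim, fun i => i.elim, ⟨fun i => i.elim, ?_⟩,
      ih (fun γ a _ => Subsingleton.elim _ _) _⟩
    intro γ x hx
    exact ⟨0, Submodule.zero_mem _, by rw [map_zero, hℳ hx]⟩

theorem reg_freeFamily [SetLike.GradedMonoid 𝒜] {ι : Type} [Fintype ι] {deg : ι → Γ} {t : ℤ}
    (h : ∀ i, w (deg i) ≤ t) (p : ℕ) : Reg 𝒜 w p t (freeFamily 𝒜 deg) := by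
  classical
  have hid : ∀ a : ι → R, Fintype.linearCombination R (fun i : ι => Pi.single i (1 : R)) a = a := by
    intro a
    rw [Fintype.linearCombination_apply]
    funext j
    simp [Finset.sum_apply, Pi.single_apply]
  cases p with
  | zero => trivial
  | succ p =>
    refine ⟨ι, _, deg, fun i => Pi.single i 1, h, ⟨fun i => mem_freeFamily.2 fun j => ?_, ?_⟩,
      reg_of_forall_eq_zero (fun γ a ha => ?_) _ _⟩
    · rcases eq_or_ne j i with rfl | hj
      · rw [Pi.single_eq_same, sub_self]
        exact SetLike.one_mem_graded 𝒜
      · rw [Pi.single_eq_of_ne hj]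
        exact Submodule.zero_mem _
    · intro γ x hx
      exact ⟨x, hx, hid x⟩
    · rw [mem_syzFamily, hid] at ha
      exact ha.2

theorem reg_self [SetLike.GradedMonoid 𝒜] (p : ℕ) : Reg 𝒜 w p 0 𝒜 := by
  have hon : MapsOnto (LinearMap.proj (R := R) (φ := fun _ : Fin 1 => R) 0)
      (freeFamily 𝒜 fun _ => (0 : Γ)) 𝒜 := by
    refine ⟨fun γ a ha => ?_, fun γ a ha => ⟨fun _ => a, mem_freeFamily.2 fun _ => ?_, rfl⟩⟩
    · simpa using mem_freeFamily.1 ha 0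
    · simpa using ha
  refine (hon.reg_iff (isGradedFamily_freeFamily _) fun γ a _ ha => ?_).1
    (reg_freeFamily (fun _ => by simp) p)
  funext i
  rw [Subsingleton.elim i 0]
  exact ha

/-- The kernel of a map between graded modules satisfying `Reg`. -/
theorem MapsOnto.reg_ker [SetLike.GradedMonoid 𝒜] {g : X →ₗ[R] Y} (hg : MapsOnto g ℳ 𝒩)
    (hℳ : IsGradedFamily 𝒜 ℳ) {p : ℕ} {t : ℤ} (h : Reg 𝒜 w p (t + 1) ℳ)
    (h' : Reg 𝒜 w (p + 1) t 𝒩) : Reg 𝒜 w p (t + 1) (kerFamily ℳ g) := by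
  obtain ⟨ι, _, deg, m', h1, h2, h3⟩ := h'
  choose n hn hn' using fun i => hg.exists_eq (h2.mem i)
  obtain rfl : (fun i => g (n i)) = m' := funext hn'
  have hlin : ∀ a : ι → R, Fintype.linearCombination R (fun i => g (n i)) a =
      g (Fintype.linearCombination R n a) := fun a => by simp [Fintype.linearCombination_apply]
  -- The fibre product of `ℳ` and a free cover of `𝒩`. Lifting the generators to `n` splits it as
  -- `ker g` plus a free module. It is also an extension of `ℳ` by the relations of `𝒩`, which
  -- bounds it; dividing by the free summand then bounds `ker g`.
  let 𝒴 : Γ → Submodule K (X × (ι → R)) := fun γ =>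
    (BigradedKoszul.kerFamily ℳ g γ).prod (freeFamily 𝒜 deg γ)
  have h𝒴 : IsGradedFamily 𝒜 𝒴 := fun γ δ a x ha hx =>
    ⟨hℳ.kerFamily g ha hx.1, isGradedFamily_freeFamily deg ha hx.2⟩
  let q : X × (ι → R) →ₗ[R] X :=
    LinearMap.fst R X (ι → R) + Fintype.linearCombination R n ∘ₗ LinearMap.snd R X (ι → R)
  have hq : ∀ z, q z = z.1 + Fintype.linearCombination R n z.2 := fun z => rfl
  have hqon : MapsOnto q 𝒴 ℳ := by
    constructor
    · intro γ z hz
      exact Submodule.add_mem _ (mem_kerFamily.1 hz.1).1 (hℳ.linearCombination_mem hn hz.2)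
    · intro γ x hx
      obtain ⟨a, ha, hax⟩ := h2.exists_eq (hg.map_mem hx)
      refine ⟨(x - Fintype.linearCombination R n a, a), ⟨mem_kerFamily.2 ⟨Submodule.sub_mem _ hx
        (hℳ.linearCombination_mem hn ha), ?_⟩, ha⟩, by rw [hq]; exact sub_add_cancel _ _⟩
      rw [map_sub, ← hlin, hax, sub_self]
  have hsnd : MapsOnto (LinearMap.snd R X (ι → R)) (BigradedKoszul.kerFamily 𝒴 q)
      (syzFamily 𝒜 deg fun i => g (n i)) := by
    constructor
    · intro γ z hz
      rw [mem_kerFamily, hq] at hz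
      refine mem_syzFamily.2 ⟨mem_freeFamily.1 hz.1.2, ?_⟩
      have h4 := congrArg g hz.2
      rw [map_add, (mem_kerFamily.1 hz.1.1).2, zero_add, map_zero] at h4
      rw [hlin]
      exact h4
    · intro γ a ha
      rw [mem_syzFamily, hlin] at ha
      refine ⟨(-Fintype.linearCombination R n a, a), mem_kerFamily.2 ⟨⟨mem_kerFamily.2
        ⟨Submodule.neg_mem _ (hℳ.linearCombination_mem hn (mem_freeFamily.2 ha.1)), ?_⟩,
        mem_freeFamily.2 ha.1⟩, ?_⟩, rfl⟩
      · rw [map_neg, ha.2, neg_zero]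
      · rw [hq]
        exact neg_add_cancel _
  have hker : Reg 𝒜 w p (t + 1) (BigradedKoszul.kerFamily 𝒴 q) := by
    refine (hsnd.reg_iff (h𝒴.kerFamily q) ?_).2 h3
    rintro γ ⟨x, a⟩ hz (rfl : a = 0)
    rw [mem_kerFamily, hq] at hz
    have h4 := hz.2
    rw [map_zero, add_zero] at h4
    exact Prod.ext h4 rfl
  have hY := hqon.reg_of_ker h𝒴 hker h
  cases p with
  | zero => trivial
  | succ p =>
    have hfst : MapsOnto (LinearMap.fst R X (ι → R)) 𝒴 (BigradedKoszul.kerFamily ℳ g) :=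
      ⟨fun γ z hz => hz.1, fun γ x hx => ⟨(x, 0), ⟨hx, Submodule.zero_mem _⟩, rfl⟩⟩
    refine hfst.reg_of_source h𝒴 ?_ hY
    have hon : MapsOnto (LinearMap.snd R X (ι → R))
        (BigradedKoszul.kerFamily 𝒴 (LinearMap.fst R X (ι → R))) (freeFamily 𝒜 deg) := by
      constructor
      · intro γ z hz
        exact (mem_kerFamily.1 hz).1.2
      · intro γ a ha
        exact ⟨(0, a), mem_kerFamily.2 ⟨⟨Submodule.zero_mem _, ha⟩, rfl⟩, rfl⟩
    refine (hon.reg_iff (h𝒴.kerFamily _) ?_).2 (reg_freeFamily (fun i => (h1 i).trans (by lia)) _)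
    intro γ z hz hz'
    exact Prod.ext (mem_kerFamily.1 hz).2 hz'

/-- The relations between any generators of suitable degrees satisfy `Reg`. -/
theorem Reg.syzFamily [SetLike.GradedMonoid 𝒜] (hℳ : IsGradedFamily 𝒜 ℳ) {p : ℕ} {t : ℤ}
    (h : Reg 𝒜 w (p + 1) t ℳ) {ι : Type} [Fintype ι] {deg : ι → Γ} {m : ι → X}
    (hm : Generates 𝒜 ℳ deg m) (hdeg : ∀ i, w (deg i) ≤ t + 1) :
    Reg 𝒜 w p (t + 1) (syzFamily 𝒜 deg m) :=
  -- This plays the role of Schanuel's lemma. Generators of weight `t + 1` are admitted since the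
  -- free cover only has to satisfy the bound `t + 1`.
  (hm.mapsOnto hℳ).reg_ker (isGradedFamily_freeFamily deg) (reg_freeFamily hdeg p) h

theorem RegInf.syzFamily [SetLike.GradedMonoid 𝒜] (hℳ : IsGradedFamily 𝒜 ℳ) {t : ℤ}
    (h : RegInf 𝒜 w t ℳ) {ι : Type} [Fintype ι] {deg : ι → Γ} {m : ι → X}
    (hm : Generates 𝒜 ℳ deg m) (hdeg : ∀ i, w (deg i) ≤ t + 1) :
    RegInf 𝒜 w (t + 1) (syzFamily 𝒜 deg m) :=
  fun p => (h (p + 1)).syzFamily hℳ hm hdeg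

/-- Zero generators can be dropped. -/
theorem Generates.exists_ne_zero [Fintype ι] {deg : ι → Γ} {m : ι → X}
    (h : Generates 𝒜 ℳ deg m) {t : ℤ} (hdeg : ∀ i, w (deg i) ≤ t) :
    ∃ (n : ℕ) (deg : Fin n → Γ) (m : Fin n → X),
      (∀ i, w (deg i) ≤ t) ∧ (∀ i, m i ≠ 0) ∧ Generates 𝒜 ℳ deg m := by
  classical
  let e : {i // m i ≠ 0} ≃ Fin (Fintype.card {i // m i ≠ 0}) := Fintype.equivFin _
  refine ⟨_, fun j => deg (e.symm j), fun j => m (e.symm j), fun j => hdeg _,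
    fun j => (e.symm j).2, fun j => h.mem _, ?_⟩
  intro γ x hx
  obtain ⟨a, ha, rfl⟩ := h.exists_eq hx
  refine ⟨fun j => a (e.symm j), mem_freeFamily.2 fun j => mem_freeFamily.1 ha _, ?_⟩
  rw [Fintype.linearCombination_apply, Fintype.linearCombination_apply,
    Equiv.sum_comp e.symm (fun i : {i // m i ≠ 0} => a i • m i),
    ← Finset.sum_subtype (Finset.univ.filter (m · ≠ 0)) (by simp) (fun i => a i • m i)]
  rw [Finset.sum_filter_of_ne]
  · intro i _ hi h0
    exact hi (by rw [h0, smul_zero])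

/-- A graded module satisfying `Reg` has a finite family of nonzero generators. -/
theorem RegInf.exists_generates {t : ℤ} (h : RegInf 𝒜 w t ℳ) :
    ∃ (n : ℕ) (deg : Fin n → Γ) (m : Fin n → X),
      (∀ i, w (deg i) ≤ t) ∧ (∀ i, m i ≠ 0) ∧ Generates 𝒜 ℳ deg m := by
  obtain ⟨ι, _, deg, m, h1, h2, -⟩ := h 1
  exact h2.exists_ne_zero h1

theorem Reg.shift {p : ℕ} (γ₀ : Γ) : ∀ {t : ℤ} {X : Type v} [AddCommGroup X] [Module K X]
    [Module R X] [IsScalarTower K R X] {ℳ : Γ → Submodule K X}, Reg 𝒜 w p t ℳ →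
    Reg 𝒜 w p (t + w γ₀) (fun γ => ℳ (γ - γ₀)) := by
  induction p with
  | zero => intros; trivial
  | succ p ih =>
    rintro t X _ _ _ _ ℳ ⟨ι, _, deg, m, h1, h2, h3⟩
    have hfree : freeFamily 𝒜 (fun i => deg i + γ₀) = fun γ => freeFamily 𝒜 deg (γ - γ₀) := by
      funext γ
      ext a
      simp only [mem_freeFamily]
      refine forall_congr' fun i => ?_
      rw [sub_sub, add_comm γ₀]
    refine ⟨ι, _, fun i => deg i + γ₀, m, fun i => ?_, ⟨fun i => ?_, ?_⟩, ?_⟩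
    · rw [map_add]
      linarith [h1 i]
    · simpa using h2.mem i
    · intro γ x hx
      obtain ⟨a, ha, hax⟩ := h2.exists_eq hx
      exact ⟨a, by rwa [hfree], hax⟩
    · have h4 := ih h3
      rw [add_right_comm] at h4
      convert h4 using 1
      unfold BigradedKoszul.syzFamily BigradedKoszul.kerFamily
      rw [hfree]

/-- Finite products of graded modules satisfying `Reg`. -/
theorem reg_pi [SetLike.GradedMonoid 𝒜] {p : ℕ} {t : ℤ} {n : ℕ}
    {ℳ : Fin n → Γ → Submodule K R} (hℳ : ∀ i, IsGradedFamily 𝒜 (ℳ i))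
    (h : ∀ i, Reg 𝒜 w p t (ℳ i)) :
    Reg 𝒜 w p t (fun γ => Submodule.pi (R := K) Set.univ fun i => ℳ i γ) := by
  induction n with
  | zero => exact reg_of_forall_eq_zero (fun γ a _ => Subsingleton.elim _ _) _ _
  | succ n ih =>
    have hgr : ∀ {n : ℕ} {ℳ : Fin n → Γ → Submodule K R}, (∀ i, IsGradedFamily 𝒜 (ℳ i)) →
        IsGradedFamily 𝒜 (fun γ => Submodule.pi (R := K) Set.univ fun i => ℳ i γ) := by
      intro n ℳ hℳ γ δ a x ha hx i _
      exact hℳ i ha (hx i trivial)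
    have hon : MapsOnto (LinearMap.proj (R := R) (φ := fun _ : Fin (n + 1) => R) 0)
        (fun γ => Submodule.pi (R := K) Set.univ fun i => ℳ i γ) (ℳ 0) := by
      refine ⟨fun γ x hx => hx 0 trivial, fun γ y hy => ⟨Fin.cons y 0, ?_, rfl⟩⟩
      intro i _
      refine Fin.cases ?_ (fun j => ?_) i
      · exact hy
      · exact Submodule.zero_mem _
    refine hon.reg_of_ker (hgr hℳ) ?_ (h 0)
    have hon' : MapsOnto (LinearMap.funLeft R R (Fin.succ : Fin n → Fin (n + 1)))
        (kerFamily (fun γ => Submodule.pi (R := K) Set.univ fun i => ℳ i γ)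
          (LinearMap.proj (R := R) (φ := fun _ : Fin (n + 1) => R) 0))
        (fun γ => Submodule.pi (R := K) Set.univ fun i => ℳ (Fin.succ i) γ) := by
      constructor
      · intro γ x hx i _
        exact (mem_kerFamily.1 hx).1 i.succ trivial
      · intro γ y hy
        refine ⟨Fin.cons 0 y, mem_kerFamily.2 ⟨?_, rfl⟩, rfl⟩
        intro i _
        refine Fin.cases ?_ (fun j => ?_) i
        · exact Submodule.zero_mem _
        · exact hy j trivial
    refine (hon'.reg_iff ((hgr hℳ).kerFamily _) ?_).2 (ih (fun i => hℳ _) fun i => h _)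
    intro γ x hx hx'
    funext i
    refine Fin.cases ?_ (fun j => ?_) i
    · exact (mem_kerFamily.1 hx).2
    · exact congrFun hx' j

/-- Finite products of graded modules satisfying `Reg`. -/
theorem reg_pi_of_fintype [SetLike.GradedMonoid 𝒜] {p : ℕ} {t : ℤ} {ι : Type} [Fintype ι]
    {ℳ : ι → Γ → Submodule K R} (hℳ : ∀ i, IsGradedFamily 𝒜 (ℳ i))
    (h : ∀ i, Reg 𝒜 w p t (ℳ i)) :
    Reg 𝒜 w p t (fun γ => Submodule.pi (R := K) Set.univ fun i => ℳ i γ) := by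
  let e := Fintype.equivFin ι
  have hon : MapsOnto (LinearMap.funLeft R R e)
      (fun γ => Submodule.pi (R := K) Set.univ fun j => ℳ (e.symm j) γ)
      (fun γ => Submodule.pi (R := K) Set.univ fun i => ℳ i γ) := by
    constructor
    · intro γ x hx i _
      simpa using hx (e i) trivial
    · intro γ y hy
      refine ⟨fun j => y (e.symm j), fun j _ => hy _ trivial, ?_⟩
      funext i
      simp [LinearMap.funLeft_apply]
  refine (hon.reg_iff (fun γ δ a x ha hx j _ => hℳ _ ha (hx j trivial)) ?_).1
    (reg_pi (fun _ => hℳ _) fun _ => h _)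
  intro γ x _ hx
  funext j
  simpa [LinearMap.funLeft_apply] using congrFun hx (e.symm j)

end Regularity

/-! ### Homogeneous components -/

section Projections

variable {K : Type u} {R : Type v} [Field K] [CommRing R] [Algebra K R]
  {X : Type*} [AddCommGroup X] [Module K X] [Module R X] [IsScalarTower K R X]

/-- The linear maps `π γ` are projections onto the members of an independent family `ℳ`. -/
structure IsProj {Γ : Type*} (ℳ : Γ → Submodule K X) (π : Γ → X →ₗ[K] X) : Prop where
  apply_self : ∀ ⦃γ x⦄, x ∈ ℳ γ → π γ x = x
  apply_ne : ∀ ⦃γ δ x⦄, x ∈ ℳ δ → δ ≠ γ → π γ x = 0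

theorem exists_isProj_of_isInternal {Γ : Type*} [DecidableEq Γ] {ℳ : Γ → Submodule K X}
    (h : DirectSum.IsInternal ℳ) : ∃ π, IsProj ℳ π := by
  let _ := h.chooseDecomposition
  refine ⟨fun γ => (ℳ γ).subtype ∘ₗ DirectSum.component K Γ _ γ ∘ₗ
    (DirectSum.decomposeLinearEquiv ℳ).toLinearMap, fun γ x hx => ?_, fun γ δ x hx hne => ?_⟩
  · exact DirectSum.decompose_of_mem_same ℳ hx
  · exact DirectSum.decompose_of_mem_ne ℳ hx hne

/-- Serves to enlarge the monoids of degrees `ℕ` and `ℕ × ℕ` to groups by adding zero components, so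
that degrees can be subtracted. -/
theorem IsProj.exists_extend {Γ Γ' : Type*} {ℳ : Γ → Submodule K X} {π : Γ → X →ₗ[K] X}
    (hπ : IsProj ℳ π) {f : Γ → Γ'} {ℳ' : Γ' → Submodule K X}
    (h : ∀ i, ℳ' (f i) = ℳ i) (h' : ∀ γ, γ ∉ Set.range f → ℳ' γ = ⊥) : ∃ π', IsProj ℳ' π' := by
  classical
  refine ⟨fun γ => if hγ : ∃ i, f i = γ then π hγ.choose else 0, fun γ x hx => ?_,
    fun γ δ x hx hne => ?_⟩
  · by_cases hγ : ∃ i, f i = γ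
    · simp only [hγ, dite_true]
      apply hπ.apply_self
      rw [← h, hγ.choose_spec]
      exact hx
    · rw [h' γ hγ, Submodule.mem_bot] at hx
      rw [hx, map_zero]
  · by_cases hδ : ∃ i, f i = δ
    · obtain ⟨i, rfl⟩ := hδ
      by_cases hγ : ∃ i, f i = γ
      · simp only [hγ, dite_true]
        rw [h] at hx
        refine hπ.apply_ne hx ?_
        rintro rfl
        exact hne hγ.choose_spec
      · simp only [hγ, dite_false, LinearMap.zero_apply]
    · rw [h' δ hδ, Submodule.mem_bot] at hx
      rw [hx, map_zero]

section

variable {Γ : Type*} {ℳ : Γ → Submodule K X} {π : Γ → X →ₗ[K] X}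

theorem IsProj.mono (hπ : IsProj ℳ π) {𝒩 : Γ → Submodule K X} (h : ∀ γ, 𝒩 γ ≤ ℳ γ) :
    IsProj 𝒩 π :=
  ⟨fun _ _ hx => hπ.apply_self (h _ hx), fun _ _ _ hx hne => hπ.apply_ne (h _ hx) hne⟩

theorem IsProj.mem (hπ : IsProj ℳ π) (γ : Γ) {x : X} (hx : x ∈ ⨆ γ, ℳ γ) : π γ x ∈ ℳ γ := by
  induction hx using Submodule.iSup_induction' with
  | mem δ x hx =>
    by_cases h : δ = γ
    · subst h
      rwa [hπ.apply_self hx]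
    · rw [hπ.apply_ne hx h]
      exact Submodule.zero_mem _
  | zero => rw [map_zero]; exact Submodule.zero_mem _
  | add x y _ _ hx hy => rw [map_add]; exact Submodule.add_mem _ hx hy

theorem IsProj.exists_sum (hπ : IsProj ℳ π) {x : X} (hx : x ∈ ⨆ γ, ℳ γ) :
    ∃ s : Finset Γ, ∀ t, s ⊆ t → ∑ γ ∈ t, π γ x = x := by
  classical
  induction hx using Submodule.iSup_induction' with
  | mem δ x hx =>
    refine ⟨{δ}, fun t ht => ?_⟩
    rw [Finset.sum_eq_single δ (fun γ _ hγ => hπ.apply_ne hx hγ.symm)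
      (fun h => absurd (ht (Finset.mem_singleton_self δ)) h), hπ.apply_self hx]
  | zero => exact ⟨∅, fun t _ => by simp⟩
  | add x y _ _ hx hy =>
    obtain ⟨s, hs⟩ := hx
    obtain ⟨s', hs'⟩ := hy
    refine ⟨s ∪ s', fun t ht => ?_⟩
    simp only [map_add, Finset.sum_add_distrib]
    rw [hs t (Finset.union_subset_left ht), hs' t (Finset.union_subset_right ht)]

theorem IsProj.eq_zero (hπ : IsProj ℳ π) {x : X} (hx : x ∈ ⨆ γ, ℳ γ) (h : ∀ γ, π γ x = 0) :
    x = 0 := by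
  obtain ⟨s, hs⟩ := hπ.exists_sum hx
  rw [← hs s subset_rfl]
  exact Finset.sum_eq_zero fun γ _ => h γ

end

section

variable {Γ Γ' : Type*}

/-- The components of a coarsening of the grading `ℳ`. -/
def totFamily (w : Γ → Γ') (ℳ : Γ → Submodule K X) (k : Γ') : Submodule K X :=
  ⨆ (γ : Γ) (_ : w γ = k), ℳ γ

variable {w : Γ → Γ'} {ℳ : Γ → Submodule K X} {π : Γ → X →ₗ[K] X}

theorem le_totFamily (γ : Γ) : ℳ γ ≤ totFamily w ℳ (w γ) :=
  le_iSup₂_of_le γ rfl le_rfl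

theorem totFamily_le (k : Γ') : totFamily w ℳ k ≤ ⨆ γ, ℳ γ :=
  iSup₂_le fun γ _ => le_iSup ℳ γ

theorem iSup_totFamily : ⨆ k, totFamily w ℳ k = ⨆ γ, ℳ γ :=
  le_antisymm (iSup_le totFamily_le) (iSup_le fun γ => (le_totFamily γ).trans (le_iSup _ _))

theorem IsProj.apply_totFamily (hπ : IsProj ℳ π) {γ : Γ} {k : Γ'} (hγ : w γ ≠ k) {x : X}
    (hx : x ∈ totFamily w ℳ k) : π γ x = 0 := by
  have : totFamily w ℳ k ≤ LinearMap.ker (π γ) :=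
    iSup₂_le fun δ hδ y hy => hπ.apply_ne hy (fun h => hγ (h ▸ hδ))
  exact this hx

end

variable {Γ : Type*} [AddCommGroup Γ] {𝒜 : Γ → Submodule K R} {ℳ : Γ → Submodule K X}
  {π : Γ → R →ₗ[K] R} {ρ : Γ → X →ₗ[K] X}

instance totFamily.gradedMonoid {M N : Type*} [AddMonoid M] [AddMonoid N] (w : M →+ N)
    (𝒜 : M → Submodule K R) [SetLike.GradedMonoid 𝒜] : SetLike.GradedMonoid (totFamily w 𝒜) where
  one_mem := by
    have := le_totFamily (w := w) (ℳ := 𝒜) 0 (SetLike.one_mem_graded 𝒜)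
    rwa [map_zero] at this
  mul_mem := by
    intro i j x y hx hy
    have h : totFamily w 𝒜 i * totFamily w 𝒜 j ≤ totFamily w 𝒜 (i + j) := by
      unfold totFamily
      simp only [Submodule.iSup_mul, Submodule.mul_iSup]
      refine iSup₂_le fun γ hγ => iSup₂_le fun δ hδ => Submodule.mul_le.2 fun r hr s hs => ?_
      refine Submodule.mem_iSup_of_mem (δ + γ) (Submodule.mem_iSup_of_mem ?_
        (SetLike.mul_mem_graded hr hs))
      rw [map_add, hγ, hδ]
    exact h (Submodule.mul_mem_mul hx hy)

/-- Only `x` is homogeneous. Of all the components of `a`, the one of degree `γ - δ` alone reaches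
degree `γ`. -/
theorem IsProj.smul (hπ : IsProj 𝒜 π) (hρ : IsProj ℳ ρ)
    (hgr : ∀ ⦃γ δ : Γ⦄ ⦃a : R⦄ ⦃x : X⦄, a ∈ 𝒜 γ → x ∈ ℳ δ → a • x ∈ ℳ (γ + δ))
    {a : R} (ha : a ∈ ⨆ γ, 𝒜 γ) {δ : Γ} {x : X} (hx : x ∈ ℳ δ) (γ : Γ) :
    ρ γ (a • x) = π (γ - δ) a • x := by
  induction ha using Submodule.iSup_induction' with
  | mem ε a ha =>
    by_cases h : ε = γ - δ
    · subst h
      rw [hπ.apply_self ha, hρ.apply_self]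
      simpa using hgr ha hx
    · rw [hπ.apply_ne ha h, zero_smul, hρ.apply_ne (hgr ha hx)]
      rintro rfl
      simp at h
  | zero => simp
  | add a b _ _ ha hb => simp only [add_smul, map_add, ha, hb]

/-- The projections onto the components of a graded free module. -/
def freeProj {ι : Type} (π : Γ → R →ₗ[K] R) (deg : ι → Γ) (γ : Γ) : (ι → R) →ₗ[K] (ι → R) :=
  LinearMap.pi fun i => π (γ - deg i) ∘ₗ LinearMap.proj i

theorem freeProj_apply {ι : Type} (deg : ι → Γ) (γ : Γ) (a : ι → R) (i : ι) :
    freeProj π deg γ a i = π (γ - deg i) (a i) := rfl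

theorem IsProj.freeProj {ι : Type} (hπ : IsProj 𝒜 π) (deg : ι → Γ) :
    IsProj (freeFamily 𝒜 deg) (freeProj π deg) := by
  constructor
  · intro γ x hx
    funext i
    exact hπ.apply_self (mem_freeFamily.1 hx i)
  · intro γ δ x hx hne
    funext i
    exact hπ.apply_ne (mem_freeFamily.1 hx i) fun h => hne (sub_left_injective h)

theorem mem_iSup_freeFamily {ι : Type} [Fintype ι] {deg : ι → Γ} {a : ι → R}
    (ha : ∀ i, a i ∈ ⨆ γ, 𝒜 γ) : a ∈ ⨆ γ, freeFamily 𝒜 deg γ := by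
  classical
  have h : ∀ (i : ι) (r : R), r ∈ ⨆ γ, 𝒜 γ → Pi.single i r ∈ ⨆ γ, freeFamily 𝒜 deg γ := by
    intro i r hr
    have : (⨆ γ, 𝒜 γ) ≤ (⨆ γ, freeFamily 𝒜 deg γ).comap
        (LinearMap.single K (fun _ : ι => R) i) := by
      refine iSup_le fun γ r hr => ?_
      refine Submodule.mem_iSup_of_mem (γ + deg i) (mem_freeFamily.2 fun j => ?_)
      rcases eq_or_ne j i with rfl | hj
      · simpa using hr
      · simp [Pi.single_eq_of_ne hj]
    exact this hr
  rw [← Finset.univ_sum_single a]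
  exact Submodule.sum_mem _ fun i _ => h i _ (ha i)

/-- Homogeneous components of a linear combination of homogeneous elements. -/
theorem IsProj.linearCombination (hπ : IsProj 𝒜 π) (hρ : IsProj ℳ ρ)
    (hgr : ∀ ⦃γ δ : Γ⦄ ⦃a : R⦄ ⦃x : X⦄, a ∈ 𝒜 γ → x ∈ ℳ δ → a • x ∈ ℳ (γ + δ))
    {ι : Type} [Fintype ι] {deg : ι → Γ} {m : ι → X} (hm : ∀ i, m i ∈ ℳ (deg i)) {a : ι → R}
    (ha : ∀ i, a i ∈ ⨆ γ, 𝒜 γ) (γ : Γ) :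
    ρ γ (Fintype.linearCombination R m a) =
      Fintype.linearCombination R m (BigradedKoszul.freeProj π deg γ a) := by
  rw [Fintype.linearCombination_apply, Fintype.linearCombination_apply, map_sum]
  exact Finset.sum_congr rfl fun i _ => hπ.smul hρ hgr (ha i) (hm i) γ

end Projections

/-! ### From the total degree back to the finer grading -/

section Coarsening

variable {K : Type u} {R : Type v} [Field K] [CommRing R] [Algebra K R]
  {Γ : Type} [AddCommGroup Γ] {𝒜 : Γ → Submodule K R} {π : Γ → R →ₗ[K] R}

/-- Because the generators are homogeneous for the fine grading, every fine component of a relation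
is again a relation. -/
theorem totFamily_syzFamily (hπ : IsProj 𝒜 π) (htop : ⨆ γ, 𝒜 γ = ⊤) {w : Γ →+ ℤ} {X : Type v}
    [AddCommGroup X] [Module K X] [Module R X] [IsScalarTower K R X] {ℳ : Γ → Submodule K X}
    {ρ : Γ → X →ₗ[K] X} (hρ : IsProj ℳ ρ) (hℳ : IsGradedFamily 𝒜 ℳ) {ι : Type} [Fintype ι]
    {deg : ι → Γ} {m : ι → X} (hm : ∀ i, m i ∈ ℳ (deg i)) :
    syzFamily (totFamily w 𝒜) (fun i => w (deg i)) m = totFamily w (syzFamily 𝒜 deg m) := by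
  have hmem : ∀ r : R, r ∈ ⨆ γ, 𝒜 γ := fun r => htop ▸ Submodule.mem_top
  funext k
  apply le_antisymm
  · intro a ha
    rw [mem_syzFamily] at ha
    obtain ⟨s, hs⟩ := (hπ.freeProj deg).exists_sum
      (mem_iSup_freeFamily (deg := deg) fun i => hmem (a i))
    rw [← hs s subset_rfl]
    refine Submodule.sum_mem _ fun γ _ => ?_
    by_cases hγ : w γ = k
    · refine Submodule.mem_iSup_of_mem γ (Submodule.mem_iSup_of_mem hγ (mem_syzFamily.2
        ⟨fun i => hπ.mem _ (hmem _), ?_⟩))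
      rw [← hπ.linearCombination hρ hℳ hm (fun i => hmem (a i)), ha.2, map_zero]
    · convert Submodule.zero_mem _
      funext i
      refine hπ.apply_totFamily (w := w) (fun h => hγ ?_) (ha.1 i)
      rw [map_sub] at h
      linarith
  · refine iSup₂_le fun γ hγ a ha => ?_
    rw [mem_syzFamily] at ha ⊢
    refine ⟨fun i => ?_, ha.2⟩
    have := le_totFamily (w := w) _ (ha.1 i)
    rwa [map_sub, hγ] at this

/-- A multigraded module satisfying `Reg` with respect to the total degree satisfies `Reg`. -/
theorem reg_of_totFamily [SetLike.GradedMonoid 𝒜] (hπ : IsProj 𝒜 π) (htop : ⨆ γ, 𝒜 γ = ⊤)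
    {w : Γ →+ ℤ} {p : ℕ} : ∀ {t : ℤ} {X : Type v} [AddCommGroup X] [Module K X] [Module R X]
    [IsScalarTower K R X] {ℳ : Γ → Submodule K X} {ρ : Γ → X →ₗ[K] X} (_ : IsProj ℳ ρ)
    (_ : IsGradedFamily 𝒜 ℳ), Reg (totFamily w 𝒜) (AddMonoidHom.id ℤ) p t (totFamily w ℳ) →
    Reg 𝒜 w p t ℳ := by
  classical
  have hmem : ∀ r : R, r ∈ ⨆ γ, 𝒜 γ := fun r => htop ▸ Submodule.mem_top
  induction p with
  | zero => intros; trivial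
  | succ p ih =>
    intro t X _ _ _ _ ℳ ρ hρ hℳ h
    have hgr : IsGradedFamily (totFamily w 𝒜) (totFamily w ℳ) := by
      intro k l a x ha hx
      have h1 : ∀ δ, w δ = l → ∀ y ∈ ℳ δ, a • y ∈ totFamily w ℳ (k + l) := by
        rintro δ rfl y hy
        have : totFamily w 𝒜 k ≤ (totFamily w ℳ (k + w δ)).comap
            ((LinearMap.toSpanSingleton R X y).restrictScalars K) := by
          refine iSup₂_le ?_
          rintro γ rfl b hb
          have := le_totFamily (w := w) _ (hℳ hb hy)
          rwa [map_add] at this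
        exact this ha
      have : totFamily w ℳ l ≤
          (totFamily w ℳ (k + l)).comap (LinearMap.lsmul R X a |>.restrictScalars K) :=
        iSup₂_le fun δ hδ y hy => h1 δ hδ y hy
      exact this hx
    obtain ⟨ι, _, deg, m, h1, h2, -⟩ := id h
    have hm : ∀ i, m i ∈ ⨆ γ, ℳ γ := fun i => totFamily_le _ (h2.mem i)
    choose s hs using fun i => hρ.exists_sum (hm i)
    -- The fine degrees that occur in the generators. The filter removes only zero components, as
    -- each `m i` has weight at most `t`.
    let S : Finset Γ := (Finset.univ.biUnion s).filter fun γ => w γ ≤ t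
    have hS : ∀ i, ∑ γ ∈ S, ρ γ (m i) = m i := by
      intro i
      rw [Finset.sum_filter_of_ne, hs i _ (Finset.subset_biUnion_of_mem s (Finset.mem_univ i))]
      intro γ _ hγ
      by_contra hlt
      refine hγ (hρ.apply_totFamily (w := w) (fun h => hlt ?_) (h2.mem i))
      rw [h]
      exact h1 i
    have hlin : ∀ a : ι → R, Fintype.linearCombination R m a =
        ∑ i, ∑ γ : S, a i • ρ γ (m i) := by
      intro a
      rw [Fintype.linearCombination_apply]
      refine Finset.sum_congr rfl fun i _ => ?_
      conv_lhs => rw [← hS i]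
      rw [Finset.smul_sum, ← Finset.sum_coe_sort]
    obtain ⟨N, e⟩ := Finite.exists_equiv_fin S
    obtain ⟨e⟩ := e
    -- The given generators need not be finely homogeneous, so they are replaced by their
    -- components.
    let deg' : ι × Fin N → Γ := fun j => e.symm j.2
    let n : ι × Fin N → X := fun j => ρ (e.symm j.2) (m j.1)
    have hn : ∀ j, n j ∈ ℳ (deg' j) := fun j => hρ.mem _ (hm j.1)
    have hdeg' : ∀ j, w (deg' j) ≤ t := fun j => (Finset.mem_filter.1 (e.symm j.2).2).2
    have hlin' : ∀ a : ι × Fin N → R, Fintype.linearCombination R n a =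
        ∑ i, ∑ γ : S, a (i, e γ) • ρ γ (m i) := by
      intro a
      rw [Fintype.linearCombination_apply, Fintype.sum_prod_type]
      refine Finset.sum_congr rfl fun i _ => ?_
      rw [← Equiv.sum_comp e]
      simp [n]
    refine ⟨ι × Fin N, inferInstance, deg', n, hdeg', ⟨hn, ?_⟩, ?_⟩
    · intro γ x hx
      obtain ⟨a, -, ha⟩ := h2.exists_eq (le_totFamily (w := w) γ hx)
      refine ⟨fun j => π (γ - deg' j) (a j.1), mem_freeFamily.2 fun j => hπ.mem _ (hmem _), ?_⟩
      rw [← hρ.apply_self hx, ← ha, hlin, hlin']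
      simp only [map_sum]
      refine Finset.sum_congr rfl fun i _ => Finset.sum_congr rfl fun δ _ => ?_
      rw [hπ.smul hρ hℳ (hmem _) (hρ.mem _ (hm i))]
      simp [deg']
    -- The components generate for the coarse grading as well. Hence `Reg.syzFamily` bounds their
    -- coarse relations, which come from the fine ones by `totFamily_syzFamily`.
    · have hgen : Generates (totFamily w 𝒜) (totFamily w ℳ) (fun j => w (deg' j)) n := by
        refine ⟨fun j => le_totFamily _ (hn j), fun k x hx => ?_⟩
        obtain ⟨a, ha, rfl⟩ := h2.exists_eq hx
        -- A component whose weight is not that of `m i` is zero; its coefficient is set to zero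
        -- since it would have the wrong degree.
        refine ⟨fun j => if w (deg' j) = deg j.1 then a j.1 else 0,
          mem_freeFamily.2 fun j => ?_, ?_⟩
        · split_ifs with hj
          · rw [hj]
            exact mem_freeFamily.1 ha _
          · exact Submodule.zero_mem _
        · rw [hlin, hlin']
          refine Finset.sum_congr rfl fun i _ => Finset.sum_congr rfl fun δ _ => ?_
          simp only [deg', Equiv.symm_apply_apply]
          split_ifs with hj
          · rfl
          · rw [hρ.apply_totFamily hj (h2.mem i), smul_zero, smul_zero]
      have h3 := h.syzFamily hgr hgen (fun j => (hdeg' j).trans (by lia))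
      rw [totFamily_syzFamily hπ htop hρ hℳ hn] at h3
      exact ih ((hπ.freeProj deg').mono fun γ => inf_le_left) (isGradedFamily_syzFamily _ _) h3

end Coarsening

/-! ### From a linear resolution to a bound on the maximal ideal -/

section LinearResolution

variable {K : Type u} {R : Type v} [Field K] [CommRing R] [Algebra K R] {Γ : Type*}

/-- The graded ideal of the elements of positive weight. -/
noncomputable def posFamily (𝒜 : Γ → Submodule K R) (w : Γ → ℤ) (γ : Γ) : Submodule K R :=
  if 0 < w γ then 𝒜 γ else ⊥

variable {𝒜 : Γ → Submodule K R}

theorem posFamily_of_pos {w : Γ → ℤ} {γ : Γ} (h : 0 < w γ) : posFamily 𝒜 w γ = 𝒜 γ := if_pos h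

theorem posFamily_of_not_pos {w : Γ → ℤ} {γ : Γ} (h : ¬ 0 < w γ) : posFamily 𝒜 w γ = ⊥ := if_neg h

theorem posFamily_le (w : Γ → ℤ) (γ : Γ) : posFamily 𝒜 w γ ≤ 𝒜 γ := by
  unfold posFamily
  split_ifs
  · exact le_rfl
  · exact bot_le

theorem isGradedFamily_posFamily [AddCommGroup Γ] [SetLike.GradedMonoid 𝒜] {w : Γ →+ ℤ}
    (h : ∀ γ, 𝒜 γ ≠ ⊥ → 0 ≤ w γ) : IsGradedFamily 𝒜 (posFamily 𝒜 w) := by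
  intro γ δ a x ha hx
  by_cases hδ : 0 < w δ
  · rw [posFamily_of_pos hδ] at hx
    by_cases h0 : a = 0
    · rw [h0, zero_smul]
      exact Submodule.zero_mem _
    · have := h γ fun hb => h0 (by rwa [hb] at ha)
      rw [posFamily_of_pos (by rw [map_add]; lia)]
      exact SetLike.mul_mem_graded ha hx
  · rw [posFamily_of_not_pos hδ, Submodule.mem_bot] at hx
    rw [hx, smul_zero]
    exact Submodule.zero_mem _

theorem totFamily_posFamily (w : Γ → ℤ) :
    totFamily w (posFamily 𝒜 w) = posFamily (totFamily w 𝒜) id := by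
  funext k
  by_cases hk : 0 < k
  · rw [posFamily_of_pos (by exact hk)]
    refine iSup_congr fun γ => iSup_congr fun hγ => ?_
    rw [posFamily_of_pos (hγ ▸ hk)]
  · rw [posFamily_of_not_pos (by exact hk)]
    refine eq_bot_iff.2 (iSup₂_le fun γ hγ => ?_)
    rw [posFamily_of_not_pos (hγ ▸ hk)]

theorem linearCombination_apply_basis {X : Type v} [AddCommGroup X] [Module R X] {n : ℕ}
    (f : (Fin n → R) →ₗ[R] X) (a : Fin n → R) :
    Fintype.linearCombination R (fun j => f (Pi.single j 1)) a = f a := by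
  conv_rhs => rw [← Finset.univ_sum_single a, map_sum]
  rw [Fintype.linearCombination_apply]
  refine Finset.sum_congr rfl fun i _ => ?_
  rw [← map_smul]
  congr 1
  rw [← Pi.single_smul, smul_eq_mul, mul_one]

/-- The graded pieces of a linear free resolution show that the ideal `R₊` satisfies `Reg`. -/
theorem LinearFreeResolution.regInf {𝒢 : ℕ → Submodule K R} (L : LinearFreeResolution 𝒢)
    {𝒯 : ℤ → Submodule K R} [SetLike.GradedMonoid 𝒯] (h𝒯 : ∀ n : ℕ, 𝒯 n = 𝒢 n)
    (h𝒯' : ∀ k < 0, 𝒯 k = ⊥) {π : ℤ → R →ₗ[K] R} (hπ : IsProj 𝒯 π) (htop : ⨆ k, 𝒯 k = ⊤) :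
    RegInf 𝒯 (AddMonoidHom.id ℤ) 1 (posFamily 𝒯 id) := by
  have hmem : ∀ r : R, r ∈ ⨆ γ, 𝒯 γ := fun r => htop ▸ Submodule.mem_top
  -- homogeneous preimages under a homogeneous map
  have hgen : ∀ {X : Type v} [AddCommGroup X] [Module K X] [Module R X] [IsScalarTower K R X]
      {ℳ : ℤ → Submodule K X} {ρ : ℤ → X →ₗ[K] X} (_ : IsProj ℳ ρ) (_ : IsGradedFamily 𝒯 ℳ)
      {n : ℕ} {c : ℤ} (f : (Fin n → R) →ₗ[R] X) (_ : ∀ j, f (Pi.single j 1) ∈ ℳ c) {k : ℤ}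
      (v : Fin n → R), f v ∈ ℳ k → ∃ a ∈ freeFamily 𝒯 (fun _ : Fin n => c) k, f a = f v := by
    intro X _ _ _ _ ℳ ρ hρ hℳ n c f hf k v hv
    refine ⟨freeProj π (fun _ => c) k v, mem_freeFamily.2 fun j => hπ.mem _ (hmem _), ?_⟩
    rw [← linearCombination_apply_basis f, ← hπ.linearCombination hρ hℳ hf fun i => hmem _,
      linearCombination_apply_basis f, hρ.apply_self hv]
  have hd : ∀ i j, L.d i (Pi.single j 1) ∈
      freeFamily 𝒯 (fun _ : Fin (L.rank i) => (i : ℤ)) (i + 1) := by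
    intro i j
    have h1 : (Pi.single j 1 : Fin (L.rank (i + 1)) → R) ∈
        shiftedFreeComponent 𝒢 (i + 1) (L.rank (i + 1)) (i + 1) := by
      rw [shiftedFreeComponent, if_pos le_rfl]
      intro l _
      rw [Nat.sub_self, ← h𝒯]
      rcases eq_or_ne l j with rfl | hl
      · rw [Pi.single_eq_same]
        exact SetLike.one_mem_graded 𝒯
      · rw [Pi.single_eq_of_ne hl]
        exact Submodule.zero_mem _
    have h2 := L.d_degree i (i + 1) _ h1
    rw [shiftedFreeComponent, if_pos (Nat.le_succ i)] at h2
    refine mem_freeFamily.2 fun l => ?_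
    have h3 := h2 l trivial
    rw [Nat.add_sub_cancel_left, ← h𝒯] at h3
    simpa using h3
  -- By exactness the kernel of `d i` is the image of the next term, whose basis has degree `i + 2`.
  have hZ : ∀ (p i : ℕ), Reg 𝒯 (AddMonoidHom.id ℤ) p ((i : ℤ) + 2)
      (kerFamily (freeFamily 𝒯 fun _ : Fin (L.rank (i + 1)) => ((i + 1 : ℕ) : ℤ)) (L.d i)) := by
    intro p
    induction p with
    | zero => intros; trivial
    | succ p ih =>
      intro i
      refine ⟨Fin (L.rank (i + 2)), inferInstance, fun _ => ((i + 2 : ℕ) : ℤ),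
        fun j => L.d (i + 1) (Pi.single j 1), fun _ => by simp, ⟨fun j => ?_, ?_⟩, ?_⟩
      · refine mem_kerFamily.2 ⟨hd (i + 1) j, ?_⟩
        exact (L.exact_succ i).apply_apply_eq_zero _
      · intro k x hx
        rw [mem_kerFamily] at hx
        obtain ⟨v, rfl⟩ := (L.exact_succ i x).1 hx.2
        simp only [linearCombination_apply_basis]
        exact hgen (hπ.freeProj _) (isGradedFamily_freeFamily _) (L.d (i + 1)) (hd (i + 1)) v hx.1
      · have h1 := ih (i + 1)
        push_cast at h1
        rw [show (i : ℤ) + 2 + 1 = i + 1 + 2 by ring]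
        convert h1 using 1
        funext k
        ext a
        rw [mem_syzFamily, linearCombination_apply_basis, mem_kerFamily, mem_freeFamily]
        push_cast
        rfl
  -- the residue field, concentrated in degree zero
  let κ : ℤ → Submodule K (R ⧸ irrelevantIdeal 𝒢) := fun k => if k = 0 then ⊤ else ⊥
  have hpos : ∀ {k : ℤ} {x : R}, k ≠ 0 → x ∈ 𝒯 k → x ∈ irrelevantIdeal 𝒢 := by
    intro k x hk hx
    rcases lt_or_gt_of_ne hk with h | h
    · rw [h𝒯' k h, Submodule.mem_bot] at hx
      rw [hx]
      exact Ideal.zero_mem _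
    · lift k to ℕ using h.le
      rw [h𝒯] at hx
      exact Ideal.subset_span ⟨k, by exact_mod_cast h, hx⟩
  have hκ : IsProj κ (fun k => if k = 0 then LinearMap.id else 0) := by
    refine ⟨fun k x hx => ?_, fun k l x hx hne => ?_⟩
    · dsimp only [κ] at hx ⊢
      split_ifs at hx ⊢ with h
      · rfl
      · rw [(Submodule.mem_bot K).1 hx, map_zero]
    · by_cases hl : l = 0
      · have hk : k ≠ 0 := fun h => hne (hl.trans h.symm)
        simp [hk]
      · have : x = 0 := by simpa [κ, hl] using hx
        rw [this, map_zero]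
  have hκgr : IsGradedFamily 𝒯 κ := by
    intro k l a x ha hx
    by_cases hl : l = 0
    · subst hl
      by_cases hk : k = 0
      · subst hk
        simp [κ]
      · obtain ⟨y, rfl⟩ := Ideal.Quotient.mk_surjective x
        convert Submodule.zero_mem _
        rw [Algebra.smul_def, Ideal.Quotient.algebraMap_eq, ← map_mul,
          Ideal.Quotient.eq_zero_iff_mem]
        exact Ideal.mul_mem_right _ _ (hpos hk ha)
    · have : x = 0 := by simpa [κ, hl] using hx
      rw [this, smul_zero]
      exact Submodule.zero_mem _
  have hε : ∀ j, L.ε (Pi.single j 1) ∈ κ 0 := fun j => by simp [κ]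
  have hKreg : RegInf 𝒯 (AddMonoidHom.id ℤ) 0 κ := by
    intro p
    rcases p with _ | p
    · trivial
    refine ⟨Fin (L.rank 0), inferInstance, fun _ => 0, fun j => L.ε (Pi.single j 1),
      fun _ => by simp, ⟨hε, ?_⟩, ?_⟩
    · intro k x hx
      obtain ⟨v, rfl⟩ := L.ε_surjective x
      simp only [linearCombination_apply_basis]
      exact hgen hκ hκgr L.ε hε v hx
    · rcases p with _ | p
      · trivial
      refine ⟨Fin (L.rank 1), inferInstance, fun _ => 1,
        fun j => L.d 0 (Pi.single j 1), fun _ => by simp, ⟨fun j => ?_, ?_⟩, ?_⟩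
      · rw [mem_syzFamily, linearCombination_apply_basis, ← mem_freeFamily]
        refine ⟨by simpa using hd 0 j, L.exact_zero.apply_apply_eq_zero _⟩
      · intro k x hx
        rw [mem_syzFamily, linearCombination_apply_basis, ← mem_freeFamily] at hx
        obtain ⟨v, rfl⟩ := (L.exact_zero x).1 hx.2
        simp only [linearCombination_apply_basis]
        refine hgen (hπ.freeProj fun _ => 0) (isGradedFamily_freeFamily _) (L.d 0) ?_ v hx.1
        intro j
        simpa using hd 0 j
      · have h1 := hZ p 0
        rw [show (0 : ℤ) + 1 + 1 = ((0 : ℕ) : ℤ) + 2 by norm_num]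
        convert h1 using 1
        funext k
        ext a
        rw [mem_syzFamily, linearCombination_apply_basis, mem_kerFamily, mem_freeFamily]
        simp
  let q : R →ₗ[R] R ⧸ irrelevantIdeal 𝒢 := Submodule.mkQ (irrelevantIdeal 𝒢)
  have hq0 : ∀ r, q (π 0 r) = q r := by
    intro r
    have := hmem r
    induction this using Submodule.iSup_induction' with
    | mem k r hr =>
      by_cases hk : k = 0
      · subst hk
        rw [hπ.apply_self hr]
      · rw [hπ.apply_ne hr hk, map_zero, eq_comm]
        exact Ideal.Quotient.eq_zero_iff_mem.2 (hpos hk hr)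
    | zero => simp
    | add x y _ _ hx hy => simp only [map_add, hx, hy]
  have hq : MapsOnto q 𝒯 κ := by
    constructor
    · intro k x hx
      by_cases hk : k = 0
      · simp [κ, hk]
      · convert Submodule.zero_mem _
        exact Ideal.Quotient.eq_zero_iff_mem.2 (hpos hk hx)
    · intro k x hx
      by_cases hk : k = 0
      · subst hk
        obtain ⟨r, rfl⟩ := Ideal.Quotient.mk_surjective x
        exact ⟨π 0 r, hπ.mem _ (hmem _), hq0 r⟩
      · have : x = 0 := by simpa [κ, hk] using hx
        exact ⟨0, Submodule.zero_mem _, by rw [this, map_zero]⟩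
  have hirr : ∀ r ∈ irrelevantIdeal 𝒢, π 0 r = 0 := by
    -- The arbitrary factor `a` makes the claim stable under the scalars in the span induction. For
    -- a generator of degree `i > 0` only the component of `a` in degree `-i` could contribute, and
    -- it vanishes.
    have : ∀ r ∈ irrelevantIdeal 𝒢, ∀ a : R, π 0 (a • r) = 0 := by
      intro r hr
      induction hr using Submodule.span_induction with
      | mem x hx =>
        intro a
        obtain ⟨i, hi, hx⟩ := hx
        rw [← h𝒯] at hx
        rw [hπ.smul hπ isGradedFamily_self (hmem a) hx]
        have := hπ.mem (0 - (i : ℤ)) (hmem a)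
        rw [h𝒯' _ (by simpa using hi), Submodule.mem_bot] at this
        rw [this, zero_smul]
      | zero => simp
      | add x y _ _ hx hy => intro a; rw [smul_add, map_add, hx, hy, add_zero]
      | smul b x _ hx => intro a; rw [smul_smul, hx]
    intro r hr
    simpa using this r hr 1
  intro p
  -- The ideal `R₊` is the kernel of `R → K`. Both modules satisfy the bound `0`, and passing to the
  -- kernel costs one.
  have h1 := hq.reg_ker isGradedFamily_self (p := p) (t := 0)
    ((reg_self p).mono (by norm_num)) (hKreg _)
  rw [zero_add] at h1
  convert h1 using 1
  funext k
  ext x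
  rw [mem_kerFamily]
  have hqx : q x = 0 ↔ x ∈ irrelevantIdeal 𝒢 := Ideal.Quotient.eq_zero_iff_mem
  rcases lt_trichotomy k 0 with hk | rfl | hk
  · rw [posFamily_of_not_pos (by simpa using hk.le), h𝒯' k hk]
    simp +contextual
  · rw [posFamily_of_not_pos (by simp), Submodule.mem_bot]
    constructor
    · rintro rfl
      exact ⟨Submodule.zero_mem _, map_zero _⟩
    · rintro ⟨hx, hx'⟩
      rw [← hπ.apply_self hx, hirr x (hqx.1 hx')]
  · rw [posFamily_of_pos (by exact hk), hqx]
    exact ⟨fun h => ⟨h, hpos hk.ne' h⟩, fun h => h.1⟩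

end LinearResolution

/-! ### The total complex of two sequences of matrices -/

section Retract

variable {K : Type u} {R : Type v} [Field K] [CommRing R] [Algebra K R] {Γ : Type}

/-- The part of the graded module `ℳ` where the linear form `l` vanishes. -/
noncomputable def zeroPart {X : Type v} [AddCommGroup X] [Module K X] (ℳ : Γ → Submodule K X)
    (l : Γ → ℤ) (γ : Γ) : Submodule K X :=
  if l γ = 0 then ℳ γ else ⊥

section

variable {X : Type v} [AddCommGroup X] [Module K X] {ℳ : Γ → Submodule K X} {l : Γ → ℤ} {γ : Γ}

theorem zeroPart_of_eq (h : l γ = 0) : zeroPart ℳ l γ = ℳ γ := if_pos h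

theorem zeroPart_of_ne (h : l γ ≠ 0) : zeroPart ℳ l γ = ⊥ := if_neg h

theorem zeroPart_le (γ : Γ) : zeroPart ℳ l γ ≤ ℳ γ := by
  unfold zeroPart
  split_ifs
  · exact le_rfl
  · exact bot_le

end

instance zeroPart.gradedMonoid [AddCommGroup Γ] (𝒜 : Γ → Submodule K R) [SetLike.GradedMonoid 𝒜]
    (l : Γ →+ ℤ) : SetLike.GradedMonoid (zeroPart 𝒜 l) where
  one_mem := by
    rw [zeroPart_of_eq (map_zero l)]
    exact SetLike.one_mem_graded 𝒜
  mul_mem := by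
    intro γ δ a b ha hb
    by_cases h : l γ = 0 ∧ l δ = 0
    · rw [zeroPart_of_eq h.1] at ha
      rw [zeroPart_of_eq h.2] at hb
      rw [zeroPart_of_eq (by rw [map_add, h.1, h.2, add_zero])]
      exact SetLike.mul_mem_graded ha hb
    · have : a = 0 ∨ b = 0 := by
        by_cases h1 : l γ = 0
        · rw [zeroPart_of_ne fun h2 => h ⟨h1, h2⟩] at hb
          exact Or.inr hb
        · rw [zeroPart_of_ne h1] at ha
          exact Or.inl ha
      have h0 : a * b = 0 := by rcases this with rfl | rfl <;> simp
      rw [h0]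
      exact Submodule.zero_mem _

/-- Two sequences of matrices `∂` and `D`, to be viewed as complexes of free modules `F` and `G`. -/
structure MatrixPair (R : Type v) where
  f : ℕ → ℕ
  g : ℕ → ℕ
  bd : ∀ p, Fin (f (p + 1)) → Fin (f p) → R
  D : ∀ q, Fin (g (q + 1)) → Fin (g q) → R

namespace MatrixPair

variable (M : MatrixPair R)

/-- The basis of `⨁_{i ≤ q} F_{p+i} ⊗ G_{q-i}`. -/
def idx : ℕ → ℕ → Type
  | 0, p => Fin (M.f p) × Fin (M.g 0)
  | q + 1, p => (Fin (M.f p) × Fin (M.g (q + 1))) ⊕ idx q (p + 1)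

instance fintypeIdx : ∀ q p, Fintype (M.idx q p)
  | 0, p => inferInstanceAs (Fintype (Fin (M.f p) × Fin (M.g 0)))
  | q + 1, p =>
    letI := fintypeIdx q (p + 1)
    inferInstanceAs (Fintype ((Fin (M.f p) × Fin (M.g (q + 1))) ⊕ M.idx q (p + 1)))

/-- The projection onto the summand `F_p ⊗ G_q`. -/
def hd : ∀ q p, (M.idx q p → R) →ₗ[R] (Fin (M.f p) × Fin (M.g q) → R)
  | 0, _ => LinearMap.id
  | _ + 1, _ => LinearMap.funLeft R R Sum.inl

/-- The projection onto the summands other than `F_p ⊗ G_{q+1}`. -/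
def tl (q p : ℕ) : (M.idx (q + 1) p → R) →ₗ[R] (M.idx q (p + 1) → R) :=
  LinearMap.funLeft R R Sum.inr

/-- An element of `⨁_{i ≤ q + 1} F_{p+i} ⊗ G_{q+1-i}` in terms of its two projections. -/
def pair {q p : ℕ} (a : Fin (M.f p) × Fin (M.g (q + 1)) → R) (b : M.idx q (p + 1) → R) :
    M.idx (q + 1) p → R :=
  Sum.elim a b

/-- The differential of `F`. -/
noncomputable def dF (q p : ℕ) :
    (Fin (M.f (p + 1)) × Fin (M.g q) → R) →ₗ[R] (Fin (M.f p) × Fin (M.g q) → R) :=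
  LinearMap.pi fun x => LinearMap.proj x.1 ∘ₗ Fintype.linearCombination R (M.bd p) ∘ₗ
    LinearMap.funLeft R R fun i => (i, x.2)

/-- The differential of `G`. -/
noncomputable def dG (q p : ℕ) :
    (Fin (M.f p) × Fin (M.g (q + 1)) → R) →ₗ[R] (Fin (M.f p) × Fin (M.g q) → R) :=
  LinearMap.pi fun x => LinearMap.proj x.2 ∘ₗ Fintype.linearCombination R (M.D q) ∘ₗ
    LinearMap.funLeft R R fun l => (x.1, l)

/-- The differential of the total complex of `F ⊗ G`. -/
noncomputable def tot : ∀ q p, (M.idx (q + 1) p → R) →ₗ[R] (M.idx q p → R)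
  | 0, p => M.dG 0 p ∘ₗ M.hd 1 p + M.dF 0 p ∘ₗ M.hd 0 (p + 1) ∘ₗ M.tl 0 p
  | q + 1, p => LinearMap.pi (Sum.rec
      (fun x => LinearMap.proj x ∘ₗ
        (M.dG (q + 1) p ∘ₗ M.hd (q + 2) p + M.dF (q + 1) p ∘ₗ M.hd (q + 1) (p + 1) ∘ₗ M.tl (q + 1) p))
      (fun x => LinearMap.proj x ∘ₗ (-(tot q (p + 1) ∘ₗ M.tl (q + 1) p))))

variable {M}

@[simp] theorem hd_pair {q p : ℕ} (a : Fin (M.f p) × Fin (M.g (q + 1)) → R)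
    (b : M.idx q (p + 1) → R) : M.hd (q + 1) p (M.pair a b) = a := rfl

@[simp] theorem tl_pair {q p : ℕ} (a : Fin (M.f p) × Fin (M.g (q + 1)) → R)
    (b : M.idx q (p + 1) → R) : M.tl q p (M.pair a b) = b := rfl

theorem ext_hd_tl {q p : ℕ} {z z' : M.idx (q + 1) p → R}
    (h : M.hd (q + 1) p z = M.hd (q + 1) p z') (h' : M.tl q p z = M.tl q p z') : z = z' := by
  funext x
  rcases x with x | x
  · exact congrFun h x
  · exact congrFun h' x

theorem pair_hd_tl {q p : ℕ} (z : M.idx (q + 1) p → R) :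
    M.pair (M.hd (q + 1) p z) (M.tl q p z) = z :=
  ext_hd_tl rfl rfl

theorem dF_apply {q p : ℕ} (z : Fin (M.f (p + 1)) × Fin (M.g q) → R) (x) :
    M.dF q p z x = ∑ i, z (i, x.2) * M.bd p i x.1 := by
  have : M.dF q p z x = Fintype.linearCombination R (M.bd p) (fun i => z (i, x.2)) x.1 := rfl
  rw [this, Fintype.linearCombination_apply, Finset.sum_apply]
  rfl

theorem dG_apply {q p : ℕ} (z : Fin (M.f p) × Fin (M.g (q + 1)) → R) (x) :
    M.dG q p z x = ∑ l, z (x.1, l) * M.D q l x.2 := by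
  have : M.dG q p z x = Fintype.linearCombination R (M.D q) (fun l => z (x.1, l)) x.2 := rfl
  rw [this, Fintype.linearCombination_apply, Finset.sum_apply]
  rfl

/-- The differentials act on different tensor factors and hence commute. The sign that makes `tot` a
differential is placed on the summands beyond `F_p`. -/
theorem dG_dF {q p : ℕ} (z : Fin (M.f (p + 1)) × Fin (M.g (q + 1)) → R) :
    M.dG q p (M.dF (q + 1) p z) = M.dF q p (M.dG q (p + 1) z) := by
  funext x
  simp only [dG_apply, dF_apply, Finset.sum_mul]
  rw [Finset.sum_comm]
  exact Finset.sum_congr rfl fun i _ => Finset.sum_congr rfl fun l _ => by ring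

theorem hd_tot {q p : ℕ} (z : M.idx (q + 1) p → R) :
    M.hd q p (M.tot q p z) =
      M.dG q p (M.hd (q + 1) p z) + M.dF q p (M.hd q (p + 1) (M.tl q p z)) := by
  cases q <;> rfl

theorem tl_tot {q p : ℕ} (z : M.idx (q + 2) p → R) :
    M.tl q p (M.tot (q + 1) p z) = -M.tot q (p + 1) (M.tl (q + 1) p z) := rfl

/-- The bound `n` is there because `G` is used while only its first `n` steps are known. -/
theorem tot_tot {n : ℕ} (hF : ∀ q p z, M.dF q p (M.dF q (p + 1) z) = 0)
    (hG : ∀ q p z, q + 1 < n → M.dG q p (M.dG (q + 1) p z) = 0) {q : ℕ} (hq : q + 1 < n) :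
    ∀ {p : ℕ} (z : M.idx (q + 2) p → R), M.tot q p (M.tot (q + 1) p z) = 0 := by
  have key : ∀ {q p : ℕ} (_ : q + 1 < n) (z : M.idx (q + 2) p → R),
      M.hd q p (M.tot q p (M.tot (q + 1) p z)) = 0 := by
    intro q p hq z
    rw [hd_tot, tl_tot, hd_tot, map_add, hG q p _ hq, map_neg, hd_tot, map_neg, map_add, hF, dG_dF]
    simp
  induction q with
  | zero => intro p z; exact key hq z
  | succ q ih =>
    intro p z
    refine ext_hd_tl (by rw [key hq, map_zero]) ?_
    rw [tl_tot, tl_tot, map_neg, neg_neg, ih (by lia), map_zero]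

/-- The degrees of the basis of `F_p ⊗ G_q`. -/
def xdeg [Add Γ] (fdeg : ∀ p, Fin (M.f p) → Γ) (gdeg : ∀ q, Fin (M.g q) → Γ) (q p : ℕ)
    (x : Fin (M.f p) × Fin (M.g q)) : Γ :=
  fdeg p x.1 + gdeg q x.2

/-- The degrees of the basis of `⨁_{i ≤ q} F_{p+i} ⊗ G_{q-i}`. -/
def tdeg [Add Γ] (fdeg : ∀ p, Fin (M.f p) → Γ) (gdeg : ∀ q, Fin (M.g q) → Γ) :
    ∀ q p, M.idx q p → Γ
  | 0, p => xdeg fdeg gdeg 0 p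
  | q + 1, p => Sum.elim (xdeg fdeg gdeg (q + 1) p) (tdeg fdeg gdeg q (p + 1))

variable [AddCommGroup Γ] {𝓡 : Γ → Submodule K R} {fdeg : ∀ p, Fin (M.f p) → Γ}
  {gdeg : ∀ q, Fin (M.g q) → Γ}

theorem hd_mem {q p : ℕ} {γ : Γ} {z : M.idx q p → R}
    (hz : z ∈ freeFamily 𝓡 (tdeg fdeg gdeg q p) γ) :
    M.hd q p z ∈ freeFamily 𝓡 (xdeg fdeg gdeg q p) γ := by
  rw [mem_freeFamily] at hz ⊢
  intro x
  cases q with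
  | zero => exact hz x
  | succ q => exact hz (Sum.inl x)

theorem tl_mem {q p : ℕ} {γ : Γ} {z : M.idx (q + 1) p → R}
    (hz : z ∈ freeFamily 𝓡 (tdeg fdeg gdeg (q + 1) p) γ) :
    M.tl q p z ∈ freeFamily 𝓡 (tdeg fdeg gdeg q (p + 1)) γ := by
  rw [mem_freeFamily] at hz ⊢
  exact fun x => hz (Sum.inr x)

theorem pair_mem {q p : ℕ} {γ : Γ} {a : Fin (M.f p) × Fin (M.g (q + 1)) → R}
    {b : M.idx q (p + 1) → R} (ha : a ∈ freeFamily 𝓡 (xdeg fdeg gdeg (q + 1) p) γ)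
    (hb : b ∈ freeFamily 𝓡 (tdeg fdeg gdeg q (p + 1)) γ) :
    M.pair a b ∈ freeFamily 𝓡 (tdeg fdeg gdeg (q + 1) p) γ := by
  rw [mem_freeFamily] at ha hb ⊢
  rintro (x | x)
  · exact ha x
  · exact hb x

variable [SetLike.GradedMonoid 𝓡]

theorem dF_mem {q p : ℕ} (hbd : ∀ i, M.bd p i ∈ freeFamily 𝓡 (fdeg p) (fdeg (p + 1) i)) {γ : Γ}
    {z : Fin (M.f (p + 1)) × Fin (M.g q) → R}
    (hz : z ∈ freeFamily 𝓡 (xdeg fdeg gdeg q (p + 1)) γ) :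
    M.dF q p z ∈ freeFamily 𝓡 (xdeg fdeg gdeg q p) γ := by
  refine mem_freeFamily.2 fun x => ?_
  rw [dF_apply]
  refine Submodule.sum_mem _ fun i _ => ?_
  have := SetLike.mul_mem_graded (mem_freeFamily.1 hz (i, x.2)) (mem_freeFamily.1 (hbd i) x.1)
  convert this using 2
  simp only [xdeg]
  abel

theorem dG_mem {q p : ℕ} (hD : ∀ l, M.D q l ∈ freeFamily 𝓡 (gdeg q) (gdeg (q + 1) l)) {γ : Γ}
    {z : Fin (M.f p) × Fin (M.g (q + 1)) → R}
    (hz : z ∈ freeFamily 𝓡 (xdeg fdeg gdeg (q + 1) p) γ) :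
    M.dG q p z ∈ freeFamily 𝓡 (xdeg fdeg gdeg q p) γ := by
  refine mem_freeFamily.2 fun x => ?_
  rw [dG_apply]
  refine Submodule.sum_mem _ fun l _ => ?_
  have := SetLike.mul_mem_graded (mem_freeFamily.1 hz (x.1, l)) (mem_freeFamily.1 (hD l) x.2)
  convert this using 2
  simp only [xdeg]
  abel

theorem tot_mem {n : ℕ} (hbd : ∀ p i, M.bd p i ∈ freeFamily 𝓡 (fdeg p) (fdeg (p + 1) i))
    (hD : ∀ q < n, ∀ l, M.D q l ∈ freeFamily 𝓡 (gdeg q) (gdeg (q + 1) l)) {γ : Γ} {q : ℕ}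
    (hq : q < n) : ∀ {p : ℕ} {z : M.idx (q + 1) p → R},
    z ∈ freeFamily 𝓡 (tdeg fdeg gdeg (q + 1) p) γ →
    M.tot q p z ∈ freeFamily 𝓡 (tdeg fdeg gdeg q p) γ := by
  have key : ∀ {q p : ℕ} (_ : q < n) {z : M.idx (q + 1) p → R},
      z ∈ freeFamily 𝓡 (tdeg fdeg gdeg (q + 1) p) γ →
      M.hd q p (M.tot q p z) ∈ freeFamily 𝓡 (xdeg fdeg gdeg q p) γ := by
    intro q p hq z hz
    rw [hd_tot]
    exact Submodule.add_mem _ (dG_mem (hD q hq) (hd_mem hz)) (dF_mem (hbd p) (hd_mem (tl_mem hz)))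
  induction q with
  | zero => intro p z hz; exact key hq hz
  | succ q ih =>
    intro p z hz
    rw [← pair_hd_tl (M.tot (q + 1) p z)]
    exact pair_mem (key hq hz) (Submodule.neg_mem _ (ih (by lia) (tl_mem hz)))

end MatrixPair

end Retract

/-! ### Exactness of the total complex, and generators of the next syzygy -/

section Retract

variable {K : Type u} {R : Type v} [Field K] [CommRing R] [Algebra K R] {Γ : Type}
  [AddCommGroup Γ]

/-- `F` is a resolution of a direct sum of copies of the residue field over the part of `R` where
`l` vanishes, and `G` is the beginning of a resolution of a direct sum of copies of `R ⧸ (l > 0)`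
over `R`. The graded modules `ZF p` and `ZG q` are the respective syzygies. -/
structure ResolutionPair (𝓡 : Γ → Submodule K R) (w l : Γ →+ ℤ) (n : ℕ) extends MatrixPair R where
  fdeg : ∀ p, Fin (f p) → Γ
  gdeg : ∀ q, Fin (g q) → Γ
  ZF : ∀ p, Γ → Submodule K (Fin (f p) → R)
  ZG : ∀ q, Γ → Submodule K (Fin (g q) → R)
  base : Fin (f 0)
  fdeg_zero : ∀ i, fdeg 0 i = 0
  gdeg_zero : ∀ i, gdeg 0 i = 0
  mem_ZF_zero : ∀ γ x, x ∈ ZF 0 γ ↔ ∀ i, x i ∈ posFamily (zeroPart 𝓡 l) w γ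
  mem_ZG_zero : ∀ γ x, x ∈ ZG 0 γ ↔ ∀ i, x i ∈ posFamily 𝓡 l γ
  genF : ∀ p, Generates (zeroPart 𝓡 l) (ZF p) (fdeg (p + 1)) (bd p)
  ZF_succ : ∀ p, ZF (p + 1) = syzFamily (zeroPart 𝓡 l) (fdeg (p + 1)) (bd p)
  genG : ∀ q < n, Generates 𝓡 (ZG q) (gdeg (q + 1)) (D q)
  ZG_succ : ∀ q < n, ZG (q + 1) = syzFamily 𝓡 (gdeg (q + 1)) (D q)
  weight_fdeg_le : ∀ p i, w (fdeg p i) ≤ p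
  apply_fdeg : ∀ p i, l (fdeg p i) = 0
  weight_fdeg_one : ∀ i, 0 < w (fdeg 1 i)
  weight_gdeg_le : ∀ q ≤ n, ∀ i, w (gdeg q i) ≤ q
  weight_gdeg_nonneg : ∀ q ≤ n, ∀ i, 0 ≤ w (gdeg q i)

namespace ResolutionPair

open MatrixPair

variable {𝓡 : Γ → Submodule K R} [SetLike.GradedMonoid 𝓡] {w l : Γ →+ ℤ} {n : ℕ}
  (P : ResolutionPair 𝓡 w l n)

theorem isGradedFamily_ZG (hl : ∀ γ, 𝓡 γ ≠ ⊥ → 0 ≤ l γ) :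
    ∀ q ≤ n, IsGradedFamily 𝓡 (P.ZG q)
  | 0, _ => by
    intro γ δ a x ha hx
    rw [P.mem_ZG_zero] at hx ⊢
    exact fun i => isGradedFamily_posFamily hl ha (hx i)
  | q + 1, hq => by
    rw [P.ZG_succ q hq]
    exact isGradedFamily_syzFamily _ _

theorem ZG_le : ∀ q ≤ n, ∀ γ, P.ZG q γ ≤ freeFamily 𝓡 (P.gdeg q) γ
  | 0, _, γ => by
    intro x hx
    rw [P.mem_ZG_zero] at hx
    refine mem_freeFamily.2 fun i => ?_
    rw [P.gdeg_zero, sub_zero]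
    exact posFamily_le _ _ (hx i)
  | q + 1, hq, γ => by
    rw [P.ZG_succ q hq]
    exact inf_le_left

theorem ZF_le : ∀ p γ, P.ZF p γ ≤ freeFamily (zeroPart 𝓡 l) (P.fdeg p) γ
  | 0, γ => by
    intro x hx
    rw [P.mem_ZF_zero] at hx
    refine mem_freeFamily.2 fun i => ?_
    rw [P.fdeg_zero, sub_zero]
    exact posFamily_le _ _ (hx i)
  | p + 1, γ => by
    rw [P.ZF_succ p]
    exact inf_le_left

theorem bd_mem (p : ℕ) (i) : P.bd p i ∈ freeFamily 𝓡 (P.fdeg p) (P.fdeg (p + 1) i) :=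
  mem_freeFamily.2 fun j =>
    zeroPart_le _ (mem_freeFamily.1 (P.ZF_le p _ ((P.genF p).mem i)) j)

theorem D_mem (q : ℕ) (hq : q < n) (i) :
    P.D q i ∈ freeFamily 𝓡 (P.gdeg q) (P.gdeg (q + 1) i) :=
  P.ZG_le q hq.le _ ((P.genG q hq).mem i)

theorem dF_dF (q p : ℕ) (z) : P.dF q p (P.dF q (p + 1) z) = 0 := by
  funext x
  have h : ∀ i, Fintype.linearCombination R (P.bd p) (P.bd (p + 1) i) = 0 := by
    intro i
    have := (P.genF (p + 1)).mem i
    rw [P.ZF_succ, mem_syzFamily] at this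
    exact this.2
  have h' : ∀ i, ∑ j, P.bd (p + 1) i j * P.bd p j x.1 = 0 := by
    intro i
    have := congrFun (h i) x.1
    rwa [Fintype.linearCombination_apply, Finset.sum_apply] at this
  simp only [dF_apply, Finset.sum_mul]
  rw [Finset.sum_comm]
  refine Finset.sum_eq_zero fun i _ => ?_
  simp only [mul_assoc, ← Finset.mul_sum]
  rw [h', mul_zero]

theorem dG_eq_zero_iff {q : ℕ} (hq : q < n) {p : ℕ} {γ : Γ}
    {z : Fin (P.f p) × Fin (P.g (q + 1)) → R}
    (hz : z ∈ freeFamily 𝓡 (xdeg P.fdeg P.gdeg (q + 1) p) γ) :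
    P.dG q p z = 0 ↔ ∀ i, (fun k => z (i, k)) ∈ P.ZG (q + 1) (γ - P.fdeg p i) := by
  have hz' : ∀ i k, z (i, k) ∈ 𝓡 (γ - P.fdeg p i - P.gdeg (q + 1) k) := by
    intro i k
    rw [sub_sub]
    exact mem_freeFamily.1 hz (i, k)
  constructor
  · intro h i
    rw [P.ZG_succ q hq, mem_syzFamily]
    refine ⟨hz' i, ?_⟩
    funext k
    exact congrFun h (i, k)
  · intro h
    funext x
    have := h x.1
    rw [P.ZG_succ q hq, mem_syzFamily] at this
    exact congrFun this.2 x.2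

theorem dG_dG {q p : ℕ} (hq : q + 1 < n) (z) : P.dG q p (P.dG (q + 1) p z) = 0 := by
  funext x
  have h : ∀ i, Fintype.linearCombination R (P.D q) (P.D (q + 1) i) = 0 := by
    intro i
    have := (P.genG (q + 1) hq).mem i
    rw [P.ZG_succ q (by lia), mem_syzFamily] at this
    exact this.2
  have h' : ∀ i, ∑ j, P.D (q + 1) i j * P.D q j x.2 = 0 := by
    intro i
    have := congrFun (h i) x.2
    rwa [Fintype.linearCombination_apply, Finset.sum_apply] at this
  simp only [dG_apply, Finset.sum_mul]
  rw [Finset.sum_comm]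
  refine Finset.sum_eq_zero fun i _ => ?_
  simp only [mul_assoc, ← Finset.mul_sum]
  rw [h', mul_zero]

/-- The cycles of the total complex of `F ⊗ G` (truncated at `F_p`). -/
def IsCycle : ∀ q p (_ : Γ), (P.idx q p → R) → Prop
  | 0, 0, γ, z => ∀ x, z x ∈ posFamily 𝓡 w γ
  | 0, p + 1, γ, z => ∀ x, P.dF 0 p (P.hd 0 (p + 1) z) x ∈ posFamily 𝓡 l (γ - P.fdeg p x.1)
  | q + 1, p, _, z => P.tot q p z = 0

/-- `w` bounds the part of `z` outside `F_p ⊗ G_q`. -/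
def Bounds : ∀ q p, (P.idx q p → R) → (P.idx q (p + 1) → R) → Prop
  | 0, _, _, _ => True
  | q + 1, p, z, y => P.tl q p z = P.tot q (p + 1) y

/-- Every cycle `z` can be changed by a boundary so that its `F_p ⊗ G_q` part lies in
`F_p ⊗ ZG_q`. -/
def Splits (q p : ℕ) : Prop :=
  ∀ γ, ∀ z ∈ freeFamily 𝓡 (tdeg P.fdeg P.gdeg q p) γ, P.IsCycle q p γ z →
    ∃ y ∈ freeFamily 𝓡 (tdeg P.fdeg P.gdeg q (p + 1)) γ, P.Bounds q p z y ∧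
      ∀ i, (fun k => (P.hd q p z + P.dF q p (P.hd q (p + 1) y)) (i, k)) ∈
        P.ZG q (γ - P.fdeg p i)

/-- For `q = 0` a cycle is an element of the maximal ideal in every coordinate if `p = 0`, and a
cycle of `F` modulo the ideal `(l > 0)` otherwise. The basis of `F_p` has `l`-degree zero, so all
entries of `z` have `l`-degree `l γ`. If this is negative, `z` vanishes; if it is zero, `z` lives
over the retract, where `F` is exact; if it is positive, every entry lies in `ZG_0` already. -/
theorem splits_zero (hl : ∀ γ, 𝓡 γ ≠ ⊥ → 0 ≤ l γ) (p : ℕ) : P.Splits 0 p := by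
  intro γ z hz hc
  have hz' : ∀ i k, z (i, k) ∈ 𝓡 (γ - P.fdeg p i) := by
    intro i k
    have := mem_freeFamily.1 hz (i, k)
    simpa [tdeg, xdeg, P.gdeg_zero] using this
  have hlγ : ∀ i, l (γ - P.fdeg p i) = l γ := fun i => by rw [map_sub, P.apply_fdeg, sub_zero]
  rcases lt_trichotomy (l γ) 0 with h | h | h
  · have h0 : z = 0 := by
      funext x
      by_contra hx
      have := hl (γ - P.fdeg p x.1) fun hb => hx (by
        have := hz' x.1 x.2
        rwa [hb, Submodule.mem_bot] at this)
      rw [hlγ] at this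
      lia
    refine ⟨0, Submodule.zero_mem _, trivial, fun i => ?_⟩
    rw [h0]
    simp only [map_zero, add_zero]
    exact Submodule.zero_mem _
  · have hzF : ∀ k, (fun i => z (i, k)) ∈ P.ZF p γ := by
      intro k
      cases p with
      | zero =>
        rw [P.mem_ZF_zero]
        intro i
        have := hc (i, k)
        by_cases hw : 0 < w γ
        · rw [posFamily_of_pos hw] at this ⊢
          rwa [zeroPart_of_eq h]
        · rw [posFamily_of_not_pos hw] at this ⊢
          exact this
      | succ p =>
        rw [P.ZF_succ, mem_syzFamily]
        constructor
        · intro i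
          rw [zeroPart_of_eq (by rw [hlγ, h])]
          exact hz' i k
        · funext j
          have := hc (j, k)
          rw [posFamily_of_not_pos (by rw [map_sub, P.apply_fdeg, h]; simp), Submodule.mem_bot]
            at this
          exact this
    choose a ha ha' using fun k => (P.genF p).exists_eq (hzF k)
    refine ⟨fun x => -a x.2 x.1, mem_freeFamily.2 fun x => ?_, trivial, fun i => ?_⟩
    · have := zeroPart_le _ (mem_freeFamily.1 (ha x.2) x.1)
      simp only [tdeg, xdeg, P.gdeg_zero, add_zero]
      exact Submodule.neg_mem _ this
    · suffices h0 : ∀ k, (P.hd 0 p z + P.dF 0 p (P.hd 0 (p + 1) fun x => -a x.2 x.1)) (i, k) = 0 by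
        simp only [h0]
        exact Submodule.zero_mem _
      intro k
      have h1 := congrFun (ha' k) i
      rw [Fintype.linearCombination_apply, Finset.sum_apply] at h1
      have h2 : P.dF 0 p (P.hd 0 (p + 1) fun x => -a x.2 x.1) (i, k) = -z (i, k) := by
        rw [dF_apply, ← h1, ← Finset.sum_neg_distrib]
        exact Finset.sum_congr rfl fun j _ => neg_mul _ _
      rw [Pi.add_apply, h2]
      exact add_neg_cancel _
  · refine ⟨0, Submodule.zero_mem _, trivial, fun i => ?_⟩
    rw [P.mem_ZG_zero]
    intro k
    rw [posFamily_of_pos (by rw [hlγ]; exact h)]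
    simp only [map_zero, add_zero]
    exact hz' i k

/-- Once a boundary has moved the leading part of the cycle into `F_p ⊗ ZG_q`, that part is in the
image of `D`, since `D` generates `ZG_q`. -/
theorem exists_tot_eq {q p : ℕ} (hq : q < n) (hs : P.Splits q p) {γ : Γ} {z}
    (hz : z ∈ freeFamily 𝓡 (tdeg P.fdeg P.gdeg q p) γ) (hc : P.IsCycle q p γ z) :
    ∃ y ∈ freeFamily 𝓡 (tdeg P.fdeg P.gdeg (q + 1) p) γ, P.tot q p y = z := by
  obtain ⟨y, hy, hyz, h⟩ := hs γ z hz hc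
  choose a ha ha' using fun i => (P.genG q hq).exists_eq (h i)
  refine ⟨P.pair (fun x => a x.1 x.2) (-y), pair_mem (mem_freeFamily.2 fun x => ?_)
    (Submodule.neg_mem _ hy), ?_⟩
  · have := mem_freeFamily.1 (ha x.1) x.2
    rwa [sub_sub] at this
  · have hhd : P.hd q p (P.tot q p (P.pair (fun x => a x.1 x.2) (-y))) = P.hd q p z := by
      rw [hd_tot, hd_pair, tl_pair, map_neg, map_neg]
      have : P.dG q p (fun x => a x.1 x.2) = P.hd q p z + P.dF q p (P.hd q (p + 1) y) := by
        funext x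
        exact congrFun (ha' x.1) x.2
      rw [this]
      abel
    cases q with
    | zero => exact hhd
    | succ q =>
      refine ext_hd_tl hhd ?_
      rw [tl_tot, tl_pair, map_neg, neg_neg]
      exact hyz.symm

/-- Induction on `q`. The part of `z` beyond `F_p` is a cycle of the complex truncated at `F_{p+1}`,
hence a boundary by `exists_tot_eq`. After this correction the leading part is killed by `dG`,
because `z` is a cycle. -/
theorem splits (hl : ∀ γ, 𝓡 γ ≠ ⊥ → 0 ≤ l γ) : ∀ {q : ℕ} (_ : q ≤ n) (p : ℕ), P.Splits q p
  | 0, _, p => P.splits_zero hl p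
  | q + 1, hq, p => by
    intro γ z hz hc
    have hc' : P.IsCycle q (p + 1) γ (P.tl q p z) := by
      cases q with
      | zero =>
        intro x
        have h1 : P.dG 0 p (P.hd 1 p z) + P.dF 0 p (P.hd 0 (p + 1) (P.tl 0 p z)) = 0 := by
          have := hd_tot z
          rw [show P.tot 0 p z = 0 from hc, map_zero] at this
          exact this.symm
        rw [eq_neg_of_add_eq_zero_right h1]
        refine Submodule.neg_mem _ ?_
        have h2 : (fun l => P.hd 1 p z (x.1, l)) ∈
            freeFamily 𝓡 (P.gdeg 1) (γ - P.fdeg p x.1) := by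
          refine mem_freeFamily.2 fun l => ?_
          rw [sub_sub]
          exact mem_freeFamily.1 (hd_mem hz) (x.1, l)
        have h3 := (P.isGradedFamily_ZG hl 0 (Nat.zero_le _)).linearCombination_mem
          (P.genG 0 hq).mem h2
        rw [P.mem_ZG_zero] at h3
        exact h3 x.2
      | succ q =>
        have h1 := tl_tot z
        rw [show P.tot (q + 1) p z = 0 from hc, map_zero] at h1
        exact (neg_eq_zero.1 h1.symm)
    obtain ⟨y, hy, hyz⟩ := P.exists_tot_eq hq (splits hl (by lia) (p + 1)) (tl_mem hz) hc'
    refine ⟨y, hy, hyz.symm, ?_⟩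
    rw [← P.dG_eq_zero_iff hq (Submodule.add_mem _ (hd_mem hz) (dF_mem (P.bd_mem p) (hd_mem hy))),
      map_add, dG_dF]
    have h1 := hd_tot y
    have h2 := hd_tot z
    rw [show P.tot q p z = 0 from hc, map_zero] at h2
    rw [hyz] at h1
    rw [h1, map_add, P.dF_dF, add_zero] at h2
    exact h2.symm

/-- The graded modules of cycles of the total complex of `F ⊗ G`. -/
noncomputable def cycles : ∀ q, Γ → Submodule K (P.idx q 0 → R)
  | 0 => fun γ => Submodule.pi (R := K) Set.univ fun _ => posFamily 𝓡 w γ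
  | q + 1 => kerFamily (freeFamily 𝓡 (tdeg P.fdeg P.gdeg (q + 1) 0)) (P.tot q 0)

theorem mem_cycles {q : ℕ} {γ : Γ} {z : P.idx q 0 → R} : z ∈ P.cycles q γ ↔
    z ∈ freeFamily 𝓡 (tdeg P.fdeg P.gdeg q 0) γ ∧ P.IsCycle q 0 γ z := by
  cases q with
  | zero =>
    constructor
    · intro h
      refine ⟨mem_freeFamily.2 fun x => ?_, fun x => h x trivial⟩
      simp only [tdeg, xdeg, P.gdeg_zero, P.fdeg_zero, add_zero, sub_zero]
      exact posFamily_le _ _ (h x trivial)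
    · exact fun h x _ => h.2 x
  | succ q => exact mem_kerFamily

theorem isGradedFamily_cycles (hw : ∀ γ, 𝓡 γ ≠ ⊥ → 0 ≤ w γ) :
    ∀ q, IsGradedFamily 𝓡 (P.cycles q)
  | 0 => fun _ _ _ _ ha hx i _ => isGradedFamily_posFamily hw ha (hx i trivial)
  | _ + 1 => (isGradedFamily_freeFamily _).kerFamily _

theorem weight_tdeg_le : ∀ {q p : ℕ} (_ : q ≤ n) (x : P.idx q p),
    w (tdeg P.fdeg P.gdeg q p x) ≤ q + p := by
  have key : ∀ {q p : ℕ} (_ : q ≤ n) x, w (xdeg P.fdeg P.gdeg q p x) ≤ q + p := by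
    intro q p hq x
    rw [xdeg, map_add]
    linarith [P.weight_fdeg_le p x.1, P.weight_gdeg_le q hq x.2]
  intro q
  induction q with
  | zero => intro p hq x; exact key hq x
  | succ q ih =>
    rintro p hq (x | x)
    · exact key hq x
    · have := ih (by lia) x
      push_cast at this ⊢
      simp only [tdeg, Sum.elim_inr]
      linarith

/-- One step of the resolution of copies of `K` by the total complex. The generation is the
exactness at `p = 0`. For `q = 0` the boundaries lie in the maximal ideal because it contains `(l >
0)`. -/
theorem generates_cycles (hw : ∀ γ, 𝓡 γ ≠ ⊥ → 0 ≤ w γ) (hl : ∀ γ, 𝓡 γ ≠ ⊥ → 0 ≤ l γ)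
    (hlw : ∀ γ, 𝓡 γ ≠ ⊥ → 0 < l γ → 0 < w γ) [∀ q p, DecidableEq (P.idx q p)] {q : ℕ}
    (hq : q < n) :
    Generates 𝓡 (P.cycles q) (tdeg P.fdeg P.gdeg (q + 1) 0)
      (fun x => P.tot q 0 (Pi.single x 1)) := by
  have hlin : ∀ a, Fintype.linearCombination R (fun x => P.tot q 0 (Pi.single x (1 : R))) a =
      P.tot q 0 a := by
    intro a
    conv_rhs => rw [← Finset.univ_sum_single a, map_sum]
    rw [Fintype.linearCombination_apply]
    refine Finset.sum_congr rfl fun i _ => ?_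
    rw [← map_smul, ← Pi.single_smul, smul_eq_mul, mul_one]
  constructor
  · intro x
    have hx : (Pi.single x 1 : P.idx (q + 1) 0 → R) ∈
        freeFamily 𝓡 (tdeg P.fdeg P.gdeg (q + 1) 0) (tdeg P.fdeg P.gdeg (q + 1) 0 x) := by
      refine mem_freeFamily.2 fun y => ?_
      rcases eq_or_ne y x with rfl | hy
      · rw [Pi.single_eq_same, sub_self]
        exact SetLike.one_mem_graded 𝓡
      · rw [Pi.single_eq_of_ne hy]
        exact Submodule.zero_mem _
    generalize tdeg P.fdeg P.gdeg (q + 1) 0 x = γ at hx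
    refine P.mem_cycles.2 ⟨tot_mem P.bd_mem P.D_mem hq hx, ?_⟩
    generalize (Pi.single x 1 : P.idx (q + 1) 0 → R) = z at hx
    cases q with
    | succ q => exact tot_tot P.dF_dF (fun q p z hq => P.dG_dG hq z) hq z
    | zero =>
      intro (y : Fin (P.f 0) × Fin (P.g 0))
      have h1 : P.tot 0 0 z = P.dG 0 0 (P.hd 1 0 z) + P.dF 0 0 (P.hd 0 1 (P.tl 0 0 z)) := hd_tot z
      rw [h1]
      refine Submodule.add_mem _ ?_ ?_
      · have h2 : (fun l => P.hd 1 0 z (y.1, l)) ∈ freeFamily 𝓡 (P.gdeg 1) γ := by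
          refine mem_freeFamily.2 fun l => ?_
          have := mem_freeFamily.1 (hd_mem hx) (y.1, l)
          rwa [xdeg, P.fdeg_zero, zero_add] at this
        have h3 := (P.isGradedFamily_ZG hl 0 (Nat.zero_le _)).linearCombination_mem
          (P.genG 0 hq).mem h2
        rw [P.mem_ZG_zero] at h3
        have h4 := h3 y.2
        change P.dG 0 0 (P.hd 1 0 z) y ∈ _ at h4
        by_cases hlγ : 0 < l γ
        · rw [posFamily_of_pos hlγ] at h4
          by_cases hb : 𝓡 γ = ⊥
          · rw [hb, Submodule.mem_bot] at h4
            rw [h4]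
            exact Submodule.zero_mem _
          · rwa [posFamily_of_pos (hlw γ hb hlγ)]
        · rw [posFamily_of_not_pos hlγ, Submodule.mem_bot] at h4
          rw [h4]
          exact Submodule.zero_mem _
      · rw [dF_apply]
        refine Submodule.sum_mem _ fun i _ => ?_
        have h2 := (P.genF 0).mem i
        rw [P.mem_ZF_zero] at h2
        have h3 : P.bd 0 i y.1 ∈ posFamily 𝓡 w (P.fdeg 1 i) := by
          have := h2 y.1
          unfold posFamily at this ⊢
          split_ifs at this ⊢
          · exact zeroPart_le _ this
          · exact this
        have h4 := mem_freeFamily.1 (hd_mem (tl_mem hx)) (i, y.2)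
        have h5 := isGradedFamily_posFamily hw h4 h3
        rw [xdeg, P.gdeg_zero, add_zero] at h5
        have h6 : γ - P.fdeg 1 i + P.fdeg 1 i = γ := sub_add_cancel _ _
        rw [← h6]
        exact h5
  · intro γ z hz
    rw [mem_cycles] at hz
    simp only [hlin]
    exact P.exists_tot_eq hq (P.splits hl hq.le 0) hz.1 hz.2

/-- The total complex need not be minimal, but its basis in total degree `q + 1` has weight at most
`q + 1`. So `Reg.syzFamily` carries the bound along, starting from copies of the maximal ideal. -/
theorem regInf_cycles (hw : ∀ γ, 𝓡 γ ≠ ⊥ → 0 ≤ w γ) (hl : ∀ γ, 𝓡 γ ≠ ⊥ → 0 ≤ l γ)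
    (hlw : ∀ γ, 𝓡 γ ≠ ⊥ → 0 < l γ → 0 < w γ) (h : RegInf 𝓡 w 1 (posFamily 𝓡 w)) {q : ℕ}
    (hq : q ≤ n) : RegInf 𝓡 w (q + 1) (P.cycles q) := by
  classical
  induction q with
  | zero =>
    intro p
    have := reg_pi_of_fintype (ι := P.idx 0 0) (fun _ => isGradedFamily_posFamily hw) fun _ => h p
    simpa [cycles] using this
  | succ q ih =>
    have hgen := P.generates_cycles hw hl hlw hq
    have h1 := (ih (by lia)).syzFamily (P.isGradedFamily_cycles hw q) hgen fun x => by
      have := P.weight_tdeg_le hq x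
      push_cast at this
      linarith
    push_cast
    convert h1 using 1
    funext γ
    ext a
    have hlin : Fintype.linearCombination R (fun x => P.tot q 0 (Pi.single x (1 : R))) a =
        P.tot q 0 a := by
      conv_rhs => rw [← Finset.univ_sum_single a, map_sum]
      rw [Fintype.linearCombination_apply]
      refine Finset.sum_congr rfl fun i _ => ?_
      rw [← map_smul, ← Pi.single_smul, smul_eq_mul, mul_one]
    rw [mem_syzFamily, hlin, ← mem_freeFamily, mem_cycles]
    rfl

/-- The next syzygy in the resolution `G` is generated by elements of bounded weight. -/
theorem exists_generates_ZG (hw : ∀ γ, 𝓡 γ ≠ ⊥ → 0 ≤ w γ) (hl : ∀ γ, 𝓡 γ ≠ ⊥ → 0 ≤ l γ)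
    (hlw : ∀ γ, 𝓡 γ ≠ ⊥ → 0 < l γ → 0 < w γ) (h : RegInf 𝓡 w 1 (posFamily 𝓡 w)) :
    ∃ (N : ℕ) (deg : Fin N → Γ) (m : Fin N → Fin (P.g n) → R), (∀ i, w (deg i) ≤ n + 1) ∧
      Generates 𝓡 (P.ZG n) deg m := by
  obtain ⟨N, deg, b, hdeg, -, hb⟩ := (P.regInf_cycles hw hl hlw h le_rfl).exists_generates
  -- Each generator `b α` of the cycles is corrected so that its `F_0 ⊗ G_n` part has all rows in
  -- `ZG_n`. The row at `base` is the proposed generator `c α`.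
  choose y hy hyb hc using fun α => P.splits hl le_rfl 0 _ (b α) (P.mem_cycles.1 (hb.mem α)).1
    (P.mem_cycles.1 (hb.mem α)).2
  let c : Fin N → Fin (P.g n) → R := fun α k =>
    (P.hd n 0 (b α) + P.dF n 0 (P.hd n 1 (y α))) (P.base, k)
  have hc0 : ∀ α, c α ∈ P.ZG n (deg α) := by
    intro α
    have := hc α P.base
    rwa [P.fdeg_zero, sub_zero] at this
  refine ⟨N, deg, c, hdeg, hc0, ?_⟩
  -- A graded Nakayama argument by induction on the weight: the error terms below have coefficients
  -- of positive weight. The induction starts because `ZG_n` vanishes in negative weights.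
  suffices H : ∀ (d : ℕ) (γ : Γ), w γ < d → ∀ x ∈ P.ZG n γ,
      ∃ a ∈ freeFamily 𝓡 deg γ, Fintype.linearCombination R c a = x by
    intro γ x hx
    exact H ((w γ).toNat + 1) γ (by have := Int.self_le_toNat (w γ); push_cast; lia) x hx
  intro d
  induction d with
  | zero =>
    intro γ hγ x hx
    refine ⟨0, Submodule.zero_mem _, ?_⟩
    rw [map_zero]
    funext k
    by_contra hk
    have h1 := mem_freeFamily.1 (P.ZG_le n le_rfl γ hx) k
    have h2 := hw _ fun hbot => hk (by rw [hbot, Submodule.mem_bot] at h1; exact h1.symm)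
    have h3 := P.weight_gdeg_nonneg n le_rfl k
    rw [map_sub] at h2
    push_cast at hγ
    linarith
  | succ d ih =>
    intro γ hγ ζ hζ
    -- the cycle with the given component in every summand of `F_0 ⊗ G_n`
    obtain ⟨z, hz, hzhd, hzc, hztl⟩ : ∃ z ∈ freeFamily 𝓡 (tdeg P.fdeg P.gdeg n 0) γ,
        (P.hd n 0 z = fun x => ζ x.2) ∧ P.IsCycle n 0 γ z ∧ P.Bounds n 0 z 0 := by
      have hfree : (fun x : Fin (P.f 0) × Fin (P.g n) => ζ x.2) ∈
          freeFamily 𝓡 (xdeg P.fdeg P.gdeg n 0) γ := by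
        refine mem_freeFamily.2 fun x => ?_
        rw [xdeg, P.fdeg_zero, zero_add]
        exact mem_freeFamily.1 (P.ZG_le n le_rfl γ hζ) x.2
      rcases n with _ | n
      · refine ⟨fun x => ζ x.2, hfree, rfl, fun x => ?_, trivial⟩
        rw [P.mem_ZG_zero] at hζ
        have h4 := hζ x.2
        change ζ x.2 ∈ _
        by_cases hlγ : 0 < l γ
        · rw [posFamily_of_pos hlγ] at h4
          by_cases hbot : 𝓡 γ = ⊥
          · rw [hbot, Submodule.mem_bot] at h4
            rw [h4]
            exact Submodule.zero_mem _
          · rwa [posFamily_of_pos (hlw γ hbot hlγ)]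
        · rw [posFamily_of_not_pos hlγ, Submodule.mem_bot] at h4
          rw [h4]
          exact Submodule.zero_mem _
      · refine ⟨P.pair (fun x => ζ x.2) 0, pair_mem hfree (Submodule.zero_mem _), rfl, ?_, ?_⟩
        · have h1 : P.dG n 0 (fun x => ζ x.2) = 0 := by
            rw [P.dG_eq_zero_iff (Nat.lt_succ_self n) hfree]
            intro i
            rwa [P.fdeg_zero, sub_zero]
          have h2 : P.hd n 0 (P.tot n 0 (P.pair (fun x => ζ x.2) 0)) = 0 := by
            rw [hd_tot, hd_pair, tl_pair, h1]
            simp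
          change P.tot n 0 _ = 0
          cases n with
          | zero => exact h2
          | succ n =>
            refine ext_hd_tl (h2.trans (map_zero _).symm) ?_
            rw [tl_tot, tl_pair]
            simp
        · change P.tl n 0 _ = _
          rw [tl_pair, map_zero]
    obtain ⟨r, hr, hrz⟩ := hb.exists_eq (P.mem_cycles.2 ⟨hz, hzc⟩)
    have hW : Fintype.linearCombination R y r ∈ freeFamily 𝓡 (tdeg P.fdeg P.gdeg n 1) γ :=
      (isGradedFamily_freeFamily _).linearCombination_mem hy hr
    have hζr : ∀ i k, ζ k = ∑ α, r α * P.hd n 0 (b α) (i, k) := by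
      intro i k
      have h1 := congrFun hzhd (i, k)
      rw [← hrz, Fintype.linearCombination_apply, map_sum, Finset.sum_apply] at h1
      simp only [map_smul, Pi.smul_apply, smul_eq_mul] at h1
      exact h1.symm
    -- The corrections combine to a cycle. For positive `n` this holds because `z` has no part
    -- beyond `F_0 ⊗ G_n`; for `n = 0` the image under `dF` is a difference of elements of `(l >
    -- 0)`.
    have hWc : P.IsCycle n 1 γ (Fintype.linearCombination R y r) := by
      rcases n with _ | n
      · intro x
        have h1 : P.dF 0 0 (P.hd 0 1 (Fintype.linearCombination R y r)) x =
            Fintype.linearCombination R (fun α k =>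
              (P.hd 0 0 (b α) + P.dF 0 0 (P.hd 0 1 (y α))) (x.1, k)) r x.2 - ζ x.2 := by
          rw [hζr x.1 x.2, Fintype.linearCombination_apply, Fintype.linearCombination_apply, map_sum,
            map_sum, Finset.sum_apply, Finset.sum_apply, ← Finset.sum_sub_distrib]
          refine Finset.sum_congr rfl fun α _ => ?_
          simp only [map_smul, Pi.smul_apply, smul_eq_mul, Pi.add_apply]
          ring
        rw [P.fdeg_zero, sub_zero]
        change P.dF 0 0 (P.hd 0 1 (Fintype.linearCombination R y r)) x ∈ _
        rw [h1]
        rw [P.mem_ZG_zero] at hζ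
        refine Submodule.sub_mem _ ?_ (hζ x.2)
        have h2 := (P.isGradedFamily_ZG hl 0 le_rfl).linearCombination_mem
          (deg := deg) (m := fun α k => (P.hd 0 0 (b α) + P.dF 0 0 (P.hd 0 1 (y α))) (x.1, k))
          (fun α => by
            have := hc α x.1
            rwa [P.fdeg_zero, sub_zero] at this) hr
        rw [P.mem_ZG_zero] at h2
        exact h2 x.2
      · change P.tot n 1 _ = 0
        have h1 : P.tl n 0 z = 0 := by
          have : P.tl n 0 z = P.tot n 1 0 := hztl
          rw [this, map_zero]
        rw [← hrz, Fintype.linearCombination_apply, map_sum] at h1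
        rw [Fintype.linearCombination_apply, map_sum, ← h1]
        refine Finset.sum_congr rfl fun α _ => ?_
        rw [map_smul, map_smul]
        congr 1
        exact (hyb α).symm
    -- A further correction moves the `F_1 ⊗ G_n` part into `F_1 ⊗ ZG_n` and does not alter its
    -- image under `dF`. The rows now lie in degrees `γ - fdeg 1 i` of smaller weight, where the
    -- induction hypothesis applies.
    obtain ⟨y', hy', -, hW'⟩ := P.splits hl le_rfl 1 γ _ hW hWc
    choose a ha ha' using fun i => ih (γ - P.fdeg 1 i)
      (by rw [map_sub]; have := P.weight_fdeg_one i; push_cast at hγ; linarith) _ (hW' i)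
    -- In the row at `base`, the combination of the `c α` with coefficients `r` is `ζ` plus the
    -- error `dF`; the subtracted sum expresses this error through the `c α`.
    refine ⟨fun α => r α - ∑ i, P.bd 0 i P.base * a i α, mem_freeFamily.2 fun α => ?_, ?_⟩
    · refine Submodule.sub_mem _ (mem_freeFamily.1 hr α) (Submodule.sum_mem _ fun i _ => ?_)
      have h1 := SetLike.mul_mem_graded (mem_freeFamily.1 (P.bd_mem 0 i) P.base)
        (mem_freeFamily.1 (ha i) α)
      convert h1 using 2
      rw [P.fdeg_zero]
      abel
    · funext k
      have h1 : P.dF n 0 (P.hd n 1 (Fintype.linearCombination R y r)) (P.base, k) =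
          ∑ i, Fintype.linearCombination R c (a i) k * P.bd 0 i P.base := by
        have h2 : P.dF n 0 (P.hd n 1 (Fintype.linearCombination R y r)) =
            P.dF n 0 (P.hd n 1 (Fintype.linearCombination R y r) + P.dF n 1 (P.hd n 2 y')) := by
          rw [map_add, P.dF_dF, add_zero]
        rw [h2, dF_apply]
        refine Finset.sum_congr rfl fun i _ => ?_
        rw [ha' i]
      have h3 : P.dF n 0 (P.hd n 1 (Fintype.linearCombination R y r)) (P.base, k) =
          Fintype.linearCombination R c r k - ζ k := by
        rw [hζr P.base k, Fintype.linearCombination_apply, Fintype.linearCombination_apply, map_sum,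
          map_sum, Finset.sum_apply, Finset.sum_apply, ← Finset.sum_sub_distrib]
        refine Finset.sum_congr rfl fun α _ => ?_
        simp only [map_smul, Pi.smul_apply, smul_eq_mul, c, Pi.add_apply]
        ring
      have h4 : Fintype.linearCombination R c
          (fun α => r α - ∑ i, P.bd 0 i P.base * a i α) k =
          Fintype.linearCombination R c r k -
            ∑ i, Fintype.linearCombination R c (a i) k * P.bd 0 i P.base := by
        simp only [Fintype.linearCombination_apply, Finset.sum_apply, Pi.smul_apply, smul_eq_mul,
          sub_mul, Finset.sum_sub_distrib, Finset.sum_mul]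
        congr 1
        rw [Finset.sum_comm]
        exact Finset.sum_congr rfl fun i _ => Finset.sum_congr rfl fun α _ => by ring
      rw [h4, ← h1, h3]
      ring

end ResolutionPair

end Retract

/-! ### Linear resolutions of algebra retracts -/

section Retract

variable {K : Type u} {R : Type v} [Field K] [CommRing R] [Algebra K R] {Γ : Type}
  [AddCommGroup Γ]

theorem zeroPart_posFamily {𝓡 : Γ → Submodule K R} {w l : Γ → ℤ} :
    zeroPart (posFamily 𝓡 w) l = posFamily (zeroPart 𝓡 l) w := by
  funext γ
  by_cases h : l γ = 0 <;> by_cases h' : 0 < w γ <;> simp [zeroPart, posFamily, h, h']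

theorem exists_apply_mem_ne_zero {𝓡 : Γ → Submodule K R} {n : ℕ} {deg : Fin n → Γ} {γ : Γ}
    {a : Fin n → R} (ha : a ∈ freeFamily 𝓡 deg γ) (h0 : a ≠ 0) : ∃ i, 𝓡 (γ - deg i) ≠ ⊥ := by
  obtain ⟨i, hi⟩ := Function.ne_iff.1 h0
  refine ⟨i, fun hb => hi ?_⟩
  have := mem_freeFamily.1 ha i
  rwa [hb, Submodule.mem_bot] at this

/-- Restricting a resolution to the part where `l` vanishes. -/
theorem reg_zeroPart {𝓡 : Γ → Submodule K R} [SetLike.GradedMonoid 𝓡] {w l : Γ →+ ℤ}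
    (hl : ∀ γ, 𝓡 γ ≠ ⊥ → 0 ≤ l γ) {p : ℕ} : ∀ {t : ℤ} {X : Type v} [AddCommGroup X] [Module K X]
    [Module R X] [IsScalarTower K R X] {ℳ : Γ → Submodule K X} (_ : IsGradedFamily 𝓡 ℳ)
    (_ : ∀ γ, ℳ γ ≠ ⊥ → 0 ≤ l γ), RegInf 𝓡 w t ℳ →
    Reg (zeroPart 𝓡 l) w p t (zeroPart ℳ l) := by
  classical
  induction p with
  | zero => intros; trivial
  | succ p ih =>
    intro t X _ _ _ _ ℳ hℳ hsupp h
    obtain ⟨n, deg, m, h1, h2, h3⟩ := h.exists_generates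
    have hdeg : ∀ i, 0 ≤ l (deg i) := fun i => hsupp _ fun hb => h2 i (by
      have := h3.mem i
      rwa [hb, Submodule.mem_bot] at this)
    have h4 := h.syzFamily hℳ h3 fun i => (h1 i).trans (by lia)
    -- Since `l` is nonnegative on the degrees of `R` and of the generators, generators of positive
    -- `l`-degree cannot contribute where `l` vanishes. Dropping them leaves a resolution over the
    -- zero part.
    have hz : ∀ {γ a}, l γ = 0 → a ∈ freeFamily 𝓡 deg γ → ∀ i, l (deg i) ≠ 0 → a i = 0 := by
      intro γ a hγ ha i hi
      by_contra h0
      have := hl (γ - deg i) fun hb => h0 (by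
        have := mem_freeFamily.1 ha i
        rwa [hb, Submodule.mem_bot] at this)
      rw [map_sub, hγ] at this
      have := hdeg i
      lia
    have hlin : ∀ {γ} {a : Fin n → R}, l γ = 0 → a ∈ freeFamily 𝓡 deg γ →
        Fintype.linearCombination R (fun i : {i // l (deg i) = 0} => m i) (fun i => a i) =
          Fintype.linearCombination R m a := by
      intro γ a hγ ha
      rw [Fintype.linearCombination_apply, Fintype.linearCombination_apply,
        ← Finset.sum_subtype (Finset.univ.filter fun i => l (deg i) = 0) (by simp)
          (fun i => a i • m i)]
      rw [Finset.sum_filter_of_ne]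
      intro i _ hi
      by_contra h0
      exact hi (by rw [hz hγ ha i h0, zero_smul])
    refine ⟨{i // l (deg i) = 0}, inferInstance, fun i => deg i, fun i => m i, fun i => h1 _,
      ⟨fun i => ?_, ?_⟩, ?_⟩
    · rw [zeroPart_of_eq i.2]
      exact h3.mem _
    · intro γ x hx
      by_cases hγ : l γ = 0
      · rw [zeroPart_of_eq hγ] at hx
        obtain ⟨a, ha, rfl⟩ := h3.exists_eq hx
        refine ⟨fun i => a i, mem_freeFamily.2 fun i => ?_, hlin hγ ha⟩
        rw [zeroPart_of_eq (by rw [map_sub, hγ, i.2, sub_zero])]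
        exact mem_freeFamily.1 ha i
      · rw [zeroPart_of_ne hγ, Submodule.mem_bot] at hx
        exact ⟨0, Submodule.zero_mem _, by rw [map_zero, hx]⟩
    · have hs : ∀ γ, syzFamily 𝓡 deg m γ ≠ ⊥ → 0 ≤ l γ := by
        intro γ hγ
        obtain ⟨a, ha, ha0⟩ := Submodule.exists_mem_ne_zero_of_ne_bot hγ
        obtain ⟨i, hi⟩ := exists_apply_mem_ne_zero (mem_freeFamily.2 (mem_syzFamily.1 ha).1) ha0
        have := hl _ hi
        rw [map_sub] at this
        have := hdeg i
        lia
      have h5 := ih (isGradedFamily_syzFamily _ _) hs h4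
      have hon : MapsOnto (LinearMap.funLeft R R (Subtype.val : {i // l (deg i) = 0} → Fin n))
          (zeroPart (syzFamily 𝓡 deg m) l)
          (syzFamily (zeroPart 𝓡 l) (fun i : {i // l (deg i) = 0} => deg i) fun i => m i) := by
        constructor
        · intro γ a ha
          by_cases hγ : l γ = 0
          · rw [zeroPart_of_eq hγ, mem_syzFamily] at ha
            refine mem_syzFamily.2 ⟨fun i => ?_,
              (hlin hγ (mem_freeFamily.2 ha.1)).trans ha.2⟩
            rw [zeroPart_of_eq (by rw [map_sub, hγ, i.2, sub_zero])]
            exact ha.1 i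
          · rw [zeroPart_of_ne hγ, Submodule.mem_bot] at ha
            rw [ha, map_zero]
            exact Submodule.zero_mem _
        · intro γ a ha
          rw [mem_syzFamily] at ha
          by_cases hγ : l γ = 0
          · have hb : (fun i => if h : l (deg i) = 0 then a ⟨i, h⟩ else 0) ∈
                freeFamily 𝓡 deg γ := by
              refine mem_freeFamily.2 fun i => ?_
              split_ifs with h
              · exact zeroPart_le _ (ha.1 ⟨i, h⟩)
              · exact Submodule.zero_mem _
            have hba : (fun i : {i // l (deg i) = 0} =>
                (fun i => if h : l (deg i) = 0 then a ⟨i, h⟩ else 0) (i : Fin n)) = a := by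
              funext i
              exact dif_pos i.2
            refine ⟨fun i => if h : l (deg i) = 0 then a ⟨i, h⟩ else 0, ?_, hba⟩
            rw [zeroPart_of_eq hγ, mem_syzFamily]
            refine ⟨mem_freeFamily.1 hb, ?_⟩
            rw [← hlin hγ hb, hba, ha.2]
          · refine ⟨0, Submodule.zero_mem _, ?_⟩
            rw [map_zero]
            funext i
            have := ha.1 i
            rw [zeroPart_of_ne (by rwa [map_sub, i.2, sub_zero]), Submodule.mem_bot] at this
            exact this.symm
      refine (hon.reg_iff ?_ ?_).1 h5
      · intro γ δ a x ha hx
        by_cases hγ : l γ = 0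
        · by_cases hδ : l δ = 0
          · rw [zeroPart_of_eq hγ] at ha
            rw [zeroPart_of_eq hδ] at hx
            rw [zeroPart_of_eq (by rw [map_add, hγ, hδ, add_zero])]
            exact isGradedFamily_syzFamily _ _ ha hx
          · rw [zeroPart_of_ne hδ, Submodule.mem_bot] at hx
            rw [hx, smul_zero]
            exact Submodule.zero_mem _
        · rw [zeroPart_of_ne hγ, Submodule.mem_bot] at ha
          rw [ha, zero_smul]
          exact Submodule.zero_mem _
      · intro γ a ha ha0
        by_cases hγ : l γ = 0
        · rw [zeroPart_of_eq hγ, mem_syzFamily] at ha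
          funext i
          by_cases hi : l (deg i) = 0
          · exact congrFun ha0 ⟨i, hi⟩
          · exact hz hγ (mem_freeFamily.2 ha.1) i hi
        · rwa [zeroPart_of_ne hγ, Submodule.mem_bot] at ha

/-- A graded free module together with a graded submodule. -/
structure Stage (K : Type u) (R : Type v) [Field K] [CommRing R] [Algebra K R] (Γ : Type) where
  n : ℕ
  deg : Fin n → Γ
  Z : Γ → Submodule K (Fin n → R)

/-- `m` gives nonzero generators of the submodule of the stage `S`, of weight at most `t`, and `S'`
consists of the corresponding free module and the relations between these generators. -/
structure IsNextVia (𝒜 : Γ → Submodule K R) (w : Γ →+ ℤ) (t : ℤ) (S S' : Stage K R Γ)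
    (m : Fin S'.n → Fin S.n → R) : Prop where
  weight_le : ∀ i, w (S'.deg i) ≤ t
  ne_zero : ∀ i, m i ≠ 0
  generates : Generates 𝒜 S.Z S'.deg m
  eq_syz : S'.Z = syzFamily 𝒜 S'.deg m

/-- The stage `S'` can follow the stage `S` in a resolution. -/
def IsNext (𝒜 : Γ → Submodule K R) (w : Γ →+ ℤ) (t : ℤ) (S S' : Stage K R Γ) : Prop :=
  ∃ m, IsNextVia 𝒜 w t S S' m

open Classical in
/-- A sequence of stages in which consecutive stages satisfy `r` as long as possible. -/
noncomputable def stages (r : ℕ → Stage K R Γ → Stage K R Γ → Prop) (S : Stage K R Γ) :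
    ℕ → Stage K R Γ
  | 0 => S
  | i + 1 => if h : ∃ S', r i (stages r S i) S' then h.choose else stages r S i

theorem stages_spec {r : ℕ → Stage K R Γ → Stage K R Γ → Prop} {S : Stage K R Γ} {i : ℕ}
    (h : ∃ S', r i (stages r S i) S') : r i (stages r S i) (stages r S (i + 1)) := by
  rw [stages, dif_pos h]
  exact h.choose_spec

/-- The stage formed by the free module of rank one and a graded ideal. -/
abbrev Stage.ofIdeal (I : Γ → Submodule K R) : Stage K R Γ where
  n := 1
  deg _ := 0
  Z γ := Submodule.pi (R := K) Set.univ fun _ => I γ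

theorem Stage.reg_ofIdeal_iff {𝒜 I : Γ → Submodule K R} (hI : IsGradedFamily 𝒜 I) {w : Γ →+ ℤ}
    {p : ℕ} {t : ℤ} : Reg 𝒜 w p t (Stage.ofIdeal I).Z ↔ Reg 𝒜 w p t I := by
  have hon : MapsOnto (LinearMap.proj (R := R) (φ := fun _ : Fin 1 => R) 0) (Stage.ofIdeal I).Z I :=
    ⟨fun γ x hx => hx 0 trivial, fun γ x hx => ⟨fun _ => x, fun _ _ => hx, rfl⟩⟩
  refine hon.reg_iff (fun γ δ a x ha hx i _ => hI ha (hx i trivial)) ?_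
  intro γ x _ hx
  funext i
  rw [Subsingleton.elim i 0]
  exact hx

theorem Stage.isGradedFamily_ofIdeal {𝒜 I : Γ → Submodule K R} (hI : IsGradedFamily 𝒜 I) :
    IsGradedFamily 𝒜 (Stage.ofIdeal I).Z :=
  fun _ _ _ _ ha hx i _ => hI ha (hx i trivial)

theorem exists_isNext {𝒜 : Γ → Submodule K R} {w : Γ →+ ℤ} {t : ℤ} {S : Stage K R Γ} {ι : Type}
    [Fintype ι] {deg : ι → Γ} {m : ι → Fin S.n → R} (hdeg : ∀ i, w (deg i) ≤ t)
    (h : Generates 𝒜 S.Z deg m) : ∃ S', IsNext 𝒜 w t S S' := by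
  obtain ⟨n, deg', m', h1, h2, h3⟩ := h.exists_ne_zero hdeg
  exact ⟨⟨n, deg', syzFamily 𝒜 deg' m'⟩, m', h1, h2, h3, rfl⟩

/-- The stages of a resolution of an ideal satisfying `RegInf`. -/
theorem stages_isNext {𝒜 I : Γ → Submodule K R} [SetLike.GradedMonoid 𝒜] {w : Γ →+ ℤ}
    (hI : IsGradedFamily 𝒜 I) (h : RegInf 𝒜 w 1 I) (i : ℕ) :
    IsNext 𝒜 w (i + 1) (stages (fun i => IsNext 𝒜 w (i + 1)) (Stage.ofIdeal I) i)
      (stages (fun i => IsNext 𝒜 w (i + 1)) (Stage.ofIdeal I) (i + 1)) := by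
  have key : ∀ i : ℕ, IsGradedFamily 𝒜 (stages (fun i => IsNext 𝒜 w (i + 1))
      (Stage.ofIdeal I) i).Z ∧ RegInf 𝒜 w (i + 1) (stages (fun i => IsNext 𝒜 w (i + 1))
      (Stage.ofIdeal I) i).Z := by
    intro i
    induction i with
    | zero =>
      refine ⟨Stage.isGradedFamily_ofIdeal hI, fun p => ?_⟩
      rw [Nat.cast_zero, zero_add]
      exact (Stage.reg_ofIdeal_iff hI).2 (h p)
    | succ i ih =>
      obtain ⟨n, deg, m, h1, -, h3⟩ := ih.2.exists_generates
      obtain ⟨m', hm'⟩ := stages_spec (r := fun i => IsNext 𝒜 w (i + 1)) (exists_isNext h1 h3)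
      rw [hm'.eq_syz]
      refine ⟨isGradedFamily_syzFamily _ _, ?_⟩
      push_cast
      exact ih.2.syzFamily ih.1 hm'.generates fun i => (hm'.weight_le i).trans (by lia)
  obtain ⟨n, deg, m, h1, -, h3⟩ := (key i).2.exists_generates
  exact stages_spec (r := fun i => IsNext 𝒜 w (i + 1)) (exists_isNext h1 h3)

/-- If the residue field has a linear resolution over `R`, then so has `R ⧸ (l > 0)`, which is an
algebra retract of `R`. -/
theorem regInf_posFamily_of_regInf {𝓡 : Γ → Submodule K R} [SetLike.GradedMonoid 𝓡] {w l : Γ →+ ℤ}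
    (hw : ∀ γ, 𝓡 γ ≠ ⊥ → 0 ≤ w γ) (hl : ∀ γ, 𝓡 γ ≠ ⊥ → 0 ≤ l γ)
    (hlw : ∀ γ, 𝓡 γ ≠ ⊥ → 0 < l γ → 0 < w γ) (h : RegInf 𝓡 w 1 (posFamily 𝓡 w)) :
    RegInf 𝓡 w 1 (posFamily 𝓡 l) := by
  classical
  have hw0 : ∀ γ, zeroPart 𝓡 l γ ≠ ⊥ → 0 ≤ w γ := fun γ hγ => hw γ fun hb =>
    hγ (eq_bot_iff.2 (hb ▸ zeroPart_le γ))
  have hF0 : RegInf (zeroPart 𝓡 l) w 1 (posFamily (zeroPart 𝓡 l) w) := by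
    intro p
    rw [← zeroPart_posFamily]
    refine reg_zeroPart hl (isGradedFamily_posFamily hw) (fun γ hγ => hl γ fun hb => ?_) h
    exact hγ (eq_bot_iff.2 (hb ▸ posFamily_le _ γ))
  let F := stages (fun i => IsNext (zeroPart 𝓡 l) w (i + 1))
    (Stage.ofIdeal (posFamily (zeroPart 𝓡 l) w))
  have hF : ∀ p : ℕ, IsNext (zeroPart 𝓡 l) w (p + 1) (F p) (F (p + 1)) :=
    stages_isNext (isGradedFamily_posFamily hw0) hF0
  choose bd hbd using hF
  -- A nonzero generator has a nonzero entry in the zero part, which forces its `l`-degree to be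
  -- that of the previous basis, namely zero.
  have hFl : ∀ p i, l ((F p).deg i) = 0 := by
    intro p
    induction p with
    | zero => exact fun i => map_zero l
    | succ p ih =>
      intro i
      have h1 : bd p i ∈ freeFamily (zeroPart 𝓡 l) (F p).deg ((F (p + 1)).deg i) := by
        have h2 := (hbd p).generates.mem i
        cases p with
        | zero =>
          refine mem_freeFamily.2 fun j => ?_
          rw [show (F 0).deg j = 0 from rfl, sub_zero]
          exact posFamily_le _ _ (h2 j trivial)
        | succ p =>
          rw [(hbd p).eq_syz, mem_syzFamily] at h2
          exact mem_freeFamily.2 h2.1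
      obtain ⟨j, hj⟩ := exists_apply_mem_ne_zero h1 ((hbd p).ne_zero i)
      by_contra h0
      exact hj (zeroPart_of_ne (by rwa [map_sub, ih, sub_zero]))
  let r : ℕ → Stage K R Γ → Stage K R Γ → Prop := fun i => IsNext 𝓡 w (i + 1)
  let G := stages r (Stage.ofIdeal (posFamily 𝓡 l))
  -- The default `0` is harmless: at stage `n` only the matrices with `q < n` carry conditions, and
  -- these steps exist.
  let D : ∀ q, Fin (G (q + 1)).n → Fin (G q).n → R := fun q =>
    if h : IsNext 𝓡 w (q + 1) (G q) (G (q + 1)) then h.choose else 0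
  -- That the resolution `G` can be continued linearly at stage `n` is known only by means of its
  -- first `n` steps, so `G` is built by strong induction.
  have hG : ∀ n : ℕ, (∀ q < n, IsNext 𝓡 w (q + 1) (G q) (G (q + 1))) →
      IsNext 𝓡 w (n + 1) (G n) (G (n + 1)) := by
    intro n hn
    have hD : ∀ q < n, IsNextVia 𝓡 w (q + 1) (G q) (G (q + 1)) (D q) := by
      intro q hq
      simp only [D, dif_pos (hn q hq)]
      exact (hn q hq).choose_spec
    let P : ResolutionPair 𝓡 w l n :=
      { f := fun p => (F p).n
        g := fun q => (G q).n
        bd := bd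
        D := D
        fdeg := fun p => (F p).deg
        gdeg := fun q => (G q).deg
        ZF := fun p => (F p).Z
        ZG := fun q => (G q).Z
        base := (0 : Fin 1)
        fdeg_zero := fun _ => rfl
        gdeg_zero := fun _ => rfl
        mem_ZF_zero := fun γ x => ⟨fun h i => h i trivial, fun h i _ => h i⟩
        mem_ZG_zero := fun γ x => ⟨fun h i => h i trivial, fun h i _ => h i⟩
        genF := fun p => (hbd p).generates
        ZF_succ := fun p => (hbd p).eq_syz
        genG := fun q hq => (hD q hq).generates
        ZG_succ := fun q hq => (hD q hq).eq_syz
        weight_fdeg_le := by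
          intro p i
          cases p with
          | zero => exact (map_zero w).le
          | succ p => exact_mod_cast (hbd p).weight_le i
        apply_fdeg := hFl
        weight_fdeg_one := by
          intro i
          by_contra h0
          have h1 := (hbd 0).generates.mem i
          refine (hbd 0).ne_zero i ?_
          funext j
          have h2 : bd 0 i j ∈ posFamily (zeroPart 𝓡 l) w ((F 1).deg i) := h1 j trivial
          rwa [posFamily_of_not_pos h0, Submodule.mem_bot] at h2
        weight_gdeg_le := by
          intro q hq i
          cases q with
          | zero => exact (map_zero w).le
          | succ q => exact_mod_cast (hD q hq).weight_le i
        weight_gdeg_nonneg := by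
          intro q hq
          induction q with
          | zero => exact fun i => (map_zero w).ge
          | succ q ih =>
            intro i
            have h1 : D q i ∈ freeFamily 𝓡 (G q).deg ((G (q + 1)).deg i) := by
              have h2 := (hD q hq).generates.mem i
              cases q with
              | zero =>
                refine mem_freeFamily.2 fun j => ?_
                rw [show (G 0).deg j = 0 from rfl, sub_zero]
                exact posFamily_le _ _ (h2 j trivial)
              | succ q =>
                rw [(hD q (by lia)).eq_syz, mem_syzFamily] at h2
                exact mem_freeFamily.2 h2.1
            obtain ⟨j, hj⟩ := exists_apply_mem_ne_zero h1 ((hD q hq).ne_zero i)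
            have h3 := hw _ hj
            rw [map_sub] at h3
            have h4 := ih (by lia) j
            linarith }
    obtain ⟨N, deg, m, h1, h2⟩ := P.exists_generates_ZG hw hl hlw h
    exact stages_spec (r := r) (exists_isNext (S := G n) h1 h2)
  have hG' : ∀ n : ℕ, IsNext 𝓡 w (n + 1) (G n) (G (n + 1)) := by
    intro n
    induction n using Nat.strong_induction_on with
    | _ n ih => exact hG n ih
  have key : ∀ p (q : ℕ), Reg 𝓡 w p (q + 1) (G q).Z := by
    intro p
    induction p with
    | zero => intros; trivial
    | succ p ih =>
      intro q
      obtain ⟨m, hm⟩ := hG' q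
      refine ⟨_, _, _, m, hm.weight_le, hm.generates, ?_⟩
      have := ih (q + 1)
      rw [hm.eq_syz] at this
      push_cast at this
      exact this
  intro p
  have := key p 0
  rw [Nat.cast_zero, zero_add] at this
  exact (Stage.reg_ofIdeal_iff (isGradedFamily_posFamily hl)).1 this

end Retract

/-! ### Slices of graded modules -/

section Slices

variable {K : Type u} {R : Type v} [Field K] [CommRing R] [Algebra K R]
  {X : Type v} [AddCommGroup X] [Module K X] [Module R X] [IsScalarTower K R X]
  {Γ Γ' : Type} [AddCommGroup Γ] [AddCommGroup Γ']

open Classical in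
/-- The graded module `⨁_{x ∈ C} ℳ_{φ(x) + γ}`. -/
noncomputable def slice (φ : Γ' →+ Γ) (C : AddSubmonoid Γ') (ℳ : Γ → Submodule K X) (γ : Γ)
    (x : Γ') : Submodule K X :=
  if x ∈ C then ℳ (φ x + γ) else ⊥

variable {φ : Γ' →+ Γ} {C : AddSubmonoid Γ'} {𝓡 : Γ → Submodule K R} {ℳ : Γ → Submodule K X}

theorem slice_of_mem {γ : Γ} {x : Γ'} (hx : x ∈ C) : slice φ C ℳ γ x = ℳ (φ x + γ) := if_pos hx

theorem slice_of_notMem {γ : Γ} {x : Γ'} (hx : x ∉ C) : slice φ C ℳ γ x = ⊥ := if_neg hx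

theorem isGradedFamily_slice (hℳ : IsGradedFamily 𝓡 ℳ) (γ : Γ) :
    IsGradedFamily (slice φ C 𝓡 0) (slice φ C ℳ γ) := by
  intro x y a m ha hm
  by_cases hx : x ∈ C
  · by_cases hy : y ∈ C
    · rw [slice_of_mem hx, add_zero] at ha
      rw [slice_of_mem hy] at hm
      rw [slice_of_mem (C.add_mem hx hy), map_add, add_assoc]
      exact hℳ ha hm
    · rw [slice_of_notMem hy, Submodule.mem_bot] at hm
      rw [hm, smul_zero]
      exact Submodule.zero_mem _
  · rw [slice_of_notMem hx, Submodule.mem_bot] at ha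
    rw [ha, zero_smul]
    exact Submodule.zero_mem _

instance slice.gradedMonoid [SetLike.GradedMonoid 𝓡] : SetLike.GradedMonoid (slice φ C 𝓡 0) where
  one_mem := by
    rw [slice_of_mem C.zero_mem, map_zero, add_zero]
    exact SetLike.one_mem_graded 𝓡
  mul_mem := fun _ _ _ _ ha hb => isGradedFamily_slice isGradedFamily_self 0 ha hb

/-- The slices of `R` that arise are in general not free over the slice algebra. This is why all
shifts `γ` must be treated together. -/
theorem slice_freeFamily {n : ℕ} (deg : Fin n → Γ) (γ : Γ) :
    slice φ C (freeFamily 𝓡 deg) γ =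
      fun x => Submodule.pi (R := K) Set.univ fun j => slice φ C 𝓡 (γ - deg j) x := by
  funext x
  by_cases hx : x ∈ C
  · rw [slice_of_mem hx]
    ext a
    simp only [mem_freeFamily, Submodule.mem_pi, Set.mem_univ, true_imp_iff]
    refine forall_congr' fun j => ?_
    rw [slice_of_mem hx, add_sub_assoc]
  · rw [slice_of_notMem hx]
    refine (eq_bot_iff.2 fun a ha => ?_).symm
    rw [Submodule.mem_bot]
    funext j
    have : a j ∈ slice φ C 𝓡 (γ - deg j) x := ha j trivial
    rwa [slice_of_notMem hx, Submodule.mem_bot] at this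

theorem slice_kerFamily {Y : Type v} [AddCommGroup Y] [Module K Y] [Module R Y]
    [IsScalarTower K R Y] (g : X →ₗ[R] Y) (γ : Γ) :
    slice φ C (kerFamily ℳ g) γ = kerFamily (slice φ C ℳ γ) g := by
  funext x
  by_cases hx : x ∈ C
  · rw [slice_of_mem hx, kerFamily, kerFamily, slice_of_mem hx]
  · rw [slice_of_notMem hx, kerFamily, slice_of_notMem hx, bot_inf_eq]

theorem MapsOnto.slice {Y : Type v} [AddCommGroup Y] [Module K Y] [Module R Y]
    [IsScalarTower K R Y] {g : X →ₗ[R] Y} {𝒩 : Γ → Submodule K Y} (hg : MapsOnto g ℳ 𝒩) (γ : Γ) :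
    MapsOnto g (slice φ C ℳ γ) (slice φ C 𝒩 γ) := by
  constructor
  · intro x m hm
    by_cases hx : x ∈ C
    · rw [slice_of_mem hx] at hm ⊢
      exact hg.map_mem hm
    · rw [slice_of_notMem hx, Submodule.mem_bot] at hm
      rw [hm, map_zero]
      exact Submodule.zero_mem _
  · intro x m hm
    by_cases hx : x ∈ C
    · rw [slice_of_mem hx] at hm ⊢
      exact hg.exists_eq hm
    · rw [slice_of_notMem hx, Submodule.mem_bot] at hm
      exact ⟨0, Submodule.zero_mem _, by rw [hm, map_zero]⟩

/-- One step of the resolution of a slice. -/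
theorem reg_slice_of_generates [SetLike.GradedMonoid 𝓡] (hℳ : IsGradedFamily 𝓡 ℳ) {w : Γ' →+ ℤ}
    {n : ℕ} {deg : Fin n → Γ} {m : Fin n → X} (hm : Generates 𝓡 ℳ deg m) {γ : Γ} {p : ℕ} {t : ℤ}
    (h : Reg (slice φ C 𝓡 0) w p (t + 1) (slice φ C (syzFamily 𝓡 deg m) γ))
    (h' : ∀ j, Reg (slice φ C 𝓡 0) w (p + 1) t (slice φ C 𝓡 (γ - deg j))) :
    Reg (slice φ C 𝓡 0) w (p + 1) t (slice φ C ℳ γ) := by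
  refine ((hm.mapsOnto hℳ).slice γ).reg_of_source
    (isGradedFamily_slice (isGradedFamily_freeFamily deg) γ) ?_ ?_
  · rwa [← slice_kerFamily]
  · rw [slice_freeFamily]
    exact reg_pi (fun _ => isGradedFamily_slice isGradedFamily_self _) h'

end Slices

/-! ### Regularity of the slices of a bigraded Koszul algebra -/

section Bigraded

variable {Γ' : Type} [AddCommGroup Γ'] {K : Type u} {R : Type v} [Field K] [CommRing R]
  [Algebra K R]

/-- The total degree. -/
def totalWeight : ℤ × ℤ →+ ℤ := AddMonoidHom.fst ℤ ℤ + AddMonoidHom.snd ℤ ℤ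

@[simp] theorem totalWeight_apply (γ : ℤ × ℤ) : totalWeight γ = γ.1 + γ.2 := rfl

/-- The sum of the absolute values of the negative coordinates. -/
def negWeight (γ : ℤ × ℤ) : ℤ := max 0 (-γ.1) + max 0 (-γ.2)

/-- The conditions on a cone `C` of degrees under which slices along `φ` inherit linear
resolutions. -/
structure IsSliceCone (φ : Γ' →+ ℤ × ℤ) (C : AddSubmonoid Γ') (w : Γ' →+ ℤ) : Prop where
  nonneg : ∀ x ∈ C, 0 ≤ φ x
  shift : ∀ γ : ℤ × ℤ, ¬ 0 ≤ γ → (∀ x ∈ C, ¬ 0 ≤ φ x + γ) ∨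
    ∃ x₀ ∈ C, w x₀ = 1 ∧ (∀ x ∈ C, 0 ≤ φ x + γ → x - x₀ ∈ C) ∧
      negWeight (γ + φ x₀) + 1 ≤ negWeight γ

variable {φ : Γ' →+ ℤ × ℤ} {C : AddSubmonoid Γ'} {w : Γ' →+ ℤ} {𝓡 : ℤ × ℤ → Submodule K R}
  [SetLike.GradedMonoid 𝓡]

/-- A resolution of `ℳ` is sliced term by term. A generator of degree `deg j` contributes the slice
of `R` at `γ - deg j`, whose negative part is at most `totalWeight (deg j) - totalWeight δ₀` because
both `deg j` and `γ` are at least `δ₀`. -/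
theorem reg_slice_of_regInf (hpos : ∀ γ, 𝓡 γ ≠ ⊥ → 0 ≤ γ) {δ₀ γ : ℤ × ℤ} (hγ : δ₀ ≤ γ) {p : ℕ}
    (hA : ∀ p' ≤ p, ∀ γ t, negWeight γ ≤ t →
      Reg (slice φ C 𝓡 0) w p' t (slice φ C 𝓡 γ)) :
    ∀ {i : ℤ} {X : Type v} [AddCommGroup X] [Module K X] [Module R X] [IsScalarTower K R X]
    {ℳ : ℤ × ℤ → Submodule K X} (_ : IsGradedFamily 𝓡 ℳ) (_ : ∀ δ, ℳ δ ≠ ⊥ → δ₀ ≤ δ)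
    (_ : RegInf 𝓡 totalWeight i ℳ),
    Reg (slice φ C 𝓡 0) w p (i - totalWeight δ₀) (slice φ C ℳ γ) := by
  induction p with
  | zero => intros; trivial
  | succ p ih =>
    intro i X _ _ _ _ ℳ hℳ hsupp h
    obtain ⟨n, deg, m, h1, h2, h3⟩ := h.exists_generates
    -- This is the reason for taking nonzero generators: their degrees lie in the support.
    have hdeg : ∀ j, δ₀ ≤ deg j := fun j => hsupp _ fun hb => h2 j (by
      have := h3.mem j
      rwa [hb, Submodule.mem_bot] at this)
    refine reg_slice_of_generates hℳ h3 ?_ fun j => ?_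
    · have h4 := ih (fun p' hp' => hA p' (by lia)) (isGradedFamily_syzFamily deg m) ?_
        (h.syzFamily hℳ h3 fun j => (h1 j).trans (by lia))
      · convert h4 using 1
        ring
      · intro δ hδ
        obtain ⟨a, ha, ha0⟩ := Submodule.exists_mem_ne_zero_of_ne_bot hδ
        obtain ⟨j, hj⟩ := exists_apply_mem_ne_zero (mem_freeFamily.2 (mem_syzFamily.1 ha).1) ha0
        exact (hdeg j).trans (sub_nonneg.1 (hpos _ hj))
    · refine hA (p + 1) le_rfl _ _ ?_
      have h5 := h1 j
      have h6 := hdeg j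
      rw [Prod.le_def] at h6 hγ
      simp only [negWeight, totalWeight_apply, Prod.fst_sub, Prod.snd_sub] at h5 ⊢
      lia

/-- The slice lives only in degrees of `x₀ + C`. So a negative shift of degrees can be traded for a
higher weight of the generators. -/
theorem slice_eq_shift (hpos : ∀ γ, 𝓡 γ ≠ ⊥ → 0 ≤ γ) {γ : ℤ × ℤ} {x₀ : Γ'} (hx₀ : x₀ ∈ C)
    (h : ∀ x ∈ C, 0 ≤ φ x + γ → x - x₀ ∈ C) :
    slice φ C 𝓡 γ = fun x => slice φ C 𝓡 (γ + φ x₀) (x - x₀) := by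
  funext x
  by_cases hx : x ∈ C
  · rw [slice_of_mem hx]
    by_cases hx' : x - x₀ ∈ C
    · rw [slice_of_mem hx', map_sub]
      congr 1
      abel
    · rw [slice_of_notMem hx']
      by_contra hb
      exact hx' (h x hx (hpos _ hb))
  · rw [slice_of_notMem hx, slice_of_notMem]
    intro hx'
    apply hx
    have := C.add_mem hx' hx₀
    rwa [sub_add_cancel] at this

theorem slice_posFamily (hC : IsSliceCone φ C w) {l : ℤ × ℤ →+ ℤ} (hl : ∀ γ, 0 ≤ γ → 0 ≤ l γ)
    {γ : ℤ × ℤ} (hγ : 0 < l γ) : slice φ C (posFamily 𝓡 l) γ = slice φ C 𝓡 γ := by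
  funext x
  by_cases hx : x ∈ C
  · rw [slice_of_mem hx, slice_of_mem hx, posFamily_of_pos]
    rw [map_add]
    have := hl _ (hC.nonneg x hx)
    lia
  · rw [slice_of_notMem hx, slice_of_notMem hx]

/-- Since `l γ > 0`, the slice of `R` is a slice of the ideal `(l > 0)`, whose generators all have
degree `e`. They contribute slices at `γ - e`. The relations have support above `e` and satisfy the
bound `2`, so `reg_slice_of_regInf` gives them the bound `1`, and only lengths up to `p` are needed
for this. -/
theorem reg_slice_of_pos (hpos : ∀ γ, 𝓡 γ ≠ ⊥ → 0 ≤ γ) (hC : IsSliceCone φ C w)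
    {l : ℤ × ℤ →+ ℤ} (hl : ∀ γ, 0 ≤ γ → 0 ≤ l γ) (hI : RegInf 𝓡 totalWeight 1 (posFamily 𝓡 l))
    {e : ℤ × ℤ} (he : totalWeight e = 1) (hle : ∀ γ, 0 ≤ γ → 0 < l γ → e ≤ γ)
    {p : ℕ} (hA : ∀ p' ≤ p, ∀ γ t, negWeight γ ≤ t →
      Reg (slice φ C 𝓡 0) w p' t (slice φ C 𝓡 γ)) {γ : ℤ × ℤ} (hγ : 0 ≤ γ) (hlγ : 0 < l γ)
    (h : Reg (slice φ C 𝓡 0) w (p + 1) 0 (slice φ C 𝓡 (γ - e))) :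
    Reg (slice φ C 𝓡 0) w (p + 1) 0 (slice φ C 𝓡 γ) := by
  have hIgr : IsGradedFamily 𝓡 (posFamily 𝓡 l) :=
    isGradedFamily_posFamily fun γ hγ => hl γ (hpos γ hγ)
  have hsupp : ∀ δ, posFamily 𝓡 l δ ≠ ⊥ → e ≤ δ := by
    intro δ hδ
    have h1 : 0 < l δ := by
      by_contra h0
      exact hδ (posFamily_of_not_pos h0)
    rw [posFamily_of_pos h1] at hδ
    exact hle δ (hpos δ hδ) h1
  obtain ⟨n, deg, m, h1, h2, h3⟩ := hI.exists_generates
  have hdeg : ∀ j, e ≤ deg j := fun j => hsupp _ fun hb => h2 j (by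
    have := h3.mem j
    rwa [hb, Submodule.mem_bot] at this)
  rw [← slice_posFamily hC hl hlγ]
  refine reg_slice_of_generates hIgr h3 ?_ fun j => ?_
  · have h4 := reg_slice_of_regInf (i := 2) hpos (hle γ hγ hlγ) hA
      (isGradedFamily_syzFamily deg m) ?_ (hI.syzFamily hIgr h3 fun j => (h1 j).trans (by lia))
    · rw [he] at h4
      exact h4
    · intro δ hδ
      obtain ⟨a, ha, ha0⟩ := Submodule.exists_mem_ne_zero_of_ne_bot hδ
      obtain ⟨j, hj⟩ := exists_apply_mem_ne_zero (mem_freeFamily.2 (mem_syzFamily.1 ha).1) ha0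
      exact (hdeg j).trans (sub_nonneg.1 (hpos _ hj))
  · have h5 : deg j = e := by
      have h6 := h1 j
      have h7 := hdeg j
      rw [Prod.le_def] at h7
      rw [totalWeight_apply] at h6 he
      exact Prod.ext (by lia) (by lia)
    rwa [h5]

/-- All slices of `R` satisfy `Reg`. -/
theorem reg_slice (hpos : ∀ γ, 𝓡 γ ≠ ⊥ → 0 ≤ γ) (hC : IsSliceCone φ C w)
    (hfst : RegInf 𝓡 totalWeight 1 (posFamily 𝓡 (AddMonoidHom.fst ℤ ℤ)))
    (hsnd : RegInf 𝓡 totalWeight 1 (posFamily 𝓡 (AddMonoidHom.snd ℤ ℤ))) (p : ℕ) :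
    ∀ γ t, negWeight γ ≤ t → Reg (slice φ C 𝓡 0) w p t (slice φ C 𝓡 γ) := by
  induction p using Nat.strong_induction_on with
  | _ p ih =>
  rcases p with _ | p
  · intros; trivial
  have hA : ∀ p' ≤ p, ∀ γ t, negWeight γ ≤ t → Reg (slice φ C 𝓡 0) w p' t (slice φ C 𝓡 γ) :=
    fun p' hp' => ih p' (by lia)
  -- A nonnegative shift is lowered by `(1, 0)` or `(0, 1)` until it is zero, where the slice is the
  -- algebra itself.
  have hnonneg : ∀ (N : ℕ) (γ : ℤ × ℤ), 0 ≤ γ → totalWeight γ ≤ N →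
      Reg (slice φ C 𝓡 0) w (p + 1) 0 (slice φ C 𝓡 γ) := by
    intro N
    induction N with
    | zero =>
      intro γ hγ hN
      rw [Prod.le_def] at hγ
      rw [totalWeight_apply] at hN
      have : γ = 0 := Prod.ext
        (by simp only [Prod.fst_zero, Prod.snd_zero, Nat.cast_zero] at *; lia)
        (by simp only [Prod.fst_zero, Prod.snd_zero, Nat.cast_zero] at *; lia)
      rw [this]
      exact reg_self _
    | succ N ihN =>
      intro γ hγ hN
      have hγ' := Prod.le_def.1 hγ
      rw [totalWeight_apply] at hN
      simp only [Prod.fst_zero, Prod.snd_zero] at hγ'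
      by_cases h1 : 0 < γ.1
      · refine reg_slice_of_pos hpos hC (l := AddMonoidHom.fst ℤ ℤ) (fun γ hγ => hγ.1) hfst
          (e := (1, 0)) rfl (fun γ hγ h => Prod.le_def.2 ⟨h, hγ.2⟩) hA hγ h1 (ihN _ ?_ ?_)
        · exact Prod.le_def.2 ⟨sub_nonneg.2 h1, by simpa using hγ'.2⟩
        · simp only [totalWeight_apply, Prod.fst_sub, Prod.snd_sub]
          push_cast at hN
          lia
      · by_cases h2 : 0 < γ.2
        · refine reg_slice_of_pos hpos hC (l := AddMonoidHom.snd ℤ ℤ) (fun γ hγ => hγ.2) hsnd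
            (e := (0, 1)) rfl (fun γ hγ h => Prod.le_def.2 ⟨hγ.1, h⟩) hA hγ h2 (ihN _ ?_ ?_)
          · exact Prod.le_def.2 ⟨by simpa using hγ'.1, sub_nonneg.2 h2⟩
          · simp only [totalWeight_apply, Prod.fst_sub, Prod.snd_sub]
            push_cast at hN
            lia
        · have : γ = 0 := Prod.ext (by simp; lia) (by simp; lia)
          rw [this]
          exact reg_self _
  -- For other shifts the slice is zero, or moving by `x₀` costs one unit of weight and lowers
  -- `negWeight` by at least one.
  have hgen : ∀ (N : ℕ) (γ : ℤ × ℤ), negWeight γ ≤ N →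
      Reg (slice φ C 𝓡 0) w (p + 1) (negWeight γ) (slice φ C 𝓡 γ) := by
    intro N
    induction N with
    | zero =>
      intro γ hN
      have h0 : 0 ≤ γ := by
        rw [Prod.le_def]
        simp only [negWeight, Prod.fst_zero, Prod.snd_zero, Nat.cast_zero] at *
        lia
      refine (hnonneg (totalWeight γ).toNat γ h0 (Int.self_le_toNat _)).mono ?_
      simp only [negWeight]
      lia
    | succ N ihN =>
      intro γ hN
      by_cases h0 : 0 ≤ γ
      · refine (hnonneg (totalWeight γ).toNat γ h0 (Int.self_le_toNat _)).mono ?_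
        simp only [negWeight]
        lia
      · rcases hC.shift γ h0 with h | ⟨x₀, hx₀, hw, hsub, hlt⟩
        · refine reg_of_forall_eq_zero (fun x a ha => ?_) _ _
          by_cases hx : x ∈ C
          · rw [slice_of_mem hx] at ha
            by_contra ha0
            exact h x hx (hpos _ fun hb => ha0 (by rwa [hb, Submodule.mem_bot] at ha))
          · rwa [slice_of_notMem hx, Submodule.mem_bot] at ha
        · rw [slice_eq_shift hpos hx₀ hsub]
          push_cast at hN
          refine ((ihN (γ + φ x₀) (by lia)).shift x₀).mono ?_
          rw [hw]
          exact hlt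
  intro γ t ht
  exact (hgen (negWeight γ).toNat γ (Int.self_le_toNat _)).mono ht

/-- The maximal ideal of a slice of a Koszul algebra satisfies `Reg`. -/
theorem regInf_slice_posFamily (hpos : ∀ γ, 𝓡 γ ≠ ⊥ → 0 ≤ γ) (hC : IsSliceCone φ C w)
    (h : RegInf 𝓡 totalWeight 1 (posFamily 𝓡 totalWeight)) :
    RegInf (slice φ C 𝓡 0) w 1 (slice φ C (posFamily 𝓡 totalWeight) 0) := by
  have hw : ∀ γ, 𝓡 γ ≠ ⊥ → 0 ≤ totalWeight γ := fun γ hγ => by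
    have := Prod.le_def.1 (hpos γ hγ)
    simp only [Prod.fst_zero, Prod.snd_zero] at this
    rw [totalWeight_apply]
    lia
  have hfst := regInf_posFamily_of_regInf (l := AddMonoidHom.fst ℤ ℤ) hw
    (fun γ hγ => (hpos γ hγ).1) (fun γ hγ hlγ => by
      have h2 : 0 ≤ γ.2 := (hpos γ hγ).2
      have h1 : 0 < γ.1 := hlγ
      rw [totalWeight_apply]
      lia) h
  have hsnd := regInf_posFamily_of_regInf (l := AddMonoidHom.snd ℤ ℤ) hw
    (fun γ hγ => (hpos γ hγ).2) (fun γ hγ hlγ => by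
      have h2 : 0 ≤ γ.1 := (hpos γ hγ).1
      have h1 : 0 < γ.2 := hlγ
      rw [totalWeight_apply]
      lia) h
  intro p
  -- The linear resolution of the maximal ideal of `R` is now sliced.
  have := reg_slice_of_regInf (δ₀ := 0) (γ := 0) (i := 1) (p := p) hpos le_rfl
    (fun p' _ => reg_slice hpos hC hfst hsnd p') (isGradedFamily_posFamily hw)
    (fun δ hδ => hpos δ fun hb => hδ (eq_bot_iff.2 (hb ▸ posFamily_le _ δ))) h
  simpa using this

end Bigraded

/-! ### Minimal resolutions and exact weights -/

section MinimalResolution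

variable {K : Type u} {R : Type v} [Field K] [CommRing R] [Algebra K R] {Γ : Type}
  [AddCommGroup Γ] {𝒜 : Γ → Submodule K R} [SetLike.GradedMonoid 𝒜] {w : Γ →+ ℤ}

/-- A generator that is a combination of the others can be dropped. -/
theorem Generates.succAbove {X : Type v} [AddCommGroup X] [Module K X] [Module R X]
    [IsScalarTower K R X] {ℳ : Γ → Submodule K X} {n : ℕ} {deg : Fin (n + 1) → Γ}
    {m : Fin (n + 1) → X} (hm : Generates 𝒜 ℳ deg m) (j : Fin (n + 1)) {b : Fin n → R}
    (hb : b ∈ freeFamily 𝒜 (deg ∘ j.succAbove) (deg j))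
    (h : m j = Fintype.linearCombination R (m ∘ j.succAbove) b) :
    Generates 𝒜 ℳ (deg ∘ j.succAbove) (m ∘ j.succAbove) := by
  refine ⟨fun i => hm.mem _, fun γ x hx => ?_⟩
  obtain ⟨a, ha, rfl⟩ := hm.exists_eq hx
  rw [mem_freeFamily] at ha hb
  refine ⟨a j • b + a ∘ j.succAbove, mem_freeFamily.2 fun i => ?_, ?_⟩
  · refine Submodule.add_mem _ ?_ (ha _)
    have := SetLike.mul_mem_graded (ha j) (hb i)
    rwa [sub_add_sub_cancel] at this
  · rw [map_add, map_smul, ← h, Fintype.linearCombination_apply, Fintype.linearCombination_apply,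
      Fin.sum_univ_succAbove _ j]
    rfl

/-- The stage `S'` can follow the stage `S` in a minimal resolution. -/
def IsMinimalNext (𝒜 : Γ → Submodule K R) (w : Γ →+ ℤ) (t : ℤ) (S S' : Stage K R Γ) : Prop :=
  IsNext 𝒜 w t S S' ∧ ∀ S'', IsNext 𝒜 w t S S'' → S'.n ≤ S''.n

theorem IsNext.exists_isMinimalNext {t : ℤ} {S S' : Stage K R Γ} (h : IsNext 𝒜 w t S S') :
    ∃ S'', IsMinimalNext 𝒜 w t S S'' := by
  classical
  have hex : ∃ n, ∃ S', IsNext 𝒜 w t S S' ∧ S'.n = n := ⟨_, S', h, rfl⟩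
  obtain ⟨S'', h1, h2⟩ := Nat.find_spec hex
  exact ⟨S'', h1, fun T hT => h2 ▸ Nat.find_min' hex ⟨T, hT, rfl⟩⟩

/-- In a minimal step the relations have larger weight than the generators. -/
theorem IsMinimalNext.lt_weight (hw : ∀ γ, 𝒜 γ ≠ ⊥ → 0 ≤ w γ)
    (hw0 : ∀ γ, 𝒜 γ ≠ ⊥ → w γ = 0 → γ = 0) (h0 : 𝒜 0 = 1) {t : ℤ} {S S' : Stage K R Γ}
    (h : IsMinimalNext 𝒜 w t S S') (hS' : ∀ i, w (S'.deg i) = t) {γ : Γ} (hγ : S'.Z γ ≠ ⊥) :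
    t < w γ := by
  obtain ⟨⟨m, hm⟩, hmin⟩ := h
  rw [hm.eq_syz] at hγ
  obtain ⟨a, ha, ha0⟩ := Submodule.exists_mem_ne_zero_of_ne_bot hγ
  rw [mem_syzFamily] at ha
  obtain ⟨j, hj⟩ := Function.ne_iff.1 ha0
  have hne : 𝒜 (γ - S'.deg j) ≠ ⊥ := fun hb => hj (by
    have := ha.1 j
    rwa [hb, Submodule.mem_bot] at this)
  have h1 := hw _ hne
  rw [map_sub, hS'] at h1
  -- In a relation of weight `t` the nonzero coefficient of `m j` has degree zero, so it is a
  -- scalar. Solving for `m j` gives fewer generators, against minimality.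
  refine (sub_nonneg.1 h1).lt_of_ne fun hlt => ?_
  have h2 := hw0 _ hne (by rw [map_sub, hS', hlt, sub_self])
  have h3 := ha.1 j
  rw [h2, h0, Submodule.mem_one] at h3
  obtain ⟨k, hk⟩ := h3
  have hk0 : k ≠ 0 := by
    rintro rfl
    exact hj (by rw [← hk, map_zero]; rfl)
  obtain ⟨n, deg, Z⟩ := S'
  dsimp only at *
  rcases n with _ | n
  · exact j.elim0
  have hγj : γ = deg j := sub_eq_zero.1 h2
  have hg : Generates 𝒜 S.Z (deg ∘ j.succAbove) (m ∘ j.succAbove) := by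
    refine hm.generates.succAbove j (b := (-k⁻¹) • (a ∘ j.succAbove)) ?_ ?_
    · refine Submodule.smul_mem _ _ (mem_freeFamily.2 fun i => ?_)
      have := ha.1 (j.succAbove i)
      rw [hγj] at this
      exact this
    · have h4 := ha.2
      rw [Fintype.linearCombination_apply, Fin.sum_univ_succAbove _ j, ← hk,
        algebraMap_smul] at h4
      have h5 : Fintype.linearCombination R (m ∘ j.succAbove) ((-k⁻¹) • (a ∘ j.succAbove)) =
          (-k⁻¹) • ∑ i, a (j.succAbove i) • m (j.succAbove i) := by
        rw [Fintype.linearCombination_apply, Finset.smul_sum]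
        simp
      rw [h5, ← neg_eq_of_add_eq_zero_right h4, smul_neg, neg_smul, neg_neg, smul_smul,
        inv_mul_cancel₀ hk0, one_smul]
  have := hmin ⟨n, deg ∘ j.succAbove, syzFamily 𝒜 (deg ∘ j.succAbove) (m ∘ j.succAbove)⟩
    ⟨m ∘ j.succAbove, fun i => hm.weight_le _, fun i => hm.ne_zero _, hg, rfl⟩
  dsimp only at this
  lia

/-- A resolution by stages with generators in the least possible weights. -/
theorem exists_linear_stages {I : Γ → Submodule K R} (hI : IsGradedFamily 𝒜 I)
    (hw : ∀ γ, 𝒜 γ ≠ ⊥ → 0 ≤ w γ) (hw0 : ∀ γ, 𝒜 γ ≠ ⊥ → w γ = 0 → γ = 0) (h0 : 𝒜 0 = 1)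
    (hIw : ∀ γ, I γ ≠ ⊥ → 0 < w γ) (h : RegInf 𝒜 w 1 I) :
    ∃ F : ℕ → Stage K R Γ, F 0 = Stage.ofIdeal I ∧ (∀ i j, w ((F i).deg j) = i) ∧
      ∀ i : ℕ, IsNext 𝒜 w (i + 1) (F i) (F (i + 1)) := by
  let r : ℕ → Stage K R Γ → Stage K R Γ → Prop := fun i => IsMinimalNext 𝒜 w (i + 1)
  let F := stages r (Stage.ofIdeal I)
  have hex : ∀ i : ℕ, RegInf 𝒜 w (i + 1) (F i).Z → ∃ S', r i (F i) S' := by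
    intro i hi
    obtain ⟨n, deg, m, h1, -, h3⟩ := hi.exists_generates
    obtain ⟨S', hS'⟩ := exists_isNext h1 h3
    exact hS'.exists_isMinimalNext
  -- Two bounds meet: regularity gives generators of weight at most `i + 1`, while minimality of the
  -- preceding step (for `i = 0`, positivity of the ideal) puts all relations in weights above `i`.
  have key : ∀ i : ℕ, IsGradedFamily 𝒜 (F i).Z ∧ RegInf 𝒜 w (i + 1) (F i).Z ∧
      (∀ j, w ((F i).deg j) = i) ∧ ∀ γ, (F i).Z γ ≠ ⊥ → (i : ℤ) < w γ := by
    intro i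
    induction i with
    | zero =>
      refine ⟨Stage.isGradedFamily_ofIdeal hI, fun p => ?_, fun j => map_zero w, fun γ hγ => ?_⟩
      · rw [Nat.cast_zero, zero_add]
        exact (Stage.reg_ofIdeal_iff hI).2 (h p)
      · refine hIw γ fun hb => hγ (eq_bot_iff.2 fun x hx => ?_)
        rw [Submodule.mem_bot]
        funext j
        have : x j ∈ I γ := hx j trivial
        rwa [hb, Submodule.mem_bot] at this
    | succ i ih =>
      have hr : r i (F i) (F (i + 1)) := stages_spec (hex i ih.2.1)
      have hdeg : ∀ j, w ((F (i + 1)).deg j) = ((i + 1 : ℕ) : ℤ) := by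
        obtain ⟨m, hm⟩ := hr.1
        intro j
        refine le_antisymm (by exact_mod_cast hm.weight_le j) ?_
        have := ih.2.2.2 ((F (i + 1)).deg j) fun hb => hm.ne_zero j (by
          have := hm.generates.mem j
          rwa [hb, Submodule.mem_bot] at this)
        push_cast
        exact this
      have hlt : ∀ γ, (F (i + 1)).Z γ ≠ ⊥ → ((i + 1 : ℕ) : ℤ) < w γ := by
        intro γ hγ
        have := hr.lt_weight hw hw0 h0 (fun j => by rw [hdeg]; push_cast; rfl) hγ
        exact_mod_cast this
      obtain ⟨m, hm⟩ := hr.1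
      refine ⟨?_, ?_, hdeg, hlt⟩
      · rw [hm.eq_syz]
        exact isGradedFamily_syzFamily _ _
      · rw [hm.eq_syz]
        push_cast
        exact ih.2.1.syzFamily ih.1 hm.generates fun i => (hm.weight_le i).trans (by lia)
  exact ⟨F, rfl, fun i => (key i).2.2.1, fun i => (stages_spec (hex i (key i).2.1)).1⟩

end MinimalResolution

/-! ### From a family of subspaces to a Koszul subalgebra -/

section Subalgebra

variable {K : Type u} {R : Type v} [Field K] [CommRing R] [Algebra K R] {Γ : Type}
  [AddCommGroup Γ] {𝒜 : Γ → Submodule K R} [SetLike.GradedMonoid 𝒜] {w : Γ →+ ℤ}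
  {π : Γ → R →ₗ[K] R}

/-- An element whose components lie in a graded submodule is a combination of generators. -/
theorem Generates.exists_linearCombination_eq {X : Type v} [AddCommGroup X] [Module K X]
    [Module R X] [IsScalarTower K R X] {ℳ 𝒩 : Γ → Submodule K X} {ρ : Γ → X →ₗ[K] X}
    (hρ : IsProj 𝒩 ρ) {n : ℕ} {deg : Fin n → Γ} {m : Fin n → X} (hm : Generates 𝒜 ℳ deg m) {x : X}
    (hx : x ∈ ⨆ γ, 𝒩 γ) (h : ∀ γ, ρ γ x ∈ ℳ γ) :
    ∃ b : Fin n → R, (∀ i, b i ∈ ⨆ γ, 𝒜 γ) ∧ Fintype.linearCombination R m b = x := by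
  obtain ⟨s, hs⟩ := hρ.exists_sum hx
  choose a ha hax using fun γ => hm.exists_eq (h γ)
  refine ⟨∑ γ ∈ s, a γ, fun i => ?_, ?_⟩
  · rw [Finset.sum_apply]
    exact Submodule.sum_mem _ fun γ _ =>
      Submodule.mem_iSup_of_mem _ (mem_freeFamily.1 (ha γ) i)
  · rw [map_sum, Finset.sum_congr rfl fun γ _ => hax γ, hs s subset_rfl]

/-- The grading of a subalgebra of `R` by the weight. -/
theorem isPositivelyGraded_of_isProj [Nontrivial R] (hπ : IsProj 𝒜 π)
    (hw : ∀ γ, 𝒜 γ ≠ ⊥ → 0 ≤ w γ) (hw0 : ∀ γ, 𝒜 γ ≠ ⊥ → w γ = 0 → γ = 0) (h0 : 𝒜 0 = 1)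
    {B : Subalgebra K R} (hB : Subalgebra.toSubmodule B = ⨆ γ, 𝒜 γ) {𝒢 : ℕ → Submodule K B}
    (h𝒢 : ∀ n : ℕ, 𝒢 n = (totFamily w 𝒜 n).comap B.val.toLinearMap) : IsPositivelyGraded 𝒢 := by
  have hmem : ∀ {n : ℕ} {x : B}, x ∈ 𝒢 n ↔ (x : R) ∈ totFamily w 𝒜 n := by
    intro n x
    rw [h𝒢]
    rfl
  have hmemB : ∀ x : B, (x : R) ∈ ⨆ γ, 𝒜 γ := fun x => hB ▸ x.2
  refine ⟨inferInstance, { one_mem := ?_, mul_mem := ?_ }, ?_, ?_⟩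
  · rw [hmem]
    exact SetLike.one_mem_graded (totFamily w 𝒜)
  · intro i j x y hx hy
    rw [hmem] at hx hy ⊢
    push_cast
    exact SetLike.mul_mem_graded hx hy
  · rw [DirectSum.isInternal_submodule_iff_iSupIndep_and_iSup_eq_top]
    constructor
    · intro n
      rw [Submodule.disjoint_def]
      intro x hx hx'
      refine Subtype.ext (hπ.eq_zero (hmemB x) fun γ => ?_)
      by_cases hγ : w γ = n
      · have : (⨆ j, ⨆ (_ : j ≠ n), 𝒢 j) ≤ LinearMap.ker (π γ ∘ₗ B.val.toLinearMap) := by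
          refine iSup₂_le fun j hj y hy => ?_
          exact hπ.apply_totFamily (by rw [hγ]; exact_mod_cast hj.symm) (hmem.1 hy)
        exact this hx'
      · exact hπ.apply_totFamily hγ (hmem.1 hx)
    · rw [eq_top_iff]
      rintro x -
      have : (⨆ γ, 𝒜 γ) ≤ (⨆ n, 𝒢 n).map B.val.toLinearMap := by
        refine iSup_le fun γ y hy => ?_
        by_cases hγ : 𝒜 γ = ⊥
        · rw [hγ, Submodule.mem_bot] at hy
          rw [hy]
          exact Submodule.zero_mem _
        · have hyB : y ∈ B := by
            rw [← Subalgebra.mem_toSubmodule, hB]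
            exact Submodule.mem_iSup_of_mem γ hy
          refine ⟨⟨y, hyB⟩, Submodule.mem_iSup_of_mem (w γ).toNat (hmem.2 ?_), rfl⟩
          rw [Int.toNat_of_nonneg (hw γ hγ)]
          exact le_totFamily γ hy
      obtain ⟨y, hy, hyx⟩ := this (hmemB x)
      obtain rfl : y = x := Subtype.ext hyx
      exact hy
  · ext x
    rw [hmem, Submodule.mem_one]
    have : totFamily w 𝒜 ((0 : ℕ) : ℤ) = 1 := by
      rw [← h0]
      refine le_antisymm (iSup₂_le fun γ hγ => ?_) ?_
      · by_cases hb : 𝒜 γ = ⊥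
        · rw [hb]
          exact bot_le
        · rw [hw0 γ hb (by simpa using hγ)]
      · have := le_totFamily (w := w) (ℳ := 𝒜) 0
        rwa [map_zero] at this
    rw [this, Submodule.mem_one]
    exact exists_congr fun k => ⟨fun h => Subtype.ext h, fun h => congrArg Subtype.val h⟩

/-- A subalgebra of `R` is Koszul if its maximal ideal satisfies `RegInf`. -/
theorem isKoszul_of_regInf [Nontrivial R] (hπ : IsProj 𝒜 π) (hw : ∀ γ, 𝒜 γ ≠ ⊥ → 0 ≤ w γ)
    (hw0 : ∀ γ, 𝒜 γ ≠ ⊥ → w γ = 0 → γ = 0) (h0 : 𝒜 0 = 1)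
    {B : Subalgebra K R} (hB : Subalgebra.toSubmodule B = ⨆ γ, 𝒜 γ) {𝒢 : ℕ → Submodule K B}
    (h𝒢 : ∀ n : ℕ, 𝒢 n = (totFamily w 𝒜 n).comap B.val.toLinearMap)
    (h : RegInf 𝒜 w 1 (posFamily 𝒜 w)) : IsKoszul 𝒢 := by
  refine ⟨isPositivelyGraded_of_isProj hπ hw hw0 h0 hB h𝒢, ?_⟩
  have hmem : ∀ {n : ℕ} {x : B}, x ∈ 𝒢 n ↔ (x : R) ∈ totFamily w 𝒜 n := by
    intro n x
    rw [h𝒢]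
    rfl
  have hmemB : ∀ {r : R}, r ∈ B ↔ r ∈ ⨆ γ, 𝒜 γ := fun {r} => by
    rw [← hB, Subalgebra.mem_toSubmodule]
  have hIgr : IsGradedFamily 𝒜 (posFamily 𝒜 w) := isGradedFamily_posFamily hw
  obtain ⟨F, hF0, hdeg, hF⟩ := exists_linear_stages hIgr hw hw0 h0 (fun γ hγ => by
    by_contra hn
    exact hγ (posFamily_of_not_pos hn)) h
  choose m hm using hF
  have hZ0 : ∀ γ x, x ∈ (F 0).Z γ ↔ ∀ j, x j ∈ posFamily 𝒜 w γ := by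
    rw [hF0]
    exact fun γ x => ⟨fun h i => h i trivial, fun h i _ => h i⟩
  have hdeg0 : ∀ j, (F 0).deg j = 0 := by
    rw [hF0]
    exact fun _ => rfl
  have hmfree : ∀ i j, m i j ∈ freeFamily 𝒜 (F i).deg ((F (i + 1)).deg j) := by
    intro i j
    have h2 := (hm i).generates.mem j
    cases i with
    | zero =>
      refine mem_freeFamily.2 fun l => ?_
      rw [hdeg0, sub_zero]
      exact posFamily_le _ _ ((hZ0 _ _).1 h2 l)
    | succ i =>
      rw [(hm i).eq_syz, mem_syzFamily] at h2
      exact mem_freeFamily.2 h2.1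
  have hentry : ∀ i j l, m i j l ∈ totFamily w 𝒜 1 := by
    intro i j l
    have h1 := le_totFamily (w := w) _ (mem_freeFamily.1 (hmfree i j) l)
    rw [map_sub, hdeg, hdeg] at h1
    convert h1 using 1
    push_cast
    ring_nf
  -- Consecutive bases differ in weight by one, so all matrix entries have weight one and lie in
  -- `B`. The matrices therefore define `B`-linear maps that preserve degrees.
  let mB : ∀ i, Fin (F (i + 1)).n → Fin (F i).n → B := fun i j l =>
    ⟨m i j l, hmemB.2 (totFamily_le _ (hentry i j l))⟩
  have hval : ∀ i (v : Fin (F (i + 1)).n → B) l,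
      ((Fintype.linearCombination B (mB i) v l : B) : R) =
        Fintype.linearCombination R (m i) (fun j => (v j : R)) l := by
    intro i v l
    simp [Fintype.linearCombination_apply, mB, Finset.sum_apply]
  have hval' : ∀ i (v : Fin (F (i + 1)).n → B) (u : Fin (F i).n → B),
      Fintype.linearCombination B (mB i) v = u ↔
        Fintype.linearCombination R (m i) (fun j => (v j : R)) = fun l => (u l : R) := by
    intro i v u
    simp only [funext_iff, ← hval, Subtype.ext_iff]
  -- homogeneous exactness implies exactness
  have hex : ∀ i (u : Fin (F i).n → B),
      (∀ γ, freeProj π (F i).deg γ (fun l => (u l : R)) ∈ (F i).Z γ) →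
      ∃ v, Fintype.linearCombination B (mB i) v = u := by
    intro i u hu
    obtain ⟨b, hb, hbu⟩ := (hm i).generates.exists_linearCombination_eq
      (hπ.freeProj (F i).deg) (mem_iSup_freeFamily fun l => hmemB.1 (u l).2) hu
    exact ⟨fun j => ⟨b j, hmemB.2 (hb j)⟩, (hval' _ _ _).2 hbu⟩
  have hn0 : (F 0).n = 1 := by rw [hF0]
  let e : Fin (F 0).n := ⟨0, by rw [hn0]; exact one_pos⟩
  have he : ∀ l, l = e := fun l => by
    have : Subsingleton (Fin (F 0).n) := by rw [hn0]; infer_instance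
    exact Subsingleton.elim _ _
  have hirr : ∀ x ∈ irrelevantIdeal 𝒢, (x : R) ∈ ⨆ γ, posFamily 𝒜 w γ := by
    have hmul : ∀ r ∈ ⨆ γ, 𝒜 γ, ∀ s ∈ ⨆ γ, posFamily 𝒜 w γ, r * s ∈ ⨆ γ, posFamily 𝒜 w γ := by
      intro r hr s hs
      have : (⨆ γ, 𝒜 γ) * (⨆ γ, posFamily 𝒜 w γ) ≤ ⨆ γ, posFamily 𝒜 w γ := by
        rw [Submodule.iSup_mul]
        refine iSup_le fun γ => ?_
        rw [Submodule.mul_iSup]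
        exact iSup_le fun δ => Submodule.mul_le.2 fun r hr s hs =>
          Submodule.mem_iSup_of_mem (γ + δ) (hIgr hr hs)
      exact this (Submodule.mul_mem_mul hr hs)
    intro x hx
    induction hx using Submodule.span_induction with
    | mem x hx =>
      obtain ⟨i, hi, hx⟩ := hx
      refine (?_ : totFamily w 𝒜 i ≤ _) (hmem.1 hx)
      refine iSup₂_le fun γ hγ => ?_
      rw [← posFamily_of_pos (𝒜 := 𝒜) (w := w) (γ := γ) (by rw [hγ]; exact_mod_cast hi)]
      exact le_iSup (posFamily 𝒜 w) γ
    | zero => exact Submodule.zero_mem _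
    | add x y _ _ hx hy => exact Submodule.add_mem _ hx hy
    | smul b x _ hx => exact hmul _ (hmemB.1 b.2) _ hx
  refine ⟨{
    rank := fun i => (F i).n
    d := fun i => Fintype.linearCombination B (mB i)
    ε := (Submodule.mkQ (irrelevantIdeal 𝒢)).comp (LinearMap.proj e)
    d_degree := ?_
    ε_surjective := ?_
    exact_zero := ?_
    exact_succ := ?_ }⟩
  · intro i n v hv
    rw [shiftedFreeComponent] at hv ⊢
    split_ifs at hv with hn
    · rw [if_pos (by lia)]
      intro l _
      rw [SetLike.mem_coe, hmem, hval, Fintype.linearCombination_apply, Finset.sum_apply]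
      refine Submodule.sum_mem _ fun j _ => ?_
      have h1 : v j ∈ 𝒢 (n - (i + 1)) := hv j trivial
      have h2 := SetLike.mul_mem_graded (hmem.1 h1) (hentry i j l)
      convert h2 using 2
      · lia
      · rfl
    · rw [(Submodule.mem_bot K).1 hv, map_zero]
      exact Submodule.zero_mem _
  · intro y
    obtain ⟨x, rfl⟩ := Submodule.mkQ_surjective _ y
    exact ⟨fun _ => x, rfl⟩
  · intro u
    rw [LinearMap.comp_apply, Submodule.mkQ_apply, Submodule.Quotient.mk_eq_zero]
    constructor
    · intro hu
      refine hex 0 u fun γ => (hZ0 _ _).2 fun j => ?_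
      rw [freeProj_apply, hdeg0, sub_zero, he j]
      exact (hπ.mono (posFamily_le w)).mem γ (hirr _ hu)
    · rintro ⟨v, rfl⟩
      rw [LinearMap.proj_apply, Fintype.linearCombination_apply, Finset.sum_apply]
      refine Ideal.sum_mem _ fun j _ => Ideal.mul_mem_left _ _ (Ideal.subset_span ?_)
      exact ⟨1, one_pos, hmem.2 (hentry 0 j e)⟩
  · intro i u
    constructor
    · intro hu
      refine hex (i + 1) u fun γ => ?_
      rw [(hm i).eq_syz, mem_syzFamily, ← mem_freeFamily]
      have hu' : ∀ l, (u l : R) ∈ ⨆ γ, 𝒜 γ := fun l => hmemB.1 (u l).2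
      refine ⟨mem_freeFamily.2 fun l => hπ.mem _ (hu' l), ?_⟩
      rw [← hπ.linearCombination (hπ.freeProj (F i).deg) (isGradedFamily_freeFamily _) (hmfree i)
        hu', (hval' _ _ 0).1 hu]
      exact map_zero _
    · rintro ⟨v, rfl⟩
      rw [hval' _ _ 0]
      simp only [hval]
      have h1 : ∀ j, Fintype.linearCombination R (m i) (m (i + 1) j) = 0 := by
        intro j
        have := (hm (i + 1)).generates.mem j
        rw [(hm i).eq_syz, mem_syzFamily] at this
        exact this.2
      change Fintype.linearCombination R (m i) (Fintype.linearCombination R (m (i + 1)) _) = 0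
      rw [Fintype.linearCombination_apply R (m (i + 1)), map_sum]
      exact Finset.sum_eq_zero fun j _ => by rw [map_smul, h1, smul_zero]

end Subalgebra

/-! ### Passage to degrees in `ℤ × ℤ` -/

section IntegralDegrees

variable {K : Type u} {R : Type v} [Field K] [CommRing R] [Algebra K R]

open Classical in
/-- The extension by zero of a family indexed by `ℕ × ℕ` to a family indexed by `ℤ × ℤ`. -/
noncomputable def intFamily (𝓡 : ℕ × ℕ → Submodule K R) (γ : ℤ × ℤ) : Submodule K R :=
  if 0 ≤ γ then 𝓡 (γ.1.toNat, γ.2.toNat) else ⊥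

variable {𝓡 : ℕ × ℕ → Submodule K R} {π : ℕ × ℕ → R →ₗ[K] R}

theorem intFamily_natCast (i j : ℕ) : intFamily 𝓡 (i, j) = 𝓡 (i, j) :=
  if_pos (Prod.le_def.2 ⟨Int.natCast_nonneg i, Int.natCast_nonneg j⟩)

theorem nonneg_of_intFamily_ne_bot (γ : ℤ × ℤ) (h : intFamily 𝓡 γ ≠ ⊥) : 0 ≤ γ := by
  by_contra h0
  exact h (if_neg h0)

theorem exists_natCast_eq {γ : ℤ × ℤ} (h : 0 ≤ γ) : ∃ i j : ℕ, γ = ((i : ℤ), (j : ℤ)) :=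
  ⟨γ.1.toNat, γ.2.toNat, Prod.ext (Int.toNat_of_nonneg h.1).symm (Int.toNat_of_nonneg h.2).symm⟩

theorem eq_natCast_of_mem_intFamily {γ : ℤ × ℤ} {r : R} (hr : r ∈ intFamily 𝓡 γ) :
    r = 0 ∨ ∃ i j : ℕ, γ = ((i : ℤ), (j : ℤ)) := by
  by_cases h : intFamily 𝓡 γ = ⊥
  · rw [h, Submodule.mem_bot] at hr
    exact Or.inl hr
  · exact Or.inr (exists_natCast_eq (nonneg_of_intFamily_ne_bot γ h))

instance intFamily.gradedMonoid [SetLike.GradedMonoid 𝓡] :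
    SetLike.GradedMonoid (intFamily 𝓡) where
  one_mem := by
    have := SetLike.one_mem_graded 𝓡
    rwa [Prod.zero_eq_mk, ← intFamily_natCast (𝓡 := 𝓡)] at this
  mul_mem := by
    intro γ δ r s hr hs
    rcases eq_natCast_of_mem_intFamily hr with rfl | ⟨i, j, rfl⟩
    · rw [zero_mul]
      exact Submodule.zero_mem _
    rcases eq_natCast_of_mem_intFamily hs with rfl | ⟨k, l, rfl⟩
    · rw [mul_zero]
      exact Submodule.zero_mem _
    rw [intFamily_natCast] at hr hs
    rw [Prod.mk_add_mk, ← Nat.cast_add, ← Nat.cast_add, intFamily_natCast]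
    exact SetLike.mul_mem_graded hr hs

theorem iSup_intFamily : ⨆ γ, intFamily 𝓡 γ = ⨆ p, 𝓡 p := by
  refine le_antisymm (iSup_le fun γ r hr => ?_) (iSup_le fun p => ?_)
  · rcases eq_natCast_of_mem_intFamily hr with rfl | ⟨i, j, rfl⟩
    · exact Submodule.zero_mem _
    · rw [intFamily_natCast] at hr
      exact Submodule.mem_iSup_of_mem _ hr
  · rw [← Prod.mk.eta (p := p), ← intFamily_natCast (𝓡 := 𝓡)]
    exact le_iSup (intFamily 𝓡) _

theorem IsProj.exists_intFamily (hπ : IsProj 𝓡 π) : ∃ π', IsProj (intFamily 𝓡) π' := by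
  refine hπ.exists_extend (f := fun p => ((p.1 : ℤ), (p.2 : ℤ)))
    (fun p => intFamily_natCast p.1 p.2) fun γ hγ => ?_
  by_contra h
  obtain ⟨i, j, rfl⟩ := exists_natCast_eq (nonneg_of_intFamily_ne_bot γ h)
  exact hγ ⟨(i, j), rfl⟩

theorem totFamily_intFamily (n : ℕ) :
    totFamily totalWeight (intFamily 𝓡) n = totalGrading 𝓡 n := by
  refine le_antisymm (iSup₂_le fun γ hγ r hr => ?_) (iSup₂_le fun p hp => ?_)
  · rcases eq_natCast_of_mem_intFamily hr with rfl | ⟨i, j, rfl⟩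
    · exact Submodule.zero_mem _
    · rw [intFamily_natCast] at hr
      refine (le_iSup₂_of_le (i, j) ?_ le_rfl : 𝓡 (i, j) ≤ totalGrading 𝓡 n) hr
      rw [Finset.HasAntidiagonal.mem_antidiagonal]
      rw [totalWeight_apply] at hγ
      dsimp only at hγ ⊢
      exact_mod_cast hγ
  · rw [Finset.HasAntidiagonal.mem_antidiagonal] at hp
    rw [← Prod.mk.eta (p := p), ← intFamily_natCast (𝓡 := 𝓡), ← hp]
    refine (le_totFamily (w := totalWeight) _).trans_eq ?_
    rw [totalWeight_apply]
    push_cast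
    rfl

theorem totFamily_intFamily_of_neg {k : ℤ} (hk : k < 0) :
    totFamily totalWeight (intFamily 𝓡) k = ⊥ := by
  rw [totFamily, iSup₂_eq_bot]
  intro γ hγ
  by_contra h
  have := Prod.le_def.1 (nonneg_of_intFamily_ne_bot γ h)
  rw [totalWeight_apply] at hγ
  simp only [Prod.fst_zero, Prod.snd_zero] at this
  lia

theorem totalWeight_nonneg {γ : ℤ × ℤ} (h : 0 ≤ γ) : 0 ≤ totalWeight γ :=
  add_nonneg h.1 h.2

variable [SetLike.GradedMonoid 𝓡]

/-- The given resolution respects the total degree only, and `reg_of_totFamily` is what makes it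
bigraded. -/
theorem IsKoszul.regInf_intFamily (h : IsKoszul (totalGrading 𝓡)) (hπ : IsProj 𝓡 π)
    (htop : ⨆ p, 𝓡 p = ⊤) :
    RegInf (intFamily 𝓡) totalWeight 1 (posFamily (intFamily 𝓡) totalWeight) := by
  obtain ⟨hgr, ⟨L⟩⟩ := h
  obtain ⟨ρ, hρ⟩ := exists_isProj_of_isInternal hgr.isInternal
  obtain ⟨ρ', hρ'⟩ := hρ.exists_extend (f := fun n : ℕ => (n : ℤ))
    (ℳ' := totFamily totalWeight (intFamily 𝓡)) totFamily_intFamily fun k hk =>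
      totFamily_intFamily_of_neg (not_le.1 fun h0 => hk ⟨k.toNat, Int.toNat_of_nonneg h0⟩)
  obtain ⟨π', hπ'⟩ := hπ.exists_intFamily
  have htop' : ⨆ γ, intFamily 𝓡 γ = ⊤ := iSup_intFamily.trans htop
  have h1 := L.regInf totFamily_intFamily (fun k hk => totFamily_intFamily_of_neg hk) hρ'
    (iSup_totFamily.trans htop')
  rw [← totFamily_posFamily] at h1
  exact fun p => reg_of_totFamily hπ' htop' (hπ'.mono (posFamily_le _))
    (isGradedFamily_posFamily fun γ hγ => totalWeight_nonneg (nonneg_of_intFamily_ne_bot γ hγ))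
    (h1 p)

/-- Slices of a Koszul algebra along a cone of degrees are Koszul. -/
theorem IsKoszul.slice (h : IsKoszul (totalGrading 𝓡)) (hπ : IsProj 𝓡 π)
    (htop : ⨆ p, 𝓡 p = ⊤) {Γ : Type} [AddCommGroup Γ] {φ : Γ →+ ℤ × ℤ} {C : AddSubmonoid Γ}
    {w : Γ →+ ℤ} (hC : IsSliceCone φ C w) (hinj : ∀ x ∈ C, ∀ y ∈ C, φ x = φ y → x = y)
    (hw : ∀ x ∈ C, x ≠ 0 → 0 < w x) {B : Subalgebra K R}
    (hB : Subalgebra.toSubmodule B = ⨆ x, BigradedKoszul.slice φ C (intFamily 𝓡) 0 x)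
    {𝒢 : ℕ → Submodule K B} (h𝒢 : ∀ n : ℕ, 𝒢 n =
      (totFamily w (BigradedKoszul.slice φ C (intFamily 𝓡) 0) n).comap B.val.toLinearMap) :
    IsKoszul 𝒢 := by
  classical
  have := h.1.nontrivial
  obtain ⟨π', hπ'⟩ := hπ.exists_intFamily
  have hmemC : ∀ {x}, BigradedKoszul.slice φ C (intFamily 𝓡) 0 x ≠ ⊥ → x ∈ C := by
    intro x hx
    by_contra h0
    exact hx (slice_of_notMem h0)
  have hle : ∀ x, BigradedKoszul.slice φ C (intFamily 𝓡) 0 x ≤ intFamily 𝓡 (φ x) := by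
    intro x
    by_cases hx : x ∈ C
    · rw [slice_of_mem hx, add_zero]
    · rw [slice_of_notMem hx]
      exact bot_le
  have hproj : IsProj (BigradedKoszul.slice φ C (intFamily 𝓡) 0)
      (fun x => if x ∈ C then π' (φ x) else 0) := by
    refine ⟨fun x r hr => ?_, fun x y r hr hne => ?_⟩ <;> by_cases hx : x ∈ C
    · rw [if_pos hx, hπ'.apply_self (hle _ hr)]
    · rw [slice_of_notMem hx, Submodule.mem_bot] at hr
      rw [hr, map_zero]
    · by_cases hy : y ∈ C
      · rw [if_pos hx, hπ'.apply_ne (hle _ hr) fun h => hne (hinj y hy x hx h)]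
      · rw [slice_of_notMem hy, Submodule.mem_bot] at hr
        rw [hr, map_zero]
    · rw [if_neg hx, LinearMap.zero_apply]
  refine isKoszul_of_regInf hproj (w := w) ?_ ?_ ?_ hB h𝒢 ?_
  · intro x hx
    rcases eq_or_ne x 0 with rfl | h0
    · rw [map_zero]
    · exact (hw x (hmemC hx) h0).le
  · intro x hx hwx
    by_contra h0
    exact (hw x (hmemC hx) h0).ne' hwx
  · rw [slice_of_mem C.zero_mem, map_zero, add_zero]
    have h1 := h.1.degree_zero
    have h2 := intFamily_natCast (𝓡 := 𝓡) 0 0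
    rw [totalGrading, Finset.Nat.antidiagonal_zero] at h1
    simp only [Finset.mem_singleton, iSup_iSup_eq_left] at h1
    rw [h1] at h2
    exact h2
  · convert regInf_slice_posFamily (C := C) (𝓡 := intFamily 𝓡) nonneg_of_intFamily_ne_bot hC
      (h.regInf_intFamily hπ htop) using 1
    funext x
    by_cases hx : x ∈ C
    -- On `C` both conditions mean `x ≠ 0`, so the maximal ideal of the slice algebra is the slice
    -- of the maximal ideal of `R`.
    · have hiff : 0 < w x ↔ 0 < totalWeight (φ x) := by
        rcases eq_or_ne x 0 with rfl | h0
        · simp only [map_zero]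
        · refine iff_of_true (hw x hx h0) ((totalWeight_nonneg (hC.nonneg x hx)).lt_of_ne ?_)
          intro h1
          have h2 := Prod.le_def.1 (hC.nonneg x hx)
          simp only [Prod.fst_zero, Prod.snd_zero] at h2
          rw [totalWeight_apply] at h1
          refine h0 (hinj x hx 0 C.zero_mem ?_)
          rw [map_zero]
          exact Prod.ext (by simp only [Prod.fst_zero]; lia) (by simp only [Prod.snd_zero]; lia)
      rw [slice_of_mem hx, add_zero]
      by_cases h1 : 0 < w x
      · rw [posFamily_of_pos h1, posFamily_of_pos (hiff.1 h1), slice_of_mem hx, add_zero]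
      · rw [posFamily_of_not_pos h1, posFamily_of_not_pos fun h2 => h1 (hiff.2 h2)]
    · rw [slice_of_notMem hx]
      exact eq_bot_iff.2 ((posFamily_le _ _).trans_eq (slice_of_notMem hx))

end IntegralDegrees

/-! ### Diagonal subalgebras -/

section Diagonal

variable {K : Type u} {R : Type v} [Field K] [CommRing R] [Algebra K R]
  {𝓡 : ℕ × ℕ → Submodule K R} [SetLike.GradedMonoid 𝓡] {π : ℕ × ℕ → R →ₗ[K] R} {a b : ℕ}

/-- `x ↦ (xa, xb)`. -/
def intDiagonalMap (a b : ℕ) : ℤ →+ ℤ × ℤ where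
  toFun x := (x * a, x * b)
  map_zero' := by simp
  map_add' x y := by simp [add_mul]

/-- If a negative coordinate of `γ` is multiplied by `a = 0` or `b = 0`, it never becomes
nonnegative. Otherwise `x₀ = 1` works: `x = 0` is excluded, and adding `(a, b)` raises each negative
coordinate by at least one. -/
theorem isSliceCone_intDiagonalMap (a b : ℕ) :
    IsSliceCone (intDiagonalMap a b) (AddSubmonoid.nonneg ℤ) (AddMonoidHom.id ℤ) := by
  refine ⟨fun x hx => Prod.le_def.2 ⟨mul_nonneg hx (Int.natCast_nonneg a),
    mul_nonneg hx (Int.natCast_nonneg b)⟩, fun γ hγ => ?_⟩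
  by_cases h : (γ.1 < 0 ∧ a = 0) ∨ (γ.2 < 0 ∧ b = 0)
  · refine Or.inl fun x _ hx => ?_
    rw [Prod.le_def] at hx
    rcases h with ⟨h, rfl⟩ | ⟨h, rfl⟩
    · have : 0 ≤ x * ((0 : ℕ) : ℤ) + γ.1 := hx.1
      simp at this
      lia
    · have : 0 ≤ x * ((0 : ℕ) : ℤ) + γ.2 := hx.2
      simp at this
      lia
  · refine Or.inr ⟨1, by simp, rfl, fun x hx hx' => ?_, ?_⟩
    · rw [AddSubmonoid.mem_nonneg] at hx ⊢
      have : x ≠ 0 := by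
        rintro rfl
        rw [map_zero, zero_add] at hx'
        exact hγ hx'
      lia
    · rw [Prod.le_def] at hγ
      simp only [negWeight, intDiagonalMap, AddMonoidHom.coe_mk, ZeroHom.coe_mk, Prod.fst_add,
        Prod.snd_add, Prod.fst_zero, Prod.snd_zero] at *
      lia

theorem slice_intDiagonalMap (i : ℕ) : slice (intDiagonalMap a b) (AddSubmonoid.nonneg ℤ)
    (intFamily 𝓡) 0 i = 𝓡 (i * a, i * b) := by
  rw [slice_of_mem (Int.natCast_nonneg i), add_zero, ← intFamily_natCast (𝓡 := 𝓡)]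
  push_cast
  rfl

theorem toSubmodule_diagonalSubalgebra : Subalgebra.toSubmodule (diagonalSubalgebra 𝓡 a b) =
    ⨆ x, slice (intDiagonalMap a b) (AddSubmonoid.nonneg ℤ) (intFamily 𝓡) 0 x := by
  change ⨆ i : ℕ, 𝓡 (i * a, i * b) = _
  refine le_antisymm (iSup_le fun i => ?_) (iSup_le fun x => ?_)
  · rw [← slice_intDiagonalMap (𝓡 := 𝓡)]
    exact le_iSup (slice (intDiagonalMap a b) (AddSubmonoid.nonneg ℤ) (intFamily 𝓡) 0) _
  · by_cases hx : 0 ≤ x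
    · lift x to ℕ using hx
      rw [slice_intDiagonalMap]
      exact le_iSup (fun i : ℕ => 𝓡 (i * a, i * b)) x
    · rw [slice_of_notMem hx]
      exact bot_le

theorem totFamily_id {ℳ : ℤ → Submodule K R} (k : ℤ) :
    totFamily (AddMonoidHom.id ℤ) ℳ k = ℳ k := by
  simp [totFamily]

/-- Diagonal subalgebras of Koszul algebras are Koszul. -/
theorem IsKoszul.diagonalGrading (h : IsKoszul (totalGrading 𝓡)) (hπ : IsProj 𝓡 π)
    (htop : ⨆ p, 𝓡 p = ⊤) (hab : (a, b) ≠ (0, 0)) :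
    IsKoszul (BigradedKoszul.diagonalGrading 𝓡 a b) := by
  refine h.slice hπ htop (isSliceCone_intDiagonalMap a b) ?_ ?_ toSubmodule_diagonalSubalgebra ?_
  · intro x _ y _ hxy
    have h1 : x * a = y * a := congrArg Prod.fst hxy
    have h2 : x * b = y * b := congrArg Prod.snd hxy
    -- Injectivity of the degree map is what `(a, b) ≠ (0, 0)` provides.
    by_cases ha : a = 0
    · have hb : b ≠ 0 := fun hb => hab (by rw [ha, hb])
      exact mul_right_cancel₀ (Nat.cast_ne_zero.2 hb) h2
    · exact mul_right_cancel₀ (Nat.cast_ne_zero.2 ha) h1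
  · intro x hx h0
    exact lt_of_le_of_ne hx h0.symm
  · intro n
    rw [totFamily_id, slice_intDiagonalMap]
    rfl

end Diagonal

/-! ### Generalized Veronese subrings -/

section Veronese

variable {K : Type u} {R : Type v} [Field K] [CommRing R] [Algebra K R]
  {𝓡 : ℕ × ℕ → Submodule K R} [SetLike.GradedMonoid 𝓡] {π : ℕ × ℕ → R →ₗ[K] R} {a b : ℕ}

/-- `(x, y) ↦ (xa, yb)`. -/
def intVeroneseMap (a b : ℕ) : ℤ × ℤ →+ ℤ × ℤ where
  toFun x := (x.1 * a, x.2 * b)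
  map_zero' := by simp
  map_add' x y := by simp [add_mul]

/-- The nonnegative degrees whose first (second) coordinate vanishes if `a = 0` (`b = 0`). -/
def veroneseCone (a b : ℕ) : AddSubmonoid (ℤ × ℤ) where
  carrier := {x | 0 ≤ x ∧ (a = 0 → x.1 = 0) ∧ (b = 0 → x.2 = 0)}
  zero_mem' := ⟨le_rfl, fun _ => rfl, fun _ => rfl⟩
  add_mem' := fun hx hy => ⟨add_nonneg hx.1 hy.1,
    fun h => by rw [Prod.fst_add, hx.2.1 h, hy.2.1 h, add_zero],
    fun h => by rw [Prod.snd_add, hx.2.2 h, hy.2.2 h, add_zero]⟩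

theorem mem_veroneseCone {x : ℤ × ℤ} :
    x ∈ veroneseCone a b ↔ 0 ≤ x ∧ (a = 0 → x.1 = 0) ∧ (b = 0 → x.2 = 0) := Iff.rfl

/-- The shift `x₀` is the unit vector of a negative coordinate of `γ`. If the multiplier of that
coordinate is zero, no degree of the cone makes it nonnegative. -/
theorem isSliceCone_intVeroneseMap (a b : ℕ) :
    IsSliceCone (intVeroneseMap a b) (veroneseCone a b) totalWeight := by
  refine ⟨fun x hx => Prod.le_def.2 ⟨mul_nonneg hx.1.1 (Int.natCast_nonneg a),
    mul_nonneg hx.1.2 (Int.natCast_nonneg b)⟩, fun γ hγ => ?_⟩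
  have hpos : ∀ {x c : ℤ} {k : ℕ}, c < 0 → 0 ≤ x → 0 ≤ x * k + c → 1 ≤ x := by
    intro x c k hc hx h
    have : x ≠ 0 := by
      rintro rfl
      rw [zero_mul] at h
      lia
    lia
  by_cases h1 : γ.1 < 0
  · by_cases ha : a = 0
    · refine Or.inl fun x hx hx' => ?_
      have : 0 ≤ x.1 * (a : ℤ) + γ.1 := hx'.1
      rw [hx.2.1 ha, zero_mul] at this
      lia
    · refine Or.inr ⟨(1, 0), ⟨Prod.le_def.2 (by simp), fun h => (ha h).elim, fun _ => rfl⟩, rfl,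
        fun x hx hx' => ⟨Prod.le_def.2 ⟨?_, ?_⟩, fun h => (ha h).elim, fun h => ?_⟩, ?_⟩
      · exact sub_nonneg.2 (hpos h1 hx.1.1 hx'.1)
      · simpa using hx.1.2
      · simpa using hx.2.2 h
      · simp only [negWeight, intVeroneseMap, AddMonoidHom.coe_mk, ZeroHom.coe_mk, Prod.fst_add,
          Prod.snd_add, zero_mul]
        lia
  · have h2 : γ.2 < 0 := by
      by_contra h2
      exact hγ (Prod.le_def.2 ⟨not_lt.1 h1, not_lt.1 h2⟩)
    by_cases hb : b = 0
    · refine Or.inl fun x hx hx' => ?_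
      have : 0 ≤ x.2 * (b : ℤ) + γ.2 := hx'.2
      rw [hx.2.2 hb, zero_mul] at this
      lia
    · refine Or.inr ⟨(0, 1), ⟨Prod.le_def.2 (by simp), fun _ => rfl, fun h => (hb h).elim⟩, rfl,
        fun x hx hx' => ⟨Prod.le_def.2 ⟨?_, ?_⟩, fun h => ?_, fun h => (hb h).elim⟩, ?_⟩
      · simpa using hx.1.1
      · exact sub_nonneg.2 (hpos h2 hx.1.2 hx'.2)
      · simpa using hx.2.1 h
      · simp only [negWeight, intVeroneseMap, AddMonoidHom.coe_mk, ZeroHom.coe_mk, Prod.fst_add,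
          Prod.snd_add, zero_mul]
        lia

theorem slice_intVeroneseMap {i j : ℕ} (h : ((i : ℤ), (j : ℤ)) ∈ veroneseCone a b) :
    slice (intVeroneseMap a b) (veroneseCone a b) (intFamily 𝓡) 0 (i, j) =
      𝓡 (i * a, j * b) := by
  rw [slice_of_mem h, add_zero, ← intFamily_natCast (𝓡 := 𝓡)]
  push_cast
  rfl

theorem eq_natCast_of_mem_slice {x : ℤ × ℤ} {r : R}
    (hr : r ∈ slice (intVeroneseMap a b) (veroneseCone a b) (intFamily 𝓡) 0 x) :
    r = 0 ∨ ∃ i j : ℕ, x = ((i : ℤ), (j : ℤ)) ∧ ((i : ℤ), (j : ℤ)) ∈ veroneseCone a b := by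
  by_cases hx : x ∈ veroneseCone a b
  · obtain ⟨i, j, rfl⟩ := exists_natCast_eq hx.1
    exact Or.inr ⟨i, j, rfl, hx⟩
  · rw [slice_of_notMem hx, Submodule.mem_bot] at hr
    exact Or.inl hr

theorem toSubmodule_veroneseSubalgebra : Subalgebra.toSubmodule (veroneseSubalgebra 𝓡 a b) =
    ⨆ x, slice (intVeroneseMap a b) (veroneseCone a b) (intFamily 𝓡) 0 x := by
  change ⨆ p : ℕ × ℕ, 𝓡 (p.1 * a, p.2 * b) = _
  refine le_antisymm (iSup_le fun p => ?_) (iSup_le fun x r hr => ?_)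
  -- An index multiplied by zero may be replaced by zero, which moves the degree into the cone
  -- without changing the component.
  · have h1 : (if a = 0 then 0 else p.1) * a = p.1 * a := by split_ifs with h <;> simp [h]
    have h2 : (if b = 0 then 0 else p.2) * b = p.2 * b := by split_ifs with h <;> simp [h]
    rw [← h1, ← h2, ← slice_intVeroneseMap (𝓡 := 𝓡)]
    · exact le_iSup (slice (intVeroneseMap a b) (veroneseCone a b) (intFamily 𝓡) 0) _
    · refine ⟨Prod.le_def.2 ⟨Int.natCast_nonneg _, Int.natCast_nonneg _⟩, fun h => ?_, fun h => ?_⟩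
        <;> simp [h]
  · rcases eq_natCast_of_mem_slice hr with rfl | ⟨i, j, rfl, hij⟩
    · exact Submodule.zero_mem _
    · rw [slice_intVeroneseMap hij] at hr
      exact Submodule.mem_iSup_of_mem (i, j) hr

theorem totalGrading_veroneseBigrading (n : ℕ) :
    totalGrading (veroneseBigrading 𝓡 a b) n =
      (totFamily totalWeight (slice (intVeroneseMap a b) (veroneseCone a b) (intFamily 𝓡) 0)
        n).comap (veroneseSubalgebra 𝓡 a b).val.toLinearMap := by
  have hcone : ∀ i j : ℕ, ((i : ℤ), (j : ℤ)) ∈ veroneseCone a b ↔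
      ¬ ((a = 0 ∧ i ≠ 0) ∨ (b = 0 ∧ j ≠ 0)) := by
    intro i j
    have h0 : (0 : ℤ × ℤ) ≤ ((i : ℤ), (j : ℤ)) :=
      Prod.le_def.2 ⟨Int.natCast_nonneg _, Int.natCast_nonneg _⟩
    simp only [mem_veroneseCone, h0, true_and, Nat.cast_eq_zero]
    tauto
  refine le_antisymm (iSup₂_le fun p hp => ?_) ?_
  · rw [veroneseBigrading]
    split_ifs with h
    · exact bot_le
    · rw [Finset.HasAntidiagonal.mem_antidiagonal] at hp
      refine Submodule.comap_mono ?_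
      rw [← slice_intVeroneseMap (𝓡 := 𝓡) ((hcone _ _).2 h), ← hp]
      refine (le_totFamily (w := totalWeight) _).trans_eq ?_
      rw [totalWeight_apply]
      push_cast
      rfl
  · have hle : totFamily totalWeight (slice (intVeroneseMap a b) (veroneseCone a b)
        (intFamily 𝓡) 0) n ≤ (totalGrading (veroneseBigrading 𝓡 a b) n).map
          (veroneseSubalgebra 𝓡 a b).val.toLinearMap := by
      refine iSup₂_le fun x hx r hr => ?_
      rcases eq_natCast_of_mem_slice hr with rfl | ⟨i, j, rfl, hij⟩
      · exact Submodule.zero_mem _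
      · rw [slice_intVeroneseMap hij] at hr
        have hrB : r ∈ veroneseSubalgebra 𝓡 a b := by
          change r ∈ ⨆ p : ℕ × ℕ, 𝓡 (p.1 * a, p.2 * b)
          exact Submodule.mem_iSup_of_mem (i, j) hr
        refine ⟨⟨r, hrB⟩, ?_, rfl⟩
        refine (le_iSup₂_of_le (i, j) ?_ le_rfl : veroneseBigrading 𝓡 a b (i, j) ≤ _) ?_
        · rw [Finset.HasAntidiagonal.mem_antidiagonal]
          rw [totalWeight_apply] at hx
          dsimp only at hx ⊢
          exact_mod_cast hx
        · rw [veroneseBigrading, if_neg ((hcone i j).1 hij)]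
          exact hr
    intro x hx
    obtain ⟨y, hy, hyx⟩ := hle hx
    obtain rfl : y = x := Subtype.ext hyx
    exact hy

/-- Generalized Veronese subrings of Koszul algebras are Koszul. -/
theorem IsKoszul.veroneseBigrading (h : IsKoszul (totalGrading 𝓡)) (hπ : IsProj 𝓡 π)
    (htop : ⨆ p, 𝓡 p = ⊤) :
    IsKoszul (totalGrading (BigradedKoszul.veroneseBigrading 𝓡 a b)) := by
  refine h.slice hπ htop (isSliceCone_intVeroneseMap a b) ?_ ?_ toSubmodule_veroneseSubalgebra
    totalGrading_veroneseBigrading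
  · intro x hx y hy hxy
    have h1 : x.1 * a = y.1 * a := congrArg Prod.fst hxy
    have h2 : x.2 * b = y.2 * b := congrArg Prod.snd hxy
    refine Prod.ext ?_ ?_
    · by_cases ha : a = 0
      · rw [hx.2.1 ha, hy.2.1 ha]
      · exact mul_right_cancel₀ (Nat.cast_ne_zero.2 ha) h1
    · by_cases hb : b = 0
      · rw [hx.2.2 hb, hy.2.2 hb]
      · exact mul_right_cancel₀ (Nat.cast_ne_zero.2 hb) h2
  · intro x hx h0
    refine (totalWeight_nonneg hx.1).lt_of_ne fun h1 => h0 ?_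
    have h2 := Prod.le_def.1 hx.1
    simp only [Prod.fst_zero, Prod.snd_zero] at h2
    rw [totalWeight_apply] at h1
    exact Prod.ext (by simp only [Prod.fst_zero]; lia) (by simp only [Prod.snd_zero]; lia)

end Veronese

/-! ### The bigraded quotient of the polynomial ring -/

section Quotient

/-- Homogeneity of `J` enters here: the projections of `S` map `J` into itself and so descend to `S
⧸ J`. -/
theorem exists_isProj_quotient {K : Type u} {S : Type v} [Field K] [CommRing S] [Algebra K S]
    {ι : Type*} [DecidableEq ι] [AddMonoid ι] (𝒮 : ι → Submodule K S) [GradedAlgebra 𝒮]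
    {J : Ideal S} (hJ : J.IsHomogeneous 𝒮) :
    ∃ π, IsProj (fun i => (𝒮 i).map (Ideal.Quotient.mkₐ K J).toLinearMap) π := by
  obtain ⟨ρ, hρ⟩ : ∃ ρ : ι → S →ₗ[K] S, ∀ i s, ρ i s = (DirectSum.decompose 𝒮 s i : S) :=
    ⟨fun i => (𝒮 i).subtype ∘ₗ DirectSum.component K ι _ i ∘ₗ
      (DirectSum.decomposeLinearEquiv 𝒮).toLinearMap, fun i s => rfl⟩
  let e := Submodule.Quotient.restrictScalarsEquiv K J
  have hker : ∀ i, J.restrictScalars K ≤ (J.restrictScalars K).comap (ρ i) := by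
    intro i s hs
    rw [Submodule.mem_comap, hρ]
    exact hJ i hs
  let π : ι → (S ⧸ J) →ₗ[K] (S ⧸ J) := fun i =>
    e.toLinearMap ∘ₗ Submodule.mapQ _ _ (ρ i) (hker i) ∘ₗ e.symm.toLinearMap
  have hπ : ∀ i s, π i (Ideal.Quotient.mkₐ K J s) = Ideal.Quotient.mkₐ K J (ρ i s) :=
    fun i s => rfl
  refine ⟨π, ?_, ?_⟩
  · rintro i _ ⟨s, hs, rfl⟩
    rw [AlgHom.toLinearMap_apply, hπ, hρ, DirectSum.decompose_of_mem_same 𝒮 hs]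
  · rintro i j _ ⟨s, hs, rfl⟩ hne
    rw [AlgHom.toLinearMap_apply, hπ, hρ, DirectSum.decompose_of_mem_ne 𝒮 hs hne, map_zero]

theorem iSup_quotientBigrading {K : Type u} [Field K] {n m : ℕ} (J : Ideal (PolyRing K n m)) :
    ⨆ p, quotientBigrading J p = ⊤ := by
  unfold quotientBigrading
  rw [← Submodule.map_iSup,
    (DirectSum.Decomposition.isInternal (polyBigrading K n m)).submodule_iSup_eq_top,
    Submodule.map_top, LinearMap.range_eq_top]
  exact Ideal.Quotient.mkₐ_surjective K J

end Quotient

end BigradedKoszul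

theorem theorem2p1 {K : Type u} [Field K] (n m : ℕ)
    (J : Ideal (BigradedKoszul.PolyRing K n m))
    (hJ : J.IsHomogeneous (BigradedKoszul.polyBigrading K n m))
    (hR : BigradedKoszul.IsKoszul
      (BigradedKoszul.totalGrading (BigradedKoszul.quotientBigrading J)))
    (a b : ℕ) (hab : (a, b) ≠ (0, 0)) :
    BigradedKoszul.IsKoszul
      (BigradedKoszul.diagonalGrading (BigradedKoszul.quotientBigrading J) a b) ∧
    BigradedKoszul.IsKoszul
      (BigradedKoszul.totalGrading
        (BigradedKoszul.veroneseBigrading (BigradedKoszul.quotientBigrading J) a b)) := by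
  obtain ⟨π, hπ⟩ := BigradedKoszul.exists_isProj_quotient (BigradedKoszul.polyBigrading K n m) hJ
  have htop := BigradedKoszul.iSup_quotientBigrading J
  exact ⟨hR.diagonalGrading hπ htop hab, hR.veroneseBigrading hπ htop⟩
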